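/- **Setting.** Let $A>0$, $x\ge 0$, $t\ge 0$, let $\mathbb H=\{\operatorname{Im}z>0\}$ and $\mathbb K=\mathbb H\setminus(0,iA]$, and let $\overline{\mathbb K}$ be the closure of $\mathbb K$, including $\infty$, in which the two sides $iy_+$, $iy_-$ ($0\le y<A$) of the slit are distinguished. Let $\mathbb F$ be the set of connected compact sets in $\overline{\mathbb K}$ that contain $0_+$ and $0_-$. Let $\rho^0$ be continuous on $\overline{\mathbb H}$ (including $\infty$), holomorphic in $\mathbb H$, with $\operatorname{Re}\rho^0=0$ on $[0,iA]$ and $\operatorname{Im}\rho^0>0$ on $(0,iA]\cup\mathbb R$, extended to the lower half-plane by $\rho^0(\eta^*)=\rho^0(\eta)^*$ ($^*$ is complex conjugation). Put $$V(z)=-\int_{-iA}^{iA}\log(z-\eta)\,\rho^0(\eta)\,d\eta-\Big(2ixz+2itz^2+i\pi\int_z^{iA}\rho^0(\eta)\,d\eta\Big),\qquad V_R=\operatorname{Re}V,$$ where the first integral is along $[-iA,iA]$, the branch of the logarithm jumping only across this segment, and the second is along the segments from $z$ to $0$ and from $0$ to $iA$. With $G(u,v)=\log\frac{|u-v^*|}{|u-v|}$,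 the weighted energy of a finite positive Borel measure $\nu$ on the closed upper half-plane is $E_{V_R}(\nu)=\iint G\,d\nu\,d\nu+2\int V_R\,d\nu$. For $F\in\mathbb F$ let $M(F)$ be the set of such measures, carried by the finite points of $F$, for which $\iint G\,d\nu\,d\nu<\infty$ and $V_R\in L^1(\nu)$. The equilibrium energy of $F$ is $\inf_{M(F)}E_{V_R}$, and an equilibrium measure $\lambda^F$ of $F$ is an element of $M(F)$ that attains it. Call $\Gamma\in\mathbb F$ *critical* if, for every $C^1$ vector field $k$ with compact support in $\mathbb K$, the derivative at $\tau=0$ ($\tau$ real) of the equilibrium energy of $\Gamma_\tau=\{z+\tau k(z):z\in\Gamma\}$ is zero wherever this derivative exists. **Theorem 6.** Let $\Gamma\in\mathbb F$ be critical, not tangent to $\mathbb R$ at $0$ (near $0$ it lies in a sector $\alpha\le\arg z\le\pi-\alpha$, $\alpha>0$), and meeting $[0,iA]$ only at $0$ (that is, only at $0_+$ and $0_-$). Suppose that $\Gamma$ has an equilibrium measure $\lambda^\Gamma$, and let $\mu$ be the signed measure on $\mathbb C$ that extends it by $\mu(z^*)=-\mu(z)$, that is, $\mu(B)=\lambda^\Gamma(B)-\lambda^\Gamma(B^*)$.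 Let $h$ be a complex-valued function that is $C^1$ (in the real sense) on an open neighbourhood of the finite points of $\Gamma\cup\Gamma^*$, with $h(0)=0$. If $\infty\in\Gamma$, suppose also that $h$, as a vector field on the Riemann sphere, is $C^1$ near $\infty$ and vanishes there ($w\mapsto w^2h(1/w)$, with value $0$ at $w=0$, is $C^1$ near $0$), and that $V'h\in L^1(|\mu|)$. Then $\frac{h(u)-h(v)}{u-v}\in L^1(|\mu|\times|\mu|)$, $V'h\in L^1(|\mu|)$, and $$\operatorname{Re}\iint\frac{h(u)-h(v)}{u-v}\,d\mu(u)\,d\mu(v)=2\operatorname{Re}\int V'(u)\,h(u)\,d\mu(u).$$ -/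

import Mathlib

open Set Filter Topology MeasureTheory
open scoped ENNReal

noncomputable section

/-! ### The slit upper half-plane and its closure -/

/-- The upper half-plane cut along the segment `(0, iA]`. -/
def slitHalfPlane (A : ℝ) : Set ℂ := {z | 0 < z.im ∧ ¬ (z.re = 0 ∧ z.im ≤ A)}

/-- The closure of the slit half-plane, in which the two sides of the slit are distinguished and to
which `∞` is added. The map `z ↦ w = √(z² + A²)` opens the slit: it carries the slit half-plane
onto the upper half-plane, its right and left sides `ix₊`, `ix₋` (`0 ≤ x < A`) to
`w = √(A² - x²)` and `w = -√(A² - x²)`, and it is a homeomorphism up to the boundary. So the closure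
is realised as the closure of the graph of this map in the product of two Riemann spheres; the last
inequality selects the branch of the square root on the real line. -/
def slitClosureSet (A : ℝ) : Set (OnePoint ℂ × OnePoint ℂ) :=
  {p | p = (OnePoint.infty, OnePoint.infty) ∨
    ∃ z w : ℂ, p = ((z : OnePoint ℂ), (w : OnePoint ℂ)) ∧
      0 ≤ z.im ∧ 0 ≤ w.im ∧ w ^ 2 = z ^ 2 + (A : ℂ) ^ 2 ∧ 0 ≤ z.re * w.re}

/-- The closure of the slit half-plane as a topological space. -/
abbrev SlitClosure (A : ℝ) : Type := ↥(slitClosureSet A)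

/-- The point of the Riemann sphere under a point of the closure of the slit half-plane. -/
def SlitClosure.point {A : ℝ} (p : SlitClosure A) : OnePoint ℂ := p.1.1

/-- The point `0₊`, on the right side of the slit. -/
def SlitClosure.zeroPlus (A : ℝ) : SlitClosure A :=
  ⟨(((0 : ℂ) : OnePoint ℂ), ((A : ℂ) : OnePoint ℂ)), Or.inr ⟨0, A, rfl, by simp⟩⟩

/-- The point `0₋`, on the left side of the slit. -/
def SlitClosure.zeroMinus (A : ℝ) : SlitClosure A :=
  ⟨(((0 : ℂ) : OnePoint ℂ), ((-A : ℂ) : OnePoint ℂ)), Or.inr ⟨0, -A, rfl, by simp⟩⟩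

/-- The continua (connected compact sets) in the closure of the slit half-plane that contain
`0₊` and `0₋`. -/
structure IsContinuum {A : ℝ} (Γ : Set (SlitClosure A)) : Prop where
  isCompact : IsCompact Γ
  isConnected : IsConnected Γ
  zeroPlus_mem : SlitClosure.zeroPlus A ∈ Γ
  zeroMinus_mem : SlitClosure.zeroMinus A ∈ Γ

/-- The continuum passes through `∞`. -/
def ContainsInfty {A : ℝ} (Γ : Set (SlitClosure A)) : Prop :=
  ∃ p ∈ Γ, p.point = OnePoint.infty

/-- The finite points of the complex plane that lie on the continuum. -/
def finitePart {A : ℝ} (Γ : Set (SlitClosure A)) : Set ℂ :=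
  {z | ∃ p ∈ Γ, p.point = (z : OnePoint ℂ)}

/-- The continuum meets the segment `[0, iA]` (on either side) only over the point `0`. -/
def MeetsSlitOnlyAtZero {A : ℝ} (Γ : Set (SlitClosure A)) : Prop :=
  ∀ s : ℝ, 0 ≤ s → s ≤ A → (s : ℂ) * Complex.I ∈ finitePart Γ → s = 0

/-- The continuum is not tangent to the real line at `0`: near `0` it lies in a sector
`α ≤ arg z ≤ π - α` with `0 < α`. -/
def NotTangentToReal {A : ℝ} (Γ : Set (SlitClosure A)) : Prop :=
  ∃ c > 0, ∃ δ > 0, ∀ z ∈ finitePart Γ, ‖z‖ < δ → c * ‖z‖ ≤ z.im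

/-! ### The external field -/

/-- The conditions on the density `ρ⁰`, a function on the closed upper half-plane including `∞`. -/
structure IsSpectralDensity (A : ℝ) (ρ : ℂ → ℂ) : Prop where
  holomorphic : DifferentiableOn ℂ ρ {z | 0 < z.im}
  continuousOn : ContinuousOn ρ {z | 0 ≤ z.im}
  continuous_infty : ∃ c : ℂ, Tendsto ρ (Bornology.cobounded ℂ ⊓ 𝓟 {z | 0 ≤ z.im}) (𝓝 c)
  re_segment : ∀ s ∈ Icc 0 A, (ρ (s * Complex.I)).re = 0
  im_segment : ∀ s ∈ Ioc 0 A, 0 < (ρ (s * Complex.I)).im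
  im_real : ∀ a : ℝ, 0 < (ρ a).im

/-- The extension of `ρ⁰` to the lower half-plane by `ρ⁰(η*) = ρ⁰(η)*`. -/
def reflectedDensity (ρ : ℂ → ℂ) (z : ℂ) : ℂ :=
  if 0 ≤ z.im then ρ z else starRingEnd ℂ (ρ (starRingEnd ℂ z))

/-- The integral `∫_z^{iA} ρ⁰(η) dη` of the extended density, along the segments from `z` to `0` and
from `0` to `iA`. -/
def tailIntegral (A : ℝ) (ρ : ℂ → ℂ) (z : ℂ) : ℂ :=
  (∫ s in (0 : ℝ)..1, reflectedDensity ρ (s * (A * Complex.I)) * (A * Complex.I)) -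
    ∫ s in (0 : ℝ)..1, reflectedDensity ρ (s * z) * z

/-- The complexified field
`V(z) = -∫_{-iA}^{iA} log(z-η) ρ⁰(η) dη - (2ixz + 2itz² + iπ ∫_z^{iA} ρ⁰(η) dη)`.
Since `ρ⁰(-η) = -ρ⁰(η)` on `[-iA, iA]`, the contributions of `η = is` and `-η = -is` to the first
integral combine into `log((z-η)/(z+η)) ρ⁰(η)`; the principal branch of this logarithm vanishes at
`z = ∞` and jumps only across `[-is, is]`. -/
def complexField (A : ℝ) (ρ : ℂ → ℂ) (x t : ℝ) (z : ℂ) : ℂ :=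
  -(∫ s in (0 : ℝ)..A,
      Complex.log ((z - s * Complex.I) / (z + s * Complex.I)) * ρ (s * Complex.I) * Complex.I) -
    (2 * Complex.I * x * z + 2 * Complex.I * t * z ^ 2
      + Complex.I * Real.pi * tailIntegral A ρ z)

/-- The external field `V_R = Re V`. -/
def externalField (A : ℝ) (ρ : ℂ → ℂ) (x t : ℝ) (z : ℂ) : ℝ := (complexField A ρ x t z).re

/-! ### Energies and equilibrium measures -/

/-- The Green function `log (|z-η*| / |z-η|)` of the upper half-plane for `z`, `η` in the closed
half-plane: `+∞` on the diagonal of the open half-plane, `0` when `z` or `η` is real. -/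
def greenFunction (z η : ℂ) : ℝ≥0∞ :=
  if z = η ∧ 0 < z.im then ⊤
  else ENNReal.ofReal (Real.log (‖z - starRingEnd ℂ η‖ / ‖z - η‖))

/-- The free Green energy `E(μ) = ∬ G(u,v) dμ(u) dμ(v)`. -/
def greenEnergy (μ : Measure ℂ) : ℝ≥0∞ := ∫⁻ u, ∫⁻ v, greenFunction u v ∂μ ∂μ

/-- The class `M(F)`: finite positive Borel measures carried by `F` whose free energy and whose
integral of the external field are finite. -/
structure IsAdmissibleMeasure (A : ℝ) (ρ : ℂ → ℂ) (x t : ℝ) (F : Set ℂ) (μ : Measure ℂ) :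
    Prop where
  finite : IsFiniteMeasure μ
  carried : μ Fᶜ = 0
  energy : greenEnergy μ ≠ ⊤
  integrable : Integrable (externalField A ρ x t) μ

/-- The weighted energy `E(μ) + 2 ∫ V_R dμ`. -/
def weightedEnergy (A : ℝ) (ρ : ℂ → ℂ) (x t : ℝ) (μ : Measure ℂ) : ℝ :=
  (greenEnergy μ).toReal + 2 * ∫ z, externalField A ρ x t z ∂μ

/-- `lam` is an equilibrium measure of `F`: it minimises the weighted energy over `M(F)`. -/
def IsEquilibriumMeasure (A : ℝ) (ρ : ℂ → ℂ) (x t : ℝ) (F : Set ℂ) (lam : Measure ℂ) : Prop :=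
  IsAdmissibleMeasure A ρ x t F lam ∧
    ∀ ν : Measure ℂ, IsAdmissibleMeasure A ρ x t F ν →
      weightedEnergy A ρ x t lam ≤ weightedEnergy A ρ x t ν

/-- `e` is the equilibrium energy of `F`: the (finite) infimum of the weighted energy over `M(F)`. -/
def IsEquilibriumEnergy (A : ℝ) (ρ : ℂ → ℂ) (x t : ℝ) (F : Set ℂ) (e : ℝ) : Prop :=
  IsGLB {r : ℝ | ∃ ν : Measure ℂ, IsAdmissibleMeasure A ρ x t F ν ∧
    r = weightedEnergy A ρ x t ν} e

/-- `Γ` is a critical point of the equilibrium energy: along every variation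
`Γ_τ = {z + τ k(z) : z ∈ Γ}`, with `k` a `C¹` vector field with compact support in the slit
half-plane (such a variation leaves `0₊`, `0₋`, `∞`, the real line and the slit fixed), the derivative
of the equilibrium energy of `Γ_τ` at `τ = 0`, wherever it exists, is zero. The parameter `τ` is real,
complex directions being obtained from the fields `c k` with `c` complex. -/
def IsCritical (A : ℝ) (ρ : ℂ → ℂ) (x t : ℝ) (Γ : Set (SlitClosure A)) : Prop :=
  ∀ k : ℂ → ℂ, ContDiff ℝ 1 k → HasCompactSupport k → tsupport k ⊆ slitHalfPlane A →
    ∀ e : ℝ → ℝ,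
      (∀ᶠ τ : ℝ in 𝓝 0,
        IsEquilibriumEnergy A ρ x t ((fun z : ℂ => z + τ * k z) '' finitePart Γ) (e τ)) →
      ∀ d : ℝ, HasDerivAt e d 0 → d = 0

/-- The extension of a measure on the closed upper half-plane to a signed measure on the plane that is
antisymmetric under complex conjugation, `μ(z*) = -μ(z)`. -/
def antisymmetricExtension (lam : Measure ℂ) [IsFiniteMeasure lam] : SignedMeasure ℂ :=
  lam.toSignedMeasure - (lam.map (starRingEnd ℂ)).toSignedMeasure

/-! ### Test fields -/

/-- `h` is a `C¹` (real differentiable) field near `Γ ∪ Γ*` which fixes `0`. If `Γ` contains `∞`, it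
is also `C¹` near `∞` as a vector field on the Riemann sphere, and fixes `∞`: in the coordinate
`w = 1/z` the field `h` reads, up to sign, `w² h(1/w)`. -/
def IsTestField {A : ℝ} (Γ : Set (SlitClosure A)) (h : ℂ → ℂ) : Prop :=
  h 0 = 0 ∧
  (∃ O : Set ℂ, IsOpen O ∧ finitePart Γ ⊆ O ∧ (starRingEnd ℂ) '' finitePart Γ ⊆ O ∧
    ContDiffOn ℝ 1 h O) ∧
  (ContainsInfty Γ → ContDiffAt ℝ 1 (fun w : ℂ => w ^ 2 * h w⁻¹) 0)

end

/-!
The proof turns the criticality of the continuum into a variational identity for its equilibrium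
measure `lam`, and then reads this identity off on the antisymmetric extension of `lam`.

*The energy is convex.* The Green function is, off the diagonal, an inner product of Poisson
kernels (`lintegral_poissonFeature_mul`), so the Green energy is positive semidefinite on signed
measures (`two_mul_mutualEnergy_le`) and defines a squared distance `energyDist`. Hence a competitor whose
energy is nearly minimal is close to `lam` in this distance (`energyDist_le_fieldEnergy_sub`).
Differences of potentials of concentric circles form an approximate identity whose integrals are
controlled by the distance. Convergence in energy therefore tests all continuous functions on the
half-plane that are bounded by a fixed potential, the weight `greenWeight`, which vanishes on the real
line and at infinity (`exists_energyDist_lt`).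

*The equilibrium energy is differentiable.* Along `z ↦ z + τ k(z)`, with `k` compactly supported in
the slit half-plane, the Green function and the field have first-order expansions whose errors are
uniform relative to the weight (`exists_greenReal_variation`, `exists_flowBounds`). A competitor that
beats the image of `lam` is close to `lam`, so its energy has nearly the same first-order term. This
is an envelope theorem (`FlowBounds.exists_hasDerivAt`): the equilibrium energy has at `τ = 0` the
derivative `energyVariation` of the energy of the image of `lam`, so for a critical continuum this
derivative is zero (`IsCritical.energyVariation_eq_zero`). In particular the derivative in the
definition of criticality always exists.

*From compact support to general fields.* The field `V_R` is positive on the negative half-line and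
negative on the positive one. A minimiser does not charge the region where the field is positive, and
the energy would be unbounded below if the continuum contained a real point where it is negative. So
`lam` is carried by a closed set that meets the real line at most at `0`
(`exists_isClosed_carrier`). A Lipschitz field that vanishes at `0` can be cut off to annuli with a
Lipschitz constant that does not depend on the annulus (`exists_lipschitz_annulusCutoff_mul`).
Dominated convergence then gives the vanishing of `energyVariation` for all `C¹` Lipschitz fields that
are symmetric under reflection (`energyVariation_eq_zero_of_lipschitz`). It needs the integrability of
`V' h`. This is assumed when the continuum is unbounded. For a bounded continuum it follows from the
sector at `0`, in which `|V'(z)|` is at most of order `1 / |z|`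
(`exists_norm_deriv_complexField_mul_le`).

*The identity.* A test field agrees on the continuum and its reflection with a `C¹` Lipschitz field `H`
on the plane (`IsTestField.exists_lipschitz`), and the symmetric field to use is `H + H*`
(`symmetrisation`). The reflected charges of the antisymmetric extension are the image charges in the
Green function, and `V'(z*) = -V'(z)*`. So the integral of the variation kernel of `H + H*` is the real
part of the double integral of the divided difference (`re_integral_dividedDifference`), and the field
term of the variation is that of the identity (`re_integral_field`).
-/


/-! ### The Green energy is positive definite -/

/-- The convolution of two Poisson kernels of the half-plane, with heights `a` and `b`, is the
Poisson kernel of height `a + b`. The hypothesis excludes a double root of the denominator, where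
the partial fractions below degenerate. -/
theorem lintegral_poisson_mul_poisson {a b p : ℝ} (ha : 0 < a) (hb : 0 < b)
    (h : p ≠ 0 ∨ a ≠ b) :
    ∫⁻ ξ : ℝ, ENNReal.ofReal (a / (ξ ^ 2 + a ^ 2)) * ENNReal.ofReal (b / ((ξ - p) ^ 2 + b ^ 2)) =
      ENNReal.ofReal (Real.pi * ((a + b) / (p ^ 2 + (a + b) ^ 2))) := by
  have hΔ : 0 < p ^ 2 + (a - b) ^ 2 := by
    rcases h with h | h
    · positivity
    · have : a - b ≠ 0 := sub_ne_zero.2 h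
      positivity
  have hΔ' : 0 < p ^ 2 + (a + b) ^ 2 := by positivity
  have hd1 : ∀ ξ : ℝ, 0 < ξ ^ 2 + a ^ 2 := fun ξ => by positivity
  have hd2 : ∀ ξ : ℝ, 0 < (ξ - p) ^ 2 + b ^ 2 := fun ξ => by positivity
  set Δ := (p ^ 2 + (a + b) ^ 2) * (p ^ 2 + (a - b) ^ 2) with hΔdef
  have hΔ0 : 0 < Δ := by positivity
  -- Coefficients of the partial fraction decomposition of the integrand.
  set A := 2 * p / Δ with hA
  set B := (p ^ 2 + b ^ 2 - a ^ 2) / Δ with hB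
  set D := (p ^ 2 + a ^ 2 - b ^ 2) / Δ with hD
  set f : ℝ → ℝ := fun ξ => a / (ξ ^ 2 + a ^ 2) * (b / ((ξ - p) ^ 2 + b ^ 2)) with hf
  set F : ℝ → ℝ := fun ξ => a * b * (A / 2 * (Real.log (ξ ^ 2 + a ^ 2) -
    Real.log ((ξ - p) ^ 2 + b ^ 2)) + B / a * Real.arctan (ξ / a) +
      D / b * Real.arctan ((ξ - p) / b)) with hF
  have hderiv : ∀ ξ, HasDerivAt F (f ξ) ξ := by
    intro ξ
    have h1 : HasDerivAt (fun ξ : ℝ => Real.log (ξ ^ 2 + a ^ 2)) (2 * ξ / (ξ ^ 2 + a ^ 2)) ξ := by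
      have := ((hasDerivAt_id ξ).pow 2).add_const (a ^ 2) |>.log (hd1 ξ).ne'
      simpa using this
    have h2 : HasDerivAt (fun ξ : ℝ => Real.log ((ξ - p) ^ 2 + b ^ 2))
        (2 * (ξ - p) / ((ξ - p) ^ 2 + b ^ 2)) ξ := by
      have := (((hasDerivAt_id ξ).sub_const p).pow 2).add_const (b ^ 2) |>.log (hd2 ξ).ne'
      simpa using this
    have h3 : HasDerivAt (fun ξ : ℝ => Real.arctan (ξ / a)) (a / (ξ ^ 2 + a ^ 2)) ξ := by
      have := ((hasDerivAt_id' ξ).div_const a).arctan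
      convert this using 1
      have := hd1 ξ
      field_simp
      ring
    have h4 : HasDerivAt (fun ξ : ℝ => Real.arctan ((ξ - p) / b))
        (b / ((ξ - p) ^ 2 + b ^ 2)) ξ := by
      have := (((hasDerivAt_id' ξ).sub_const p).div_const b).arctan
      convert this using 1
      have := hd2 ξ
      field_simp
      ring
    have h5 := ((((h1.sub h2).const_mul (A / 2)).add (h3.const_mul (B / a))).add
      (h4.const_mul (D / b))).const_mul (a * b)
    refine HasDerivAt.congr_deriv (f := F) h5 ?_
    have e1 := (hd1 ξ).ne'
    have e2 := (hd2 ξ).ne'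
    have e3 := hΔ0.ne'
    simp only [f, A, B, D]
    field_simp
    rw [hΔdef]
    ring
  have hnn : ∀ ξ, 0 ≤ f ξ := fun ξ => by
    have := hd1 ξ; have := hd2 ξ
    simp only [hf]; positivity
  have hlog : Tendsto (fun ξ : ℝ => Real.log (ξ ^ 2 + a ^ 2) - Real.log ((ξ - p) ^ 2 + b ^ 2))
      (Bornology.cobounded ℝ) (𝓝 0) := by
    have h1 : Tendsto (fun ξ : ℝ => ξ⁻¹) (Bornology.cobounded ℝ) (𝓝 0) :=
      tendsto_inv₀_cobounded
    have h2 : Tendsto (fun ξ : ℝ => Real.log ((1 + (a * ξ⁻¹) ^ 2) /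
        ((1 - p * ξ⁻¹) ^ 2 + (b * ξ⁻¹) ^ 2))) (Bornology.cobounded ℝ)
        (𝓝 (Real.log ((1 + (a * 0) ^ 2) / ((1 - p * 0) ^ 2 + (b * 0) ^ 2)))) := by
      refine Tendsto.log ?_ (by simp)
      refine Tendsto.div ?_ ?_ (by simp)
      · exact tendsto_const_nhds.add ((h1.const_mul a).pow 2)
      · exact ((tendsto_const_nhds.sub (h1.const_mul p)).pow 2).add ((h1.const_mul b).pow 2)
    have h3 : Real.log ((1 + (a * 0) ^ 2) / ((1 - p * 0) ^ 2 + (b * 0) ^ 2)) = 0 := by simp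
    rw [h3] at h2
    refine h2.congr' ?_
    filter_upwards [Bornology.eventually_ne_cobounded (0 : ℝ)] with ξ hξ
    rw [← Real.log_div (hd1 ξ).ne' (hd2 ξ).ne']
    congr 1
    have e2 := (hd2 ξ).ne'
    have e3 : (1 - p * ξ⁻¹) ^ 2 + (b * ξ⁻¹) ^ 2 = ((ξ - p) ^ 2 + b ^ 2) / ξ ^ 2 := by
      field_simp
    have e4 : 1 + (a * ξ⁻¹) ^ 2 = (ξ ^ 2 + a ^ 2) / ξ ^ 2 := by
      field_simp
    rw [e3, e4]
    field_simp
  have hcob : Bornology.cobounded ℝ = atBot ⊔ atTop := by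
    rw [IsOrderBornology.cobounded_eq]
  have hlim : ∀ (l : Filter ℝ) (c : ℝ), l ≤ Bornology.cobounded ℝ →
      Tendsto (fun ξ : ℝ => Real.arctan (ξ / a)) l (𝓝 c) →
      Tendsto (fun ξ : ℝ => Real.arctan ((ξ - p) / b)) l (𝓝 c) →
      Tendsto F l (𝓝 (a * b * (B / a + D / b) * c)) := by
    intro l c hl h1 h2
    have := ((((hlog.mono_left hl).const_mul (A / 2)).add (h1.const_mul (B / a))).add
      (h2.const_mul (D / b))).const_mul (a * b)
    convert this using 2
    ring
  have htop : Tendsto F atTop (𝓝 (a * b * (B / a + D / b) * (Real.pi / 2))) := by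
    refine hlim _ _ (by rw [hcob]; exact le_sup_right) ?_ ?_
    · exact ((Real.tendsto_arctan_atTop.mono_right nhdsWithin_le_nhds)).comp
        (tendsto_id.atTop_div_const ha)
    · exact ((Real.tendsto_arctan_atTop.mono_right nhdsWithin_le_nhds)).comp
        ((tendsto_atTop_add_const_right _ (-p) tendsto_id).atTop_div_const hb)
  have hbot : Tendsto F atBot (𝓝 (a * b * (B / a + D / b) * (-(Real.pi / 2)))) := by
    refine hlim _ _ (by rw [hcob]; exact le_sup_left) ?_ ?_
    · exact ((Real.tendsto_arctan_atBot.mono_right nhdsWithin_le_nhds)).comp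
        (tendsto_id.atBot_div_const ha)
    · exact ((Real.tendsto_arctan_atBot.mono_right nhdsWithin_le_nhds)).comp
        ((tendsto_atBot_add_const_right _ (-p) tendsto_id).atBot_div_const hb)
  have hint : Integrable f := by
    have h1 : Integrable fun ξ : ℝ => (a * b)⁻¹ * (1 + (ξ / a) ^ 2)⁻¹ :=
      (integrable_inv_one_add_sq.comp_div ha.ne').const_mul _
    refine h1.mono' (Continuous.aestronglyMeasurable ?_) (ae_of_all _ fun ξ => ?_)
    · exact (continuous_const.div (by fun_prop) fun ξ => (hd1 ξ).ne').mul
        (continuous_const.div (by fun_prop) fun ξ => (hd2 ξ).ne')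
    · rw [Real.norm_of_nonneg (hnn ξ)]
      have e1 := hd1 ξ
      have e2 : b / ((ξ - p) ^ 2 + b ^ 2) ≤ b⁻¹ := by
        rw [div_le_iff₀ (hd2 ξ), inv_mul_eq_div, le_div_iff₀ hb]
        nlinarith [sq_nonneg (ξ - p)]
      calc f ξ ≤ a / (ξ ^ 2 + a ^ 2) * b⁻¹ := by
            simp only [hf]; gcongr
        _ = (a * b)⁻¹ * (1 + (ξ / a) ^ 2)⁻¹ := by
            field_simp
            ring
  have hval := integral_of_hasDerivAt_of_tendsto hderiv hint hbot htop
  have : ∀ ξ : ℝ, ENNReal.ofReal (a / (ξ ^ 2 + a ^ 2)) *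
      ENNReal.ofReal (b / ((ξ - p) ^ 2 + b ^ 2)) = ENNReal.ofReal (f ξ) := fun ξ => by
    rw [← ENNReal.ofReal_mul]
    have := hd1 ξ
    positivity
  simp_rw [this]
  rw [← ofReal_integral_eq_lintegral_ofReal hint (ae_of_all _ hnn), hval]
  congr 1
  have e3 := hΔ.ne'
  have e4 := hΔ'.ne'
  simp only [hB, hD, hΔdef]
  field_simp
  ring

/-- The Green function of the half-plane as an integral over the height of the Poisson kernels. -/
theorem lintegral_poisson_height {x b d : ℝ} (hb : 0 ≤ b) (hd : 0 ≤ d) (h : x ≠ 0 ∨ b ≠ d) :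
    ∫⁻ s in Ioo 0 (min b d), ENNReal.ofReal ((b - s + (d - s)) / (x ^ 2 + (b - s + (d - s)) ^ 2)) =
      ENNReal.ofReal ((Real.log (x ^ 2 + (b + d) ^ 2) - Real.log (x ^ 2 + (b - d) ^ 2)) / 4) := by
  have hm : 0 ≤ min b d := le_min hb hd
  have hden : ∀ s ∈ Icc 0 (min b d), 0 < x ^ 2 + (b - s + (d - s)) ^ 2 := by
    intro s hs
    have h1 : s ≤ b := hs.2.trans (min_le_left _ _)
    have h2 : s ≤ d := hs.2.trans (min_le_right _ _)
    rcases h with h | h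
    · positivity
    · have : 0 < b - s + (d - s) := by
        rcases lt_or_gt_of_ne h with h | h <;> linarith
      positivity
  have hderiv : ∀ s ∈ uIcc 0 (min b d), HasDerivAt
      (fun s : ℝ => -Real.log (x ^ 2 + (b - s + (d - s)) ^ 2) / 4)
      ((b - s + (d - s)) / (x ^ 2 + (b - s + (d - s)) ^ 2)) s := by
    intro s hs
    rw [uIcc_of_le hm] at hs
    have h0 : HasDerivAt (fun s : ℝ => b - s + (d - s)) (-1 + -1) s :=
      ((hasDerivAt_id s).const_sub b).add ((hasDerivAt_id s).const_sub d)
    have := ((((h0.pow 2).const_add (x ^ 2)).log (hden s hs).ne').neg).div_const 4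
    refine HasDerivAt.congr_deriv this ?_
    have := (hden s hs).ne'
    simp only [Pi.pow_apply]
    push_cast
    field_simp
    ring
  have hcont : ContinuousOn (fun s : ℝ => (b - s + (d - s)) / (x ^ 2 + (b - s + (d - s)) ^ 2))
      (Icc 0 (min b d)) :=
    ContinuousOn.div (by fun_prop) (by fun_prop) fun s hs => (hden s hs).ne'
  have hint : IntervalIntegrable (fun s : ℝ => (b - s + (d - s)) /
      (x ^ 2 + (b - s + (d - s)) ^ 2)) volume 0 (min b d) :=
    ContinuousOn.intervalIntegrable (by rwa [uIcc_of_le hm])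
  have hval := intervalIntegral.integral_eq_sub_of_hasDerivAt hderiv hint
  rw [setLIntegral_congr Ioo_ae_eq_Ioc, ← ofReal_integral_eq_lintegral_ofReal hint.1,
    ← intervalIntegral.integral_of_le hm, hval]
  · congr 1
    have e : (b - min b d + (d - min b d)) ^ 2 = (b - d) ^ 2 := by
      rcases le_total b d with h | h
      · rw [min_eq_left h]; ring
      · rw [min_eq_right h]; ring
    rw [e]
    simp only [sub_zero]
    ring
  · filter_upwards [ae_restrict_mem measurableSet_Ioc] with s hs
    have h1 : s ≤ b := hs.2.trans (min_le_left _ _)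
    have h2 : s ≤ d := hs.2.trans (min_le_right _ _)
    have := hden s ⟨hs.1.le, hs.2⟩
    exact div_nonneg (by linarith) this.le

/-- The Poisson kernel at `u` of the half-plane above the height `p.1`, with boundary point
`p.2 + i p.1`, extended by zero below that height. These functions are the features in which the
Green function becomes an inner product. -/
noncomputable def poissonFeature (p : ℝ × ℝ) (u : ℂ) : ℝ≥0∞ :=
  if p.1 < u.im then ENNReal.ofReal ((u.im - p.1) / ((u.re - p.2) ^ 2 + (u.im - p.1) ^ 2)) else 0

theorem measurable_poissonFeature :
    Measurable fun z : (ℝ × ℝ) × ℂ => poissonFeature z.1 z.2 := by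
  unfold poissonFeature
  refine Measurable.ite ?_ ?_ measurable_const
  · exact measurableSet_lt (by fun_prop) (by fun_prop)
  · fun_prop

/-- The parameter space of the Poisson features. -/
noncomputable def featureMeasure : Measure (ℝ × ℝ) := (volume.restrict (Ioi (0 : ℝ))).prod volume

instance : SFinite featureMeasure := by unfold featureMeasure; infer_instance

theorem norm_sub_conj_sq (u v : ℂ) :
    ‖u - starRingEnd ℂ v‖ ^ 2 = (u.re - v.re) ^ 2 + (u.im + v.im) ^ 2 := by
  rw [← Complex.normSq_eq_norm_sq, Complex.normSq_apply]; simp; ring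

theorem norm_sub_sq' (u v : ℂ) :
    ‖u - v‖ ^ 2 = (u.re - v.re) ^ 2 + (u.im - v.im) ^ 2 := by
  rw [← Complex.normSq_eq_norm_sq, Complex.normSq_apply]; simp; ring

/-- Off the diagonal the Green function is, up to the factor `π / 2`, the inner product of the
Poisson features: the convolution of two Poisson kernels is a Poisson kernel, and its integral over
the heights is the logarithm of the quotient of the distances. -/
theorem lintegral_poissonFeature_mul {u v : ℂ} (hu : 0 ≤ u.im) (hv : 0 ≤ v.im) (huv : u ≠ v) :
    ∫⁻ p, poissonFeature p u * poissonFeature p v ∂featureMeasure =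
      ENNReal.ofReal (Real.pi / 2) *
        ENNReal.ofReal (Real.log (‖u - starRingEnd ℂ v‖ / ‖u - v‖)) := by
  have hcase : v.re - u.re ≠ 0 ∨ u.im ≠ v.im := by
    by_contra! h
    exact huv (Complex.ext (by linarith [h.1]) h.2)
  rw [featureMeasure, lintegral_prod]
  swap
  · exact ((measurable_poissonFeature.comp (measurable_id.prodMk measurable_const)).mul
      (measurable_poissonFeature.comp (measurable_id.prodMk measurable_const))).aemeasurable
  have inner : ∀ s : ℝ, ∫⁻ ξ : ℝ, poissonFeature (s, ξ) u * poissonFeature (s, ξ) v =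
      (Iio (min u.im v.im)).indicator (fun s => ENNReal.ofReal Real.pi * ENNReal.ofReal
        ((u.im - s + (v.im - s)) / ((v.re - u.re) ^ 2 + (u.im - s + (v.im - s)) ^ 2))) s := by
    intro s
    by_cases hs : s < min u.im v.im
    · rw [indicator_of_mem (mem_Iio.2 hs)]
      obtain ⟨h1, h2⟩ := lt_min_iff.1 hs
      have h3 : u.im - s ≠ v.im - s ↔ u.im ≠ v.im := by simp
      rw [← ENNReal.ofReal_mul Real.pi_pos.le, ← lintegral_poisson_mul_poisson (p := v.re - u.re)
        (sub_pos.2 h1) (sub_pos.2 h2) (by rwa [h3])]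
      rw [← lintegral_add_right_eq_self _ u.re]
      refine lintegral_congr fun ξ => ?_
      simp only [poissonFeature, if_pos h1, if_pos h2]
      congr 4 <;> ring
    · rw [indicator_of_notMem (by simpa using hs)]
      simp only [poissonFeature]
      rcases min_le_iff.1 (not_lt.1 hs) with h | h
      · simp [not_lt.2 h]
      · simp [not_lt.2 h]
  simp_rw [inner]
  rw [setLIntegral_indicator measurableSet_Iio, Iio_inter_Ioi,
    lintegral_const_mul' _ _ ENNReal.ofReal_ne_top, lintegral_poisson_height hu hv hcase,
    ← ENNReal.ofReal_mul Real.pi_pos.le, ← ENNReal.ofReal_mul (by positivity)]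
  congr 1
  have h1 : 0 < ‖u - v‖ := norm_pos_iff.2 (sub_ne_zero.2 huv)
  have h2 : 0 < ‖u - starRingEnd ℂ v‖ := by
    rw [norm_pos_iff, sub_ne_zero]
    intro h
    have hi := congrArg Complex.im h
    have hr := congrArg Complex.re h
    simp at hi hr
    exact huv (Complex.ext hr (by linarith))
  rw [Real.log_div h2.ne' h1.ne']
  have e1 : (v.re - u.re) ^ 2 + (u.im + v.im) ^ 2 = ‖u - starRingEnd ℂ v‖ ^ 2 := by
    rw [norm_sub_conj_sq]; ring
  have e2 : (v.re - u.re) ^ 2 + (u.im - v.im) ^ 2 = ‖u - v‖ ^ 2 := by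
    rw [norm_sub_sq']; ring
  rw [e1, e2, Real.log_pow, Real.log_pow]
  push_cast
  ring

theorem measurable_greenFunction : Measurable fun z : ℂ × ℂ => greenFunction z.1 z.2 := by
  unfold greenFunction
  refine Measurable.ite ?_ measurable_const ?_
  · exact (measurableSet_eq_fun measurable_fst measurable_snd).inter
      (measurableSet_lt measurable_const (Complex.measurable_im.comp measurable_fst))
  · refine ENNReal.measurable_ofReal.comp (Real.measurable_log.comp (Measurable.div ?_ ?_))
    · exact (measurable_fst.sub (Complex.continuous_conj.measurable.comp measurable_snd)).norm
    · exact (measurable_fst.sub measurable_snd).norm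

theorem measurable_greenFunction_right (u : ℂ) : Measurable (greenFunction u) :=
  measurable_greenFunction.comp (measurable_const.prodMk measurable_id)

theorem greenFunction_comm (u v : ℂ) : greenFunction u v = greenFunction v u := by
  unfold greenFunction
  have h1 : ‖u - starRingEnd ℂ v‖ = ‖v - starRingEnd ℂ u‖ := by
    rw [← Complex.norm_conj (u - _), map_sub, Complex.conj_conj, norm_sub_rev]
  by_cases h : u = v
  · subst h; rfl
  · rw [if_neg (fun h' => h h'.1), if_neg (fun h' => h h'.1.symm), h1, norm_sub_rev u v]

theorem greenFunction_of_im_eq_zero {u v : ℂ} (hu : u.im = 0) : greenFunction u v = 0 := by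
  unfold greenFunction
  have h1 : ‖u - starRingEnd ℂ v‖ = ‖u - v‖ := by
    rw [← Complex.norm_conj (u - v), map_sub, Complex.conj_eq_iff_im.2 hu]
  rw [if_neg (fun h' => h'.2.ne' hu), h1]
  by_cases h : ‖u - v‖ = 0
  · simp [h]
  · simp [div_self h]

/-- This inequality holds on the diagonal too, where the Green function is infinite; only the
reverse one has to exclude it. -/
theorem poissonFeature_integral_le_greenFunction {u v : ℂ} (hu : 0 ≤ u.im) (hv : 0 ≤ v.im) :
    ∫⁻ p, poissonFeature p u * poissonFeature p v ∂featureMeasure ≤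
      ENNReal.ofReal (Real.pi / 2) * greenFunction u v := by
  by_cases huv : u = v
  · subst huv
    rcases hu.eq_or_lt with h0 | h0
    · refine le_of_eq_of_le ?_ zero_le
      have : ∀ᵐ p : ℝ × ℝ ∂featureMeasure, 0 < p.1 :=
        Measure.quasiMeasurePreserving_fst.ae (ae_restrict_mem measurableSet_Ioi)
      rw [lintegral_congr_ae (g := fun _ => 0), lintegral_zero]
      filter_upwards [this] with p hp
      simp [poissonFeature, ← h0, not_lt.2 hp.le]
    · have : greenFunction u u = ⊤ := by simp [greenFunction, h0]
      rw [this, ENNReal.mul_top (by simp [Real.pi_pos])]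
      exact le_top
  · rw [lintegral_poissonFeature_mul hu hv huv, greenFunction, if_neg (fun h => huv h.1)]

theorem greenFunction_le_poissonFeature_integral {u v : ℂ} (hu : 0 ≤ u.im) (hv : 0 ≤ v.im)
    (huv : ¬ (u = v ∧ 0 < u.im)) :
    ENNReal.ofReal (Real.pi / 2) * greenFunction u v ≤
      ∫⁻ p, poissonFeature p u * poissonFeature p v ∂featureMeasure := by
  by_cases h : u = v
  · have : u.im = 0 := le_antisymm (not_lt.1 fun h' => huv ⟨h, h'⟩) hu
    rw [greenFunction_of_im_eq_zero this]
    simp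
  · rw [lintegral_poissonFeature_mul hu hv h, greenFunction, if_neg huv]

/-- The mutual Green energy `∬ G(u,v) dα(u) dβ(v)` of two measures. -/
noncomputable def mutualEnergy (α β : Measure ℂ) : ℝ≥0∞ :=
  ∫⁻ u, ∫⁻ v, greenFunction u v ∂β ∂α

theorem mutualEnergy_self (α : Measure ℂ) : mutualEnergy α α = greenEnergy α := rfl

theorem mutualEnergy_comm (α β : Measure ℂ) [SFinite α] [SFinite β] :
    mutualEnergy α β = mutualEnergy β α := by
  unfold mutualEnergy
  rw [lintegral_lintegral_swap measurable_greenFunction.aemeasurable]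
  simp_rw [greenFunction_comm]

theorem mutualEnergy_add_left (α α' β : Measure ℂ) :
    mutualEnergy (α + α') β = mutualEnergy α β + mutualEnergy α' β :=
  lintegral_add_measure _ _ _

theorem mutualEnergy_smul_left (c : ℝ≥0∞) (α β : Measure ℂ) :
    mutualEnergy (c • α) β = c * mutualEnergy α β :=
  lintegral_smul_measure _ _

theorem mutualEnergy_add_right (α β β' : Measure ℂ) [SFinite β] [SFinite β'] :
    mutualEnergy α (β + β') = mutualEnergy α β + mutualEnergy α β' := by
  simp only [mutualEnergy, lintegral_add_measure]
  exact lintegral_add_left measurable_greenFunction.lintegral_prod_right' _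

theorem mutualEnergy_smul_right (c : ℝ≥0∞) (α β : Measure ℂ) [SFinite β] :
    mutualEnergy α (c • β) = c * mutualEnergy α β := by
  simp only [mutualEnergy, lintegral_smul_measure, smul_eq_mul]
  exact lintegral_const_mul _ measurable_greenFunction.lintegral_prod_right'

/-- A measure of finite Green energy has no atoms in the open half-plane. -/
theorem measure_singleton_eq_zero_of_greenEnergy {α : Measure ℂ} (h : greenEnergy α ≠ ⊤)
    {z : ℂ} (hz : 0 < z.im) : α {z} = 0 := by
  by_contra h0
  apply h
  rw [greenEnergy, eq_top_iff]
  have hzz : greenFunction z z = ⊤ := by simp [greenFunction, hz]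
  calc (⊤ : ℝ≥0∞) = ∫⁻ u in {z}, ∫⁻ v in {z}, greenFunction u v ∂α ∂α := by
        simp only [lintegral_singleton, hzz]
        rw [ENNReal.top_mul h0, ENNReal.top_mul h0]
    _ ≤ ∫⁻ u in {z}, ∫⁻ v, greenFunction u v ∂α ∂α :=
        lintegral_mono fun u => setLIntegral_le_lintegral _ _
    _ ≤ _ := setLIntegral_le_lintegral _ _

/-- The diagonal, where the Green function exceeds the inner product of the features, is negligible
for measures of finite energy. -/
theorem ae_ne_of_greenEnergy {β : Measure ℂ} (h : greenEnergy β ≠ ⊤) (u : ℂ) :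
    ∀ᵐ v ∂β, ¬ (u = v ∧ 0 < u.im) := by
  by_cases hu : 0 < u.im
  · have : β {u} = 0 := measure_singleton_eq_zero_of_greenEnergy h hu
    filter_upwards [measure_eq_zero_iff_ae_notMem.1 this] with v hv h'
    exact hv h'.1.symm
  · exact ae_of_all _ fun v h' => hu h'.2

theorem lintegral_feature_swap (α β : Measure ℂ) [SFinite α] [SFinite β] :
    ∫⁻ u, ∫⁻ v, (∫⁻ p, poissonFeature p u * poissonFeature p v ∂featureMeasure) ∂β ∂α =
      ∫⁻ p, (∫⁻ u, poissonFeature p u ∂α) * (∫⁻ v, poissonFeature p v ∂β) ∂featureMeasure := by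
  have hm : ∀ p, Measurable (poissonFeature p) := fun p =>
    measurable_poissonFeature.comp (measurable_const.prodMk measurable_id)
  have h1 : ∀ u, ∫⁻ v, (∫⁻ p, poissonFeature p u * poissonFeature p v ∂featureMeasure) ∂β =
      ∫⁻ p, poissonFeature p u * (∫⁻ v, poissonFeature p v ∂β) ∂featureMeasure := by
    intro u
    rw [lintegral_lintegral_swap]
    · refine lintegral_congr fun p => ?_
      rw [lintegral_const_mul _ (hm p)]
    · refine Measurable.aemeasurable (Measurable.mul ?_ ?_)
      · exact measurable_poissonFeature.comp (measurable_snd.prodMk measurable_const)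
      · exact measurable_poissonFeature.comp (measurable_snd.prodMk measurable_fst)
  simp_rw [h1]
  rw [lintegral_lintegral_swap]
  · refine lintegral_congr fun p => ?_
    rw [lintegral_mul_const _ (hm p)]
  · refine Measurable.aemeasurable (Measurable.mul ?_ ?_)
    · exact measurable_poissonFeature.comp (measurable_snd.prodMk measurable_fst)
    · exact (Measurable.lintegral_prod_right' (f := fun z : (ℝ × ℝ) × ℂ => poissonFeature z.1 z.2)
        measurable_poissonFeature).comp measurable_snd

theorem ENNReal.two_mul_le_add_mul_self (a b : ℝ≥0∞) : 2 * (a * b) ≤ a * a + b * b := by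
  by_cases ha : a = ⊤
  · simp [ha]
  by_cases hb : b = ⊤
  · simp [hb]
  lift a to NNReal using ha
  lift b to NNReal using hb
  have : 2 * (a * b) ≤ a * a + b * b := by
    have := two_mul_le_add_sq a b
    rwa [sq, sq, mul_assoc] at this
  exact_mod_cast this

/-- The Green energy is positive semidefinite: the energy of `α - β` is nonnegative. -/
theorem two_mul_mutualEnergy_le {α β : Measure ℂ} [SFinite α] [SFinite β]
    (hα : ∀ᵐ z ∂α, 0 ≤ z.im) (hβ : ∀ᵐ z ∂β, 0 ≤ z.im) :
    2 * mutualEnergy α β ≤ greenEnergy α + greenEnergy β := by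
  by_cases hEβ : greenEnergy β = ⊤
  · simp [hEβ]
  set c := ENNReal.ofReal (Real.pi / 2) with hc
  have hc0 : c ≠ 0 := by simp [hc, Real.pi_pos]
  have hct : c ≠ ⊤ := ENNReal.ofReal_ne_top
  have hm : Measurable fun z : ℂ × ℂ => greenFunction z.1 z.2 := measurable_greenFunction
  have hT : ∀ γ : Measure ℂ, SFinite γ → Measurable fun p => ∫⁻ u, poissonFeature p u ∂γ :=
    fun γ _ => Measurable.lintegral_prod_right' (f := fun z : (ℝ × ℝ) × ℂ =>
      poissonFeature z.1 z.2) measurable_poissonFeature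
  have hlow : ∀ γ : Measure ℂ, SFinite γ → (∀ᵐ z ∂γ, 0 ≤ z.im) →
      ∫⁻ p, (∫⁻ u, poissonFeature p u ∂γ) * (∫⁻ v, poissonFeature p v ∂γ) ∂featureMeasure ≤
        c * greenEnergy γ := by
    intro γ _ hγ
    rw [← lintegral_feature_swap, greenEnergy, ← lintegral_const_mul' _ _ hct]
    refine lintegral_mono_ae ?_
    filter_upwards [hγ] with u hu
    rw [← lintegral_const_mul' _ _ hct]
    refine lintegral_mono_ae ?_
    filter_upwards [hγ] with v hv
    exact poissonFeature_integral_le_greenFunction hu hv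
  have hup : c * mutualEnergy α β ≤
      ∫⁻ p, (∫⁻ u, poissonFeature p u ∂α) * (∫⁻ v, poissonFeature p v ∂β) ∂featureMeasure := by
    rw [← lintegral_feature_swap, mutualEnergy, ← lintegral_const_mul' _ _ hct]
    refine lintegral_mono_ae ?_
    filter_upwards [hα] with u hu
    rw [← lintegral_const_mul' _ _ hct]
    refine lintegral_mono_ae ?_
    filter_upwards [hβ, ae_ne_of_greenEnergy hEβ u] with v hv huv
    exact greenFunction_le_poissonFeature_integral hu hv huv
  have key : c * (2 * mutualEnergy α β) ≤ c * (greenEnergy α + greenEnergy β) := by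
    calc c * (2 * mutualEnergy α β) = 2 * (c * mutualEnergy α β) := by ring
      _ ≤ 2 * ∫⁻ p, (∫⁻ u, poissonFeature p u ∂α) * (∫⁻ v, poissonFeature p v ∂β)
          ∂featureMeasure := by gcongr
      _ = ∫⁻ p, 2 * ((∫⁻ u, poissonFeature p u ∂α) * (∫⁻ v, poissonFeature p v ∂β))
          ∂featureMeasure := (lintegral_const_mul' _ _ (by simp)).symm
      _ ≤ ∫⁻ p, (∫⁻ u, poissonFeature p u ∂α) * (∫⁻ v, poissonFeature p v ∂α) +
          (∫⁻ u, poissonFeature p u ∂β) * (∫⁻ v, poissonFeature p v ∂β) ∂featureMeasure := by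
        refine lintegral_mono fun p => ?_
        generalize ∫⁻ u, poissonFeature p u ∂α = a
        generalize ∫⁻ u, poissonFeature p u ∂β = b
        exact ENNReal.two_mul_le_add_mul_self a b
      _ ≤ c * greenEnergy α + c * greenEnergy β := by
        rw [lintegral_add_left (by exact (hT α inferInstance).mul (hT α inferInstance))]
        exact add_le_add (hlow α inferInstance hα) (hlow β inferInstance hβ)
      _ = _ := by ring
  exact (ENNReal.mul_le_mul_iff_right hc0 hct).1 key

/-! ### Measures of finite energy -/

/-- A finite measure on the closed upper half-plane of finite Green energy. -/
structure HasFiniteEnergy (ν : Measure ℂ) : Prop where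
  finite : IsFiniteMeasure ν
  upper : ∀ᵐ z ∂ν, 0 ≤ z.im
  energy : greenEnergy ν ≠ ⊤

theorem HasFiniteEnergy.mutualEnergy_ne_top {α β : Measure ℂ} (hα : HasFiniteEnergy α)
    (hβ : HasFiniteEnergy β) : mutualEnergy α β ≠ ⊤ := by
  have := hα.finite
  have := hβ.finite
  intro h
  have h1 := two_mul_mutualEnergy_le hα.upper hβ.upper
  rw [h, ENNReal.mul_top (by simp), top_le_iff, ENNReal.add_eq_top] at h1
  exact h1.elim hα.energy hβ.energy

theorem HasFiniteEnergy.add {α β : Measure ℂ} (hα : HasFiniteEnergy α)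
    (hβ : HasFiniteEnergy β) : HasFiniteEnergy (α + β) := by
  have := hα.finite
  have := hβ.finite
  refine ⟨inferInstance, ?_, ?_⟩
  · rw [ae_add_measure_iff]; exact ⟨hα.upper, hβ.upper⟩
  · rw [← mutualEnergy_self, mutualEnergy_add_left, mutualEnergy_add_right, mutualEnergy_add_right]
    simp only [ne_eq, ENNReal.add_eq_top, not_or]
    exact ⟨⟨hα.energy, hα.mutualEnergy_ne_top hβ⟩, hβ.mutualEnergy_ne_top hα, hβ.energy⟩

theorem HasFiniteEnergy.smul {α : Measure ℂ} (hα : HasFiniteEnergy α) {c : ℝ≥0∞} (hc : c ≠ ⊤) :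
    HasFiniteEnergy (c • α) := by
  have := hα.finite
  refine ⟨α.smul_finite hc, ?_, ?_⟩
  · exact Measure.ae_smul_measure hα.upper c
  · rw [← mutualEnergy_self, mutualEnergy_smul_left, mutualEnergy_smul_right]
    exact ENNReal.mul_ne_top hc (ENNReal.mul_ne_top hc hα.energy)

/-- The squared energy distance `∬ G d(α - β) d(α - β)` of two measures. -/
noncomputable def energyDist (α β : Measure ℂ) : ℝ :=
  (greenEnergy α).toReal - 2 * (mutualEnergy α β).toReal + (greenEnergy β).toReal

theorem energyDist_nonneg {α β : Measure ℂ} (hα : HasFiniteEnergy α) (hβ : HasFiniteEnergy β) :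
    0 ≤ energyDist α β := by
  have := hα.finite
  have := hβ.finite
  have h := ENNReal.toReal_mono (ENNReal.add_ne_top.2 ⟨hα.energy, hβ.energy⟩)
    (two_mul_mutualEnergy_le hα.upper hβ.upper)
  rw [ENNReal.toReal_mul, ENNReal.toReal_add hα.energy hβ.energy, ENNReal.toReal_ofNat] at h
  unfold energyDist
  linarith

theorem toReal_mutualEnergy_add_smul {α β m : Measure ℂ} (hα : HasFiniteEnergy α)
    (hβ : HasFiniteEnergy β) (hm : HasFiniteEnergy m) {s : ℝ} (hs : 0 ≤ s) :
    (mutualEnergy (α + ENNReal.ofReal s • m) β).toReal =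
      (mutualEnergy α β).toReal + s * (mutualEnergy m β).toReal := by
  rw [mutualEnergy_add_left, mutualEnergy_smul_left, ENNReal.toReal_add
    (hα.mutualEnergy_ne_top hβ) (ENNReal.mul_ne_top ENNReal.ofReal_ne_top
      (hm.mutualEnergy_ne_top hβ)), ENNReal.toReal_mul, ENNReal.toReal_ofReal hs]

theorem toReal_greenEnergy_add_smul {α m : Measure ℂ} (hα : HasFiniteEnergy α)
    (hm : HasFiniteEnergy m) {s : ℝ} (hs : 0 ≤ s) :
    (greenEnergy (α + ENNReal.ofReal s • m)).toReal = (greenEnergy α).toReal +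
      2 * s * (mutualEnergy α m).toReal + s ^ 2 * (greenEnergy m).toReal := by
  have := hα.finite
  have := hm.finite
  have hsm := hm.smul (c := ENNReal.ofReal s) ENNReal.ofReal_ne_top
  have := hsm.finite
  have hs' := hα.add hsm
  have := hs'.finite
  rw [← mutualEnergy_self, toReal_mutualEnergy_add_smul hα hs' hm hs,
    mutualEnergy_comm α, mutualEnergy_comm m, toReal_mutualEnergy_add_smul hα hα hm hs,
    toReal_mutualEnergy_add_smul hα hm hm hs, mutualEnergy_self, mutualEnergy_self,
    mutualEnergy_comm m α]
  ring

/-- The Cauchy–Schwarz inequality for the Green energy of `ν - lam` and `m`. -/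
theorem sq_mutualEnergy_sub_le {ν lam m : Measure ℂ} (hν : HasFiniteEnergy ν)
    (hl : HasFiniteEnergy lam) (hm : HasFiniteEnergy m) :
    ((mutualEnergy ν m).toReal - (mutualEnergy lam m).toReal) ^ 2 ≤
      energyDist ν lam * (greenEnergy m).toReal := by
  have := hν.finite
  have := hl.finite
  have := hm.finite
  set d := (mutualEnergy ν m).toReal - (mutualEnergy lam m).toReal with hd
  have key : ∀ s : ℝ, 0 ≤ (greenEnergy m).toReal * (s * s) + (2 * d) * s + energyDist ν lam := by
    intro s
    rcases le_total 0 s with hs | hs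
    · have h := energyDist_nonneg (hν.add (hm.smul (ENNReal.ofReal_ne_top (r := s)))) hl
      rw [energyDist, toReal_greenEnergy_add_smul hν hm hs, toReal_mutualEnergy_add_smul hν hl hm hs,
        mutualEnergy_comm m lam] at h
      unfold energyDist
      nlinarith
    · have hs' : 0 ≤ -s := by linarith
      have h := energyDist_nonneg hν (hl.add (hm.smul (ENNReal.ofReal_ne_top (r := -s))))
      have := (hl.add (hm.smul (ENNReal.ofReal_ne_top (r := -s)))).finite
      rw [energyDist, toReal_greenEnergy_add_smul hl hm hs', mutualEnergy_comm ν,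
        toReal_mutualEnergy_add_smul hl hν hm hs', mutualEnergy_comm m ν,
        mutualEnergy_comm lam ν] at h
      unfold energyDist
      nlinarith
  have := discrim_le_zero key
  unfold discrim at this
  nlinarith

/-! ### Potentials of circles -/

/-- The normalised arc length on the circle of centre `c` and radius `r`. -/
noncomputable def circleMeasure (c : ℂ) (r : ℝ) : Measure ℂ :=
  ENNReal.ofReal (2 * Real.pi)⁻¹ • (volume.restrict (Ioc 0 (2 * Real.pi))).map (circleMap c r)

/-- The Green potential of the normalised arc length on the circle of centre `c` and radius `r`, in
closed form: it equals that potential on the closed half-plane when `r < Im c`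
(`lintegral_greenFunction_circleMeasure`). -/
noncomputable def smearedGreen (c : ℂ) (r : ℝ) (u : ℂ) : ℝ :=
  Real.log ‖u - starRingEnd ℂ c‖ - Real.log (max ‖u - c‖ r)

instance (c : ℂ) (r : ℝ) : IsFiniteMeasure (circleMeasure c r) := by
  unfold circleMeasure
  exact Measure.smul_finite _ ENNReal.ofReal_ne_top

theorem norm_sub_le_norm_sub_conj {u v : ℂ} (hu : 0 ≤ u.im) (hv : 0 ≤ v.im) :
    ‖u - v‖ ≤ ‖u - starRingEnd ℂ v‖ := by
  refine le_of_sq_le_sq ?_ (norm_nonneg _)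
  rw [norm_sub_sq', norm_sub_conj_sq]
  nlinarith [mul_nonneg hu hv]

theorem norm_sub_conj_comm (u v : ℂ) :
    ‖u - starRingEnd ℂ v‖ = ‖v - starRingEnd ℂ u‖ := by
  rw [← Complex.norm_conj (u - _), map_sub, Complex.conj_conj, norm_sub_rev]

theorem im_le_norm_sub_conj {u v : ℂ} (hu : 0 ≤ u.im) :
    v.im ≤ ‖u - starRingEnd ℂ v‖ := by
  have := (Complex.abs_im_le_norm (u - starRingEnd ℂ v))
  simp at this
  linarith [le_abs_self (u.im + v.im)]

theorem im_circleMap_ge {c : ℂ} {r : ℝ} (hr : 0 < r) (θ : ℝ) :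
    c.im - r ≤ (circleMap c r θ).im := by
  have h : ‖circleMap c r θ - c‖ = r := by simp [circleMap, abs_of_pos hr]
  have := Complex.abs_im_le_norm (circleMap c r θ - c)
  rw [h, Complex.sub_im] at this
  linarith [neg_abs_le ((circleMap c r θ).im - c.im)]

theorem ae_circleMeasure {c : ℂ} {r : ℝ} {p : ℂ → Prop} (hp : MeasurableSet {z | p z})
    (h : ∀ θ, p (circleMap c r θ)) : ∀ᵐ z ∂circleMeasure c r, p z := by
  unfold circleMeasure
  refine Measure.ae_smul_measure ?_ _
  rw [ae_map_iff (measurable_circleMap c r).aemeasurable hp]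
  exact ae_of_all _ h

theorem circleAverage_log_norm_sub {c a : ℂ} {r : ℝ} (hr : 0 < r) :
    Real.circleAverage (fun z => Real.log ‖z - a‖) c r = Real.log (max ‖c - a‖ r) := by
  rw [circleAverage_log_norm_sub_const_eq_log_radius_add_posLog hr.ne',
    Real.posLog_eq_log_max_one (by positivity), ← Real.log_mul hr.ne' (by positivity)]
  congr 1
  rw [mul_max_of_nonneg _ _ hr.le, mul_inv_cancel_left₀ hr.ne', mul_one, max_comm]

theorem lintegral_greenFunction_circleMeasure {c u : ℂ} {r : ℝ} (hr : 0 < r) (hc : r < c.im)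
    (hu : 0 ≤ u.im) :
    ∫⁻ w, greenFunction u w ∂circleMeasure c r = ENNReal.ofReal (smearedGreen c r u) := by
  unfold circleMeasure
  rw [lintegral_smul_measure, lintegral_map (measurable_greenFunction_right u)
    (measurable_circleMap c r)]
  set f : ℂ → ℝ := fun w => Real.log ‖w - starRingEnd ℂ u‖ - Real.log ‖w - u‖ with hf
  have h1 : CircleIntegrable (fun z => Real.log ‖z - starRingEnd ℂ u‖) c r :=
    circleIntegrable_log_norm_sub_const r
  have h2 : CircleIntegrable (fun z => Real.log ‖z - u‖) c r :=
    circleIntegrable_log_norm_sub_const r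
  have hfi : CircleIntegrable f c r := h1.sub h2
  have hne : ∀ᵐ θ ∂(volume.restrict (Ioc 0 (2 * Real.pi))), circleMap c r θ ≠ u := by
    refine ae_restrict_of_ae ?_
    have : (circleMap c r ⁻¹' {u}).Countable :=
      (countable_singleton u).preimage_circleMap c hr.ne'
    exact measure_eq_zero_iff_ae_notMem.1 (this.measure_zero volume)
  have him : ∀ θ, 0 < (circleMap c r θ).im := fun θ => by linarith [im_circleMap_ge hr θ (c := c)]
  have hG : ∀ᵐ θ ∂(volume.restrict (Ioc 0 (2 * Real.pi))),
      greenFunction u (circleMap c r θ) = ENNReal.ofReal (f (circleMap c r θ)) := by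
    filter_upwards [hne] with θ hθ
    rw [greenFunction, if_neg (fun h => hθ h.1.symm), norm_sub_conj_comm, norm_sub_rev u,
      Real.log_div]
    · have := im_le_norm_sub_conj (v := circleMap c r θ) hu
      rw [norm_sub_conj_comm] at this
      linarith [him θ]
    · exact norm_ne_zero_iff.2 (sub_ne_zero.2 hθ)
  rw [lintegral_congr_ae hG, ← ofReal_integral_eq_lintegral_ofReal hfi.1, smul_eq_mul,
    ← ENNReal.ofReal_mul (by positivity), ← intervalIntegral.integral_of_le (by positivity)]
  · congr 1
    have : (2 * Real.pi)⁻¹ * ∫ θ in (0 : ℝ)..2 * Real.pi, f (circleMap c r θ) =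
        Real.circleAverage f c r := rfl
    rw [this]
    have h3 := Real.circleAverage_sub h1 h2
    change Real.circleAverage f c r = _ at h3
    rw [h3, circleAverage_log_norm_sub hr, circleAverage_log_norm_sub hr, smearedGreen,
      norm_sub_rev c u, norm_sub_conj_comm c u, max_eq_left]
    linarith [im_le_norm_sub_conj (v := c) hu]
  · filter_upwards [hne] with θ hθ
    simp only [hf, Pi.zero_apply, sub_nonneg]
    exact Real.log_le_log (norm_pos_iff.2 (sub_ne_zero.2 hθ))
      (norm_sub_le_norm_sub_conj (him θ).le hu)

theorem smearedGreen_nonneg {c u : ℂ} {r : ℝ} (hr : 0 < r) (hc : r < c.im) (hu : 0 ≤ u.im) :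
    0 ≤ smearedGreen c r u := by
  unfold smearedGreen
  rw [sub_nonneg]
  refine Real.log_le_log (lt_max_of_lt_right hr) (max_le ?_ ?_)
  · exact norm_sub_le_norm_sub_conj hu (by linarith)
  · linarith [im_le_norm_sub_conj (v := c) hu]

theorem smearedGreen_le {c u : ℂ} {r : ℝ} (hr : 0 < r) (hc : r < c.im) (hu : 0 ≤ u.im) :
    smearedGreen c r u ≤ Real.log (1 + 2 * c.im / r) := by
  unfold smearedGreen
  have hm : 0 < max ‖u - c‖ r := lt_max_of_lt_right hr
  have h0 : 0 < ‖u - starRingEnd ℂ c‖ := by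
    linarith [im_le_norm_sub_conj (v := c) hu]
  rw [← Real.log_div h0.ne' hm.ne']
  refine Real.log_le_log (by positivity) ?_
  rw [div_le_iff₀ hm]
  have h1 : ‖u - starRingEnd ℂ c‖ ≤ ‖u - c‖ + 2 * c.im := by
    have : ‖c - starRingEnd ℂ c‖ = 2 * c.im := by
      rw [Complex.sub_conj]
      simp [abs_of_pos (hr.trans hc)]
    calc ‖u - starRingEnd ℂ c‖ = ‖(u - c) + (c - starRingEnd ℂ c)‖ := by congr 1; ring
      _ ≤ _ := (norm_add_le _ _).trans (by rw [this])
  have h2 : 2 * c.im ≤ 2 * c.im / r * max ‖u - c‖ r := by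
    rw [div_mul_eq_mul_div, le_div_iff₀ hr]
    gcongr
    · linarith
    · exact le_max_right _ _
  nlinarith [le_max_left ‖u - c‖ r]

theorem continuousOn_smearedGreen {c : ℂ} {r : ℝ} (hr : 0 < r) (hc : r < c.im) :
    ContinuousOn (smearedGreen c r) {z | 0 ≤ z.im} := by
  unfold smearedGreen
  refine ContinuousOn.sub (ContinuousOn.log (by fun_prop) fun u hu => ?_)
    (ContinuousOn.log (by fun_prop) fun u _ => (lt_max_of_lt_right hr).ne')
  have := im_le_norm_sub_conj (v := c) hu
  linarith

theorem measurable_smearedGreen (c : ℂ) (r : ℝ) : Measurable (smearedGreen c r) := by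
  unfold smearedGreen
  fun_prop

theorem integrable_smearedGreen {c : ℂ} {r : ℝ} (hr : 0 < r) (hc : r < c.im) {ν : Measure ℂ}
    [IsFiniteMeasure ν] (hν : ∀ᵐ z ∂ν, 0 ≤ z.im) : Integrable (smearedGreen c r) ν := by
  refine Integrable.of_bound (measurable_smearedGreen c r).aestronglyMeasurable
    (Real.log (1 + 2 * c.im / r)) ?_
  filter_upwards [hν] with u hu
  rw [Real.norm_of_nonneg (smearedGreen_nonneg hr hc hu)]
  exact smearedGreen_le hr hc hu

theorem toReal_mutualEnergy_circleMeasure {c : ℂ} {r : ℝ} (hr : 0 < r) (hc : r < c.im)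
    {ν : Measure ℂ} [IsFiniteMeasure ν] (hν : ∀ᵐ z ∂ν, 0 ≤ z.im) :
    mutualEnergy ν (circleMeasure c r) = ENNReal.ofReal (∫ u, smearedGreen c r u ∂ν) := by
  unfold mutualEnergy
  rw [ofReal_integral_eq_lintegral_ofReal (integrable_smearedGreen hr hc hν)]
  · refine lintegral_congr_ae ?_
    filter_upwards [hν] with u hu
    exact lintegral_greenFunction_circleMeasure hr hc hu
  · filter_upwards [hν] with u hu
    exact smearedGreen_nonneg hr hc hu

theorem ae_circleMeasure_im {c : ℂ} {r : ℝ} (hr : 0 < r) (hc : r < c.im) :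
    ∀ᵐ z ∂circleMeasure c r, 0 ≤ z.im :=
  ae_circleMeasure (measurableSet_le measurable_const Complex.measurable_im) fun θ => by
    linarith [im_circleMap_ge hr θ (c := c)]

theorem circleMeasure_univ (c : ℂ) (r : ℝ) : circleMeasure c r univ = 1 := by
  unfold circleMeasure
  rw [Measure.smul_apply, Measure.map_apply (measurable_circleMap c r) MeasurableSet.univ]
  simp only [preimage_univ, Measure.restrict_apply_univ, Real.volume_Ioc, sub_zero, smul_eq_mul]
  rw [← ENNReal.ofReal_mul (by positivity), inv_mul_cancel₀ (by positivity), ENNReal.ofReal_one]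

theorem greenEnergy_circleMeasure_le {c : ℂ} {r : ℝ} (hr : 0 < r) (hc : r < c.im) :
    greenEnergy (circleMeasure c r) ≤ ENNReal.ofReal (Real.log (1 + 2 * c.im / r)) := by
  rw [← mutualEnergy_self, toReal_mutualEnergy_circleMeasure hr hc (ae_circleMeasure_im hr hc)]
  refine ENNReal.ofReal_le_ofReal ?_
  calc ∫ u, smearedGreen c r u ∂circleMeasure c r
      ≤ ∫ _, Real.log (1 + 2 * c.im / r) ∂circleMeasure c r := by
        refine integral_mono_ae (integrable_smearedGreen hr hc (ae_circleMeasure_im hr hc))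
          (integrable_const _) ?_
        filter_upwards [ae_circleMeasure_im hr hc] with u hu
        exact smearedGreen_le hr hc hu
    _ = _ := by simp [measureReal_def, circleMeasure_univ]

theorem HasFiniteEnergy.circleMeasure {c : ℂ} {r : ℝ} (hr : 0 < r) (hc : r < c.im) :
    HasFiniteEnergy (circleMeasure c r) :=
  ⟨inferInstance, ae_circleMeasure_im hr hc,
    ((greenEnergy_circleMeasure_le hr hc).trans_lt ENNReal.ofReal_lt_top).ne⟩

/-- Integrals of potentials of circles are continuous in the energy distance. -/
theorem sq_integral_smearedGreen_sub_le {c : ℂ} {r : ℝ} (hr : 0 < r) (hc : r < c.im)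
    {ν lam : Measure ℂ} (hν : HasFiniteEnergy ν) (hl : HasFiniteEnergy lam) :
    (∫ u, smearedGreen c r u ∂ν - ∫ u, smearedGreen c r u ∂lam) ^ 2 ≤
      energyDist ν lam * Real.log (1 + 2 * c.im / r) := by
  have := hν.finite
  have := hl.finite
  have h := sq_mutualEnergy_sub_le hν hl (HasFiniteEnergy.circleMeasure hr hc)
  have hnn : ∀ {α : Measure ℂ}, (∀ᵐ z ∂α, 0 ≤ z.im) → 0 ≤ ∫ u, smearedGreen c r u ∂α :=
    fun hα => integral_nonneg_of_ae <| by
      filter_upwards [hα] with u hu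
      exact smearedGreen_nonneg hr hc hu
  rw [toReal_mutualEnergy_circleMeasure hr hc hν.upper, toReal_mutualEnergy_circleMeasure hr hc
    hl.upper, ENNReal.toReal_ofReal (hnn hν.upper), ENNReal.toReal_ofReal (hnn hl.upper)] at h
  refine h.trans ?_
  gcongr
  · exact energyDist_nonneg hν hl
  · refine ENNReal.toReal_le_of_le_ofReal (Real.log_nonneg ?_) (greenEnergy_circleMeasure_le hr hc)
    have : 0 ≤ 2 * c.im / r := div_nonneg (by linarith) hr.le
    linarith

/-! ### Convergence in energy tests continuous functions -/

/-- A fixed weight on the closed half-plane, the Green potential of a circle about `i`. It vanishes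
on the real line and at infinity exactly like the Green function with a fixed pole, and its
integral is controlled by the Green energy. -/
noncomputable def greenWeight (u : ℂ) : ℝ := smearedGreen Complex.I (1 / 2) u

theorem half_lt_I_im : (1 / 2 : ℝ) < Complex.I.im := by simp; norm_num

theorem greenWeight_nonneg {u : ℂ} (hu : 0 ≤ u.im) : 0 ≤ greenWeight u :=
  smearedGreen_nonneg (by norm_num) half_lt_I_im hu

theorem continuousOn_greenWeight : ContinuousOn greenWeight {z | 0 ≤ z.im} :=
  continuousOn_smearedGreen (by norm_num) half_lt_I_im

theorem integrable_greenWeight {ν : Measure ℂ} [IsFiniteMeasure ν] (hν : ∀ᵐ z ∂ν, 0 ≤ z.im) :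
    Integrable greenWeight ν :=
  integrable_smearedGreen (by norm_num) half_lt_I_im hν

theorem integral_greenWeight_nonneg {ν : Measure ℂ} (hν : ∀ᵐ z ∂ν, 0 ≤ z.im) :
    0 ≤ ∫ u, greenWeight u ∂ν :=
  integral_nonneg_of_ae <| by filter_upwards [hν] with u hu using greenWeight_nonneg hu

theorem greenWeight_le {u : ℂ} (hu : 0 ≤ u.im) : greenWeight u ≤ Real.log 5 := by
  have := smearedGreen_le (r := 1 / 2) (by norm_num) half_lt_I_im hu
  norm_num at this
  exact this

theorem greenWeight_of_im_eq_zero {u : ℂ} (hu : u.im = 0) : greenWeight u = 0 := by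
  have h1 : ‖u - starRingEnd ℂ Complex.I‖ = ‖u - Complex.I‖ := by
    rw [norm_sub_conj_comm, Complex.conj_eq_iff_im.2 hu, norm_sub_rev]
  have h2 : 1 ≤ ‖u - Complex.I‖ := by
    have := Complex.abs_im_le_norm (u - Complex.I)
    simpa [hu] using this
  rw [greenWeight, smearedGreen, h1, max_eq_left (by linarith), sub_self]

theorem le_greenWeight {u : ℂ} (hu : 0 ≤ u.im) : u.im / (1 + ‖u‖) ^ 2 ≤ greenWeight u := by
  have hs1 : ‖u - starRingEnd ℂ Complex.I‖ ^ 2 = ‖u‖ ^ 2 + 1 + 2 * u.im := by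
    rw [norm_sub_conj_sq, ← Complex.normSq_eq_norm_sq, Complex.normSq_apply]; simp; ring
  have hs2 : ‖u - Complex.I‖ ^ 2 = ‖u‖ ^ 2 + 1 - 2 * u.im := by
    rw [norm_sub_sq', ← Complex.normSq_eq_norm_sq, Complex.normSq_apply]; simp; ring
  have him : u.im ≤ ‖u‖ := (le_abs_self _).trans (Complex.abs_im_le_norm u)
  have hn := norm_nonneg u
  have h1 : 1 ≤ ‖u - starRingEnd ℂ Complex.I‖ := by
    nlinarith [norm_nonneg (u - starRingEnd ℂ Complex.I)]
  have hm : 0 < max ‖u - Complex.I‖ (1 / 2) := lt_max_of_lt_right (by norm_num)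
  set a := ‖u - starRingEnd ℂ Complex.I‖ with ha
  have hden : 0 < (1 + ‖u‖) ^ 2 := by positivity
  have key : (max ‖u - Complex.I‖ (1 / 2)) ^ 2 ≤ a ^ 2 - 2 * (u.im / (1 + ‖u‖) ^ 2) * a ^ 2 := by
    have hfrac : u.im / (1 + ‖u‖) ^ 2 * a ^ 2 ≤ u.im := by
      rw [div_mul_eq_mul_div, div_le_iff₀ hden, hs1]
      exact mul_le_mul_of_nonneg_left (by nlinarith) hu
    rcases le_total ‖u - Complex.I‖ (1 / 2) with h | h
    · rw [max_eq_right h]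
      have h2 : ‖u - Complex.I‖ ^ 2 ≤ 1 / 4 := by nlinarith [norm_nonneg (u - Complex.I)]
      have h3 : 1 ≤ ‖u‖ ^ 2 + 1 := by nlinarith
      nlinarith
    · rw [max_eq_left h]
      nlinarith
  have hlog : Real.log ((max ‖u - Complex.I‖ (1 / 2)) ^ 2 / a ^ 2) ≤
      (max ‖u - Complex.I‖ (1 / 2)) ^ 2 / a ^ 2 - 1 :=
    Real.log_le_sub_one_of_pos (by positivity)
  rw [Real.log_div (by positivity) (by positivity), Real.log_pow, Real.log_pow] at hlog
  have h5 : (max ‖u - Complex.I‖ (1 / 2)) ^ 2 / a ^ 2 - 1 ≤ - (2 * (u.im / (1 + ‖u‖) ^ 2)) := by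
    rw [sub_le_iff_le_add, div_le_iff₀ (by positivity)]
    linarith
  unfold greenWeight smearedGreen
  push_cast at hlog
  linarith

theorem greenWeight_pos {u : ℂ} (hu : 0 < u.im) : 0 < greenWeight u :=
  (by positivity : 0 < u.im / (1 + ‖u‖) ^ 2).trans_le (le_greenWeight hu.le)

theorem exists_le_greenWeight {S : Set ℂ} (hS : IsCompact S) (hSH : ∀ z ∈ S, 0 < z.im) :
    ∃ c > 0, ∀ z ∈ S, c ≤ greenWeight z := by
  rcases S.eq_empty_or_nonempty with rfl | hne
  · exact ⟨1, one_pos, by simp⟩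
  obtain ⟨z, hz, hmin⟩ := hS.exists_isMinOn hne
    (continuousOn_greenWeight.mono fun z hz => (hSH z hz).le)
  exact ⟨greenWeight z, greenWeight_pos (hSH z hz), fun w hw => hmin hw⟩

theorem sq_integral_greenWeight_sub_le {ν lam : Measure ℂ} (hν : HasFiniteEnergy ν)
    (hl : HasFiniteEnergy lam) :
    (∫ u, greenWeight u ∂ν - ∫ u, greenWeight u ∂lam) ^ 2 ≤ energyDist ν lam * Real.log 5 := by
  have := sq_integral_smearedGreen_sub_le (r := 1 / 2) (by norm_num) half_lt_I_im hν hl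
  norm_num at this
  exact this

/-- A compactly supported difference of potentials of concentric circles; translates of it,
suitably normalised, form an approximate identity. -/
noncomputable def annulusKernel (r : ℝ) (w : ℂ) : ℝ :=
  Real.log (max ‖w‖ (2 * r)) - Real.log (max ‖w‖ r)

theorem annulusKernel_nonneg {r : ℝ} (hr : 0 < r) (w : ℂ) : 0 ≤ annulusKernel r w := by
  unfold annulusKernel
  rw [sub_nonneg]
  exact Real.log_le_log (lt_max_of_lt_right hr) (max_le_max le_rfl (by linarith))

theorem continuous_annulusKernel {r : ℝ} (hr : 0 < r) : Continuous (annulusKernel r) := by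
  unfold annulusKernel
  refine Continuous.sub (Continuous.log (by fun_prop) fun w => ?_)
    (Continuous.log (by fun_prop) fun w => (lt_max_of_lt_right hr).ne')
  exact (lt_max_of_lt_right (by linarith)).ne'

theorem annulusKernel_eq_zero {r : ℝ} (hr : 0 < r) {w : ℂ} (hw : 2 * r ≤ ‖w‖) :
    annulusKernel r w = 0 := by
  rw [annulusKernel, max_eq_left hw, max_eq_left (by linarith), sub_self]

theorem annulusKernel_le {r : ℝ} (hr : 0 < r) (w : ℂ) : annulusKernel r w ≤ Real.log 2 := by
  unfold annulusKernel
  have hm : 0 < max ‖w‖ r := lt_max_of_lt_right hr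
  rw [← Real.log_div (lt_max_of_lt_right (by linarith)).ne' hm.ne']
  refine Real.log_le_log (div_pos (lt_max_of_lt_right (by linarith)) hm) ?_
  rw [div_le_iff₀ hm]
  exact max_le (by linarith [le_max_left ‖w‖ r]) (by linarith [le_max_right ‖w‖ r])

theorem hasCompactSupport_annulusKernel {r : ℝ} (hr : 0 < r) :
    HasCompactSupport (annulusKernel r) :=
  HasCompactSupport.intro (isCompact_closedBall (0 : ℂ) (2 * r)) fun w hw =>
    annulusKernel_eq_zero hr (by simpa using (not_le.1 (by simpa using hw) : 2 * r < ‖w‖).le)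

theorem integrable_annulusKernel {r : ℝ} (hr : 0 < r) : Integrable (annulusKernel r) :=
  (continuous_annulusKernel hr).integrable_of_hasCompactSupport (hasCompactSupport_annulusKernel hr)

theorem integral_annulusKernel_pos {r : ℝ} (hr : 0 < r) : 0 < ∫ w, annulusKernel r w := by
  refine (continuous_annulusKernel hr).integral_pos_of_hasCompactSupport_nonneg_nonzero
    (hasCompactSupport_annulusKernel hr) (annulusKernel_nonneg hr) (x := 0) ?_
  have : annulusKernel r 0 = Real.log 2 := by
    rw [annulusKernel, norm_zero, max_eq_right (by linarith), max_eq_right hr.le,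
      Real.log_mul (by norm_num) hr.ne']
    ring
  rw [this]
  exact (Real.log_pos (by norm_num)).ne'

theorem annulusKernel_sub_eq (u v : ℂ) (r : ℝ) :
    annulusKernel r (u - v) = smearedGreen v r u - smearedGreen v (2 * r) u := by
  simp only [annulusKernel, smearedGreen]; ring

/-- The kernel is a difference of two circle potentials, so its integrals are controlled by the
energy distance, uniformly in the pole `v` away from the real line. -/
theorem abs_integral_annulusKernel_sub_le {v : ℂ} {r R : ℝ} (hr : 0 < r) (hv : 2 * r < v.im)
    (hvR : v.im ≤ R) {ν lam : Measure ℂ} (hν : HasFiniteEnergy ν) (hl : HasFiniteEnergy lam) :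
    |∫ u, annulusKernel r (u - v) ∂ν - ∫ u, annulusKernel r (u - v) ∂lam| ≤
      2 * √(energyDist ν lam * Real.log (1 + 2 * R / r)) := by
  have := hν.finite
  have := hl.finite
  have h2r : 0 < 2 * r := by linarith
  have hr' : r < v.im := by linarith
  have hd := energyDist_nonneg hν hl
  simp_rw [annulusKernel_sub_eq]
  rw [integral_sub (integrable_smearedGreen hr hr' hν.upper) (integrable_smearedGreen h2r hv
    hν.upper), integral_sub (integrable_smearedGreen hr hr' hl.upper)
      (integrable_smearedGreen h2r hv hl.upper)]
  -- Both circles have radius between `r` and `Im v`, and one energy bound serves for both.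
  have key : ∀ s, r ≤ s → s < v.im → |∫ u, smearedGreen v s u ∂ν - ∫ u, smearedGreen v s u ∂lam| ≤
      √(energyDist ν lam * Real.log (1 + 2 * R / r)) := by
    intro s hs hsv
    have hs0 : 0 < s := hr.trans_le hs
    refine Real.abs_le_sqrt ((sq_integral_smearedGreen_sub_le hs0 hsv hν hl).trans ?_)
    have hv0 : 0 < v.im := by linarith
    have hR0 : 0 ≤ 2 * R := by linarith
    gcongr
  have h1 := abs_le.1 (key r le_rfl hr')
  have h2 := abs_le.1 (key (2 * r) (by linarith) hv)
  rw [abs_le]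
  constructor <;> linarith [h1.1, h1.2, h2.1, h2.2]

theorem exists_pos_le_im {S : Set ℂ} (hS : IsCompact S) (hSH : ∀ z ∈ S, 0 < z.im) :
    ∃ d > 0, ∀ z ∈ S, d ≤ z.im := by
  rcases S.eq_empty_or_nonempty with rfl | hne
  · exact ⟨1, one_pos, by simp⟩
  obtain ⟨z, hz, hmin⟩ := hS.exists_isMinOn hne Complex.continuous_im.continuousOn
  exact ⟨z.im, hSH z hz, fun w hw => hmin hw⟩

theorem abs_integral_le_integral {X : Type*} [MeasurableSpace X] {μ : Measure X} {f g : X → ℝ}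
    (hg : Integrable g μ) (h : ∀ᵐ x ∂μ, |f x| ≤ g x) : |∫ x, f x ∂μ| ≤ ∫ x, g x ∂μ := by
  rw [← Real.norm_eq_abs]
  exact norm_integral_le_of_norm_le hg h

/-- Convergence in energy implies vague convergence in the open half-plane. The test function is
mollified by differences of circle potentials, whose integrals are controlled by the energy
distance. -/
theorem exists_energyDist_lt_of_hasCompactSupport {F : ℂ → ℝ} (hF : Continuous F)
    (hFc : HasCompactSupport F) (hFH : tsupport F ⊆ {z | 0 < z.im}) {lam : Measure ℂ}
    (hl : HasFiniteEnergy lam) {ε : ℝ} (hε : 0 < ε) :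
    ∃ δ > 0, ∀ ν : Measure ℂ, HasFiniteEnergy ν → energyDist ν lam < δ →
      |∫ u, F u ∂ν - ∫ u, F u ∂lam| < ε := by
  have := hl.finite
  have hS : IsCompact (tsupport F) := hFc
  obtain ⟨d, hd, hdS⟩ := exists_pos_le_im hS hFH
  obtain ⟨R, hR⟩ := hS.isBounded.exists_norm_le
  have hS' : IsCompact (Metric.cthickening (d / 2) (tsupport F)) := hS.cthickening
  have hS'H : ∀ z ∈ Metric.cthickening (d / 2) (tsupport F), 0 < z.im := by
    intro z hz
    rw [hS.cthickening_eq_biUnion_closedBall (by positivity)] at hz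
    obtain ⟨w, hw, hzw⟩ := mem_iUnion₂.1 hz
    rw [Metric.mem_closedBall, dist_eq_norm] at hzw
    have h1 := (Complex.abs_im_le_norm (z - w)).trans hzw
    have h2 := hdS w hw
    have h3 := neg_abs_le (z - w).im
    rw [Complex.sub_im] at h1 h3
    linarith
  obtain ⟨c0, hc0, hc0S⟩ := exists_le_greenWeight hS' hS'H
  set Q := ∫ u, greenWeight u ∂lam with hQ
  have hQ0 : 0 ≤ Q := integral_greenWeight_nonneg hl.upper
  have hlog5 : 0 ≤ Real.log 5 := Real.log_nonneg (by norm_num)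
  -- the mass `∫ q dν` is at most `Q + √(log 5)` when the energy distance is at most one
  set M := 2 * Q + √(Real.log 5) + 1 with hM
  have hM0 : 0 < M := by positivity
  set ω := ε * c0 / (2 * M) with hω
  have hω0 : 0 < ω := by positivity
  obtain ⟨η, hη, hηF⟩ := Metric.uniformContinuous_iff.1
    (hFc.uniformContinuous_of_continuous hF) ω hω0
  set r := min (d / 5) (η / 3) with hr
  have hr0 : 0 < r := by positivity
  have hrd : 2 * r < d / 2 := by linarith [min_le_left (d / 5) (η / 3)]
  have hrη : 2 * r < η := by linarith [min_le_right (d / 5) (η / 3)]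
  set N := annulusKernel r with hN
  set cr := ∫ w, N w with hcr
  have hcr0 : 0 < cr := integral_annulusKernel_pos hr0
  have hFi : Integrable F := hF.integrable_of_hasCompactSupport hFc
  set L1 := ∫ v, |F v| with hL1
  have hL10 : 0 ≤ L1 := integral_nonneg fun _ => abs_nonneg _
  have hNc : Continuous N := continuous_annulusKernel hr0
  set Fr : ℂ → ℝ := fun u => ∫ v, F v * N (u - v) with hFr
  have hNi : ∀ u, Integrable fun v => N (u - v) := fun u =>
    (integrable_annulusKernel hr0).comp_sub_left u
  have hNle : ∀ w, |N w| ≤ Real.log 2 := fun w => by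
    rw [abs_of_nonneg (annulusKernel_nonneg hr0 w)]; exact annulusKernel_le hr0 w
  have hFNi : ∀ u, Integrable fun v => F v * N (u - v) := fun u =>
    hFi.mul_bdd (c := Real.log 2) (by fun_prop)
      (ae_of_all _ fun v => hNle _)
  -- `Fr / cr` is uniformly close to `F`, relative to the weight
  have happrox : ∀ u : ℂ, 0 ≤ u.im → |cr * F u - Fr u| ≤ cr * (ω / c0) * greenWeight u := by
    intro u hu
    have e1 : cr * F u = ∫ v, F u * N (u - v) := by
      rw [integral_const_mul, integral_sub_left_eq_self N volume u, mul_comm]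
    by_cases huS : u ∈ Metric.cthickening (d / 2) (tsupport F)
    · rw [e1, hFr, ← integral_sub ((hNi u).const_mul _) (hFNi u)]
      have h1 : ∀ v, ‖F u * N (u - v) - F v * N (u - v)‖ ≤ ω * N (u - v) := by
        intro v
        rw [← sub_mul, norm_mul, Real.norm_of_nonneg (annulusKernel_nonneg hr0 (u - v))]
        by_cases hv : 2 * r ≤ ‖u - v‖
        · simp [hN, annulusKernel_eq_zero hr0 hv]
        · refine mul_le_mul_of_nonneg_right ?_ (annulusKernel_nonneg hr0 _)
          have := hηF (a := u) (b := v) (by rw [dist_eq_norm]; linarith)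
          rw [Real.dist_eq] at this
          exact this.le
      have h2 := norm_integral_le_of_norm_le ((hNi u).const_mul ω) (ae_of_all _ h1)
      rw [integral_const_mul, integral_sub_left_eq_self N volume u] at h2
      refine h2.trans ?_
      have h3 := hc0S u huS
      have h4 : ω * cr = cr * (ω / c0) * c0 := by field_simp
      rw [h4]
      exact mul_le_mul_of_nonneg_left h3 (by positivity)
    · have hu0 : F u = 0 := by
        refine image_eq_zero_of_notMem_tsupport fun h => huS ?_
        exact Metric.self_subset_cthickening _ h
      have hFr0 : Fr u = 0 := by
        rw [hFr]
        refine integral_eq_zero_of_ae (ae_of_all _ fun v => ?_)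
        by_cases hv : v ∈ tsupport F
        · have : 2 * r ≤ ‖u - v‖ := by
            by_contra! h
            refine huS (Metric.mem_cthickening_of_dist_le u v _ _ hv ?_)
            rw [dist_eq_norm]; linarith
          simp [hN, annulusKernel_eq_zero hr0 this]
        · simp [image_eq_zero_of_notMem_tsupport hv]
      rw [hu0, hFr0]
      simpa using mul_nonneg (by positivity : 0 ≤ cr * (ω / c0)) (greenWeight_nonneg hu)
  have hFrm : ∀ α : Measure ℂ, IsFiniteMeasure α → Integrable Fr α := by
    intro α _
    have : Integrable (fun z : ℂ × ℂ => F z.2 * N (z.1 - z.2)) (α.prod volume) :=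
      (hFi.comp_snd α).mul_bdd (c := Real.log 2) (by fun_prop) (ae_of_all _ fun v => hNle _)
    exact this.integral_prod_left
  have hFrswap : ∀ α : Measure ℂ, IsFiniteMeasure α →
      ∫ u, Fr u ∂α = ∫ v, F v * ∫ u, N (u - v) ∂α := by
    intro α _
    have : Integrable (fun z : ℂ × ℂ => F z.2 * N (z.1 - z.2)) (α.prod volume) :=
      (hFi.comp_snd α).mul_bdd (c := Real.log 2) (by fun_prop) (ae_of_all _ fun v => hNle _)
    rw [hFr, integral_integral_swap this]
    simp_rw [integral_const_mul]
  have hFαi : ∀ α : Measure ℂ, IsFiniteMeasure α → Integrable F α := fun α _ => by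
    obtain ⟨C, hC⟩ := hF.bounded_above_of_compact_support hFc
    exact Integrable.of_bound hF.aestronglyMeasurable C (ae_of_all _ hC)
  set K := Real.log (1 + 2 * max R d / r) with hK
  have hK0 : 0 ≤ K := Real.log_nonneg (by
    have : 0 ≤ 2 * max R d / r := by positivity
    linarith)
  set T := L1 * 2 * √K / cr + 1 with hT
  have hT0 : 0 < T := by positivity
  refine ⟨min 1 ((ε / (2 * T)) ^ 2), by positivity, fun ν hν hdist => ?_⟩
  have := hν.finite
  have hd0 := energyDist_nonneg hν hl
  have hdist1 : energyDist ν lam ≤ 1 := (hdist.trans_le (min_le_left _ _)).le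
  have hsq : √(energyDist ν lam) < ε / (2 * T) := by
    rw [Real.sqrt_lt' (by positivity)]
    exact hdist.trans_le (min_le_right _ _)
  have hQν : ∫ u, greenWeight u ∂ν ≤ Q + √(Real.log 5) := by
    have h1 := Real.abs_le_sqrt (sq_integral_greenWeight_sub_le hν hl)
    have h2 : √(energyDist ν lam * Real.log 5) ≤ √(Real.log 5) :=
      Real.sqrt_le_sqrt (by nlinarith)
    linarith [(abs_le.1 (h1.trans h2)).2]
  have hFNint : ∀ α : Measure ℂ, IsFiniteMeasure α →
      Integrable fun v => F v * ∫ u, N (u - v) ∂α := by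
    intro α _
    have hNm : Continuous fun z : ℂ × ℂ => N (z.2 - z.1) := by fun_prop
    refine hFi.mul_bdd (c := Real.log 2 * α.real univ) ?_ (ae_of_all _ fun v => ?_)
    · exact (StronglyMeasurable.integral_prod_right' (ν := α)
        hNm.stronglyMeasurable).aestronglyMeasurable
    · exact norm_integral_le_of_norm_le_const (ae_of_all _ fun u => hNle _)
  have hmain : |∫ u, Fr u ∂ν - ∫ u, Fr u ∂lam| ≤ L1 * (2 * (√(energyDist ν lam) * √K)) := by
    rw [hFrswap ν hν.finite, hFrswap lam hl.finite, ← integral_sub]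
    · rw [hL1, ← integral_mul_const]
      refine abs_integral_le_integral (hFi.abs.mul_const _) (ae_of_all _ fun v => ?_)
      rw [← mul_sub, abs_mul]
      by_cases hv : v ∈ tsupport F
      · refine mul_le_mul_of_nonneg_left ?_ (abs_nonneg _)
        rw [← Real.sqrt_mul hd0]
        exact abs_integral_annulusKernel_sub_le hr0 (by linarith [hdS v hv])
          (((le_abs_self _).trans ((Complex.abs_im_le_norm v).trans (hR v hv))).trans
            (le_max_left _ _)) hν hl
      · simp [image_eq_zero_of_notMem_tsupport hv]
    · exact hFNint ν hν.finite
    · exact hFNint lam hl.finite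
  have herr : ∀ α : Measure ℂ, HasFiniteEnergy α →
      |∫ u, F u ∂α - (∫ u, Fr u ∂α) / cr| ≤ ω / c0 * ∫ u, greenWeight u ∂α := by
    intro α hα
    have := hα.finite
    rw [← integral_div, ← integral_sub (hFαi α hα.finite) ((hFrm α hα.finite).div_const _),
      ← integral_const_mul]
    refine abs_integral_le_integral ((integrable_greenWeight hα.upper).const_mul _) ?_
    filter_upwards [hα.upper] with u hu
    have h1 := happrox u hu
    have h2 : F u - Fr u / cr = (cr * F u - Fr u) / cr := by field_simp
    rw [h2, abs_div, abs_of_pos hcr0, div_le_iff₀ hcr0]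
    calc _ ≤ _ := h1
      _ = _ := by ring
  have h1 := herr ν hν
  have h2 := herr lam hl
  have h3 : |(∫ u, Fr u ∂ν) / cr - (∫ u, Fr u ∂lam) / cr| < ε / 2 := by
    rw [← sub_div, abs_div, abs_of_pos hcr0]
    calc _ ≤ L1 * (2 * (√(energyDist ν lam) * √K)) / cr := by gcongr
      _ = (T - 1) * √(energyDist ν lam) := by rw [hT]; ring
      _ ≤ T * √(energyDist ν lam) := by
        have := Real.sqrt_nonneg (energyDist ν lam)
        nlinarith
      _ < T * (ε / (2 * T)) := by gcongr
      _ = ε / 2 := by field_simp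
  have h4 : ω / c0 * ∫ u, greenWeight u ∂ν + ω / c0 * ∫ u, greenWeight u ∂lam ≤ ε / 2 := by
    calc _ = ω / c0 * (∫ u, greenWeight u ∂ν + Q) := by rw [hQ]; ring
      _ ≤ ω / c0 * M := by
        gcongr
        linarith
      _ = ε / 2 := by rw [hω]; field_simp
  have h1' := abs_le.1 h1
  have h2' := abs_le.1 h2
  have h3' := abs_lt.1 h3
  rw [abs_lt]
  constructor <;> linarith [h1'.1, h1'.2, h2'.1, h2'.2, h3'.1, h3'.2]

/-- A continuous cutoff equal to one on most of the open half-plane. -/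
noncomputable def halfPlaneCutoff (n : ℕ) (z : ℂ) : ℝ :=
  max 0 (min 1 ((n + 1) * z.im - 1)) * max 0 (min 1 (n + 1 - ‖z‖))

theorem continuous_halfPlaneCutoff (n : ℕ) : Continuous (halfPlaneCutoff n) := by
  unfold halfPlaneCutoff
  have := Complex.continuous_im
  fun_prop

theorem halfPlaneCutoff_nonneg (n : ℕ) (z : ℂ) : 0 ≤ halfPlaneCutoff n z := by
  unfold halfPlaneCutoff; positivity

theorem halfPlaneCutoff_le_one (n : ℕ) (z : ℂ) : halfPlaneCutoff n z ≤ 1 := by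
  unfold halfPlaneCutoff
  exact mul_le_one₀ (by simp) (by positivity) (by simp)

theorem mem_of_halfPlaneCutoff_ne_zero {n : ℕ} {z : ℂ} (h : halfPlaneCutoff n z ≠ 0) :
    z ∈ {z : ℂ | 1 ≤ (n + 1) * z.im} ∩ Metric.closedBall 0 (n + 1) := by
  unfold halfPlaneCutoff at h
  constructor
  · by_contra! h'
    simp only [mem_ofPred_eq, not_le] at h'
    apply h
    rw [max_eq_left, zero_mul]
    exact (min_le_right _ _).trans (by linarith)
  · by_contra! h'
    simp only [Metric.mem_closedBall, dist_zero_right, not_le] at h'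
    apply h
    rw [max_eq_left (b := min 1 ((n : ℝ) + 1 - ‖z‖)), mul_zero]
    exact (min_le_right _ _).trans (by linarith)

theorem tendsto_halfPlaneCutoff {z : ℂ} (hz : 0 < z.im) :
    Tendsto (fun n => halfPlaneCutoff n z) atTop (𝓝 1) := by
  refine tendsto_const_nhds.congr' ?_
  have h1 := tendsto_natCast_atTop_atTop (R := ℝ)
  filter_upwards [h1.eventually_ge_atTop (2 / z.im), h1.eventually_ge_atTop ‖z‖] with n hn1 hn2
  have : 2 ≤ (n + 1) * z.im := by
    rw [div_le_iff₀ hz] at hn1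
    linarith
  rw [halfPlaneCutoff, min_eq_left (by linarith), min_eq_left (by linarith)]
  simp

theorem isCompact_halfPlaneCutoff_set (n : ℕ) :
    IsCompact ({z : ℂ | 1 ≤ (n + 1) * z.im} ∩ Metric.closedBall (0 : ℂ) (n + 1)) := by
  refine (isCompact_closedBall (0 : ℂ) (n + 1)).inter_left ?_
  have := Complex.continuous_im
  exact isClosed_le continuous_const (by fun_prop)

theorem tsupport_halfPlaneCutoff_subset {f : ℂ → ℝ} (n : ℕ) :
    tsupport (fun z => halfPlaneCutoff n z * f z) ⊆
      {z : ℂ | 1 ≤ (n + 1) * z.im} ∩ Metric.closedBall (0 : ℂ) (n + 1) :=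
  closure_minimal (fun _ hz => mem_of_halfPlaneCutoff_ne_zero (left_ne_zero_of_mul hz))
    (isCompact_halfPlaneCutoff_set n).isClosed

theorem integrable_of_abs_le_greenWeight {f : ℂ → ℝ} (hf : ContinuousOn f {z | 0 < z.im}) {C : ℝ}
    (hfC : ∀ u : ℂ, 0 ≤ u.im → |f u| ≤ C * greenWeight u) {ν : Measure ℂ} [IsFiniteMeasure ν]
    (hν : ∀ᵐ z ∂ν, 0 ≤ z.im) : Integrable f ν := by
  have hm : MeasurableSet {z : ℂ | 0 < z.im} := measurableSet_lt measurable_const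
    Complex.measurable_im
  refine ((integrable_greenWeight hν).const_mul C).mono' ?_ ?_
  · have h1 : AEStronglyMeasurable ({z : ℂ | 0 < z.im}.indicator f) ν :=
      (aestronglyMeasurable_indicator_iff hm).2 (hf.aestronglyMeasurable hm)
    refine h1.congr ?_
    filter_upwards [hν] with u hu
    by_cases h : 0 < u.im
    · rw [indicator_of_mem (by exact h)]
    · rw [indicator_of_notMem (by exact h)]
      have := hfC u hu
      rw [greenWeight_of_im_eq_zero (le_antisymm (not_lt.1 h) hu), mul_zero] at this
      exact (abs_nonpos_iff.1 this).symm
  · filter_upwards [hν] with u hu using hfC u hu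

/-- Convergence in energy tests every continuous function on the open half-plane which is bounded
by a multiple of the weight: no weighted mass can escape to the boundary, since the integral of the
weight itself converges. -/
theorem exists_energyDist_lt {f : ℂ → ℝ} (hf : ContinuousOn f {z | 0 < z.im}) {C : ℝ}
    (hfC : ∀ u : ℂ, 0 ≤ u.im → |f u| ≤ C * greenWeight u) {lam : Measure ℂ}
    (hl : HasFiniteEnergy lam) {ε : ℝ} (hε : 0 < ε) :
    ∃ δ > 0, ∀ ν : Measure ℂ, HasFiniteEnergy ν → energyDist ν lam < δ →
      |∫ u, f u ∂ν - ∫ u, f u ∂lam| < ε := by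
  have := hl.finite
  have hC : 0 ≤ C := by
    have h1 := (abs_nonneg _).trans (hfC Complex.I (by simp))
    exact nonneg_of_mul_nonneg_left h1 (greenWeight_pos (by simp))
  have hcontmul : ∀ (n : ℕ) (g : ℂ → ℝ), ContinuousOn g {z | 0 < z.im} →
      Continuous fun z => halfPlaneCutoff n z * g z := by
    intro n g hg
    refine continuous_of_tsupport fun z hz => ?_
    have hz' := tsupport_halfPlaneCutoff_subset n hz
    have hzim : 0 < z.im := by
      have : (1 : ℝ) ≤ (n + 1) * z.im := hz'.1
      by_contra! h
      have : ((n : ℝ) + 1) * z.im ≤ 0 := mul_nonpos_of_nonneg_of_nonpos (by positivity) h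
      linarith
    exact (continuous_halfPlaneCutoff n).continuousAt.mul
      (hg.continuousAt ((isOpen_lt continuous_const Complex.continuous_im).mem_nhds hzim))
  have hsupp : ∀ (n : ℕ) (g : ℂ → ℝ),
      tsupport (fun z => halfPlaneCutoff n z * g z) ⊆ {z | 0 < z.im} := by
    intro n g z hz
    have : (1 : ℝ) ≤ (n + 1) * z.im := (tsupport_halfPlaneCutoff_subset n hz).1
    by_contra! h
    have h' : z.im ≤ 0 := not_lt.1 h
    have : ((n : ℝ) + 1) * z.im ≤ 0 := mul_nonpos_of_nonneg_of_nonpos (by positivity) h'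
    linarith
  have hcs : ∀ (n : ℕ) (g : ℂ → ℝ), HasCompactSupport fun z => halfPlaneCutoff n z * g z :=
    fun n g => (isCompact_halfPlaneCutoff_set n).of_isClosed_subset (isClosed_tsupport _)
      (tsupport_halfPlaneCutoff_subset n)
  have hqc : ContinuousOn greenWeight {z | 0 < z.im} :=
    continuousOn_greenWeight.mono fun z (hz : 0 < z.im) => hz.le
  -- most of the weighted mass of `lam` lies under the cutoff
  have htail : Tendsto (fun n => ∫ u, halfPlaneCutoff n u * greenWeight u ∂lam) atTop
      (𝓝 (∫ u, greenWeight u ∂lam)) := by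
    refine tendsto_integral_of_dominated_convergence greenWeight
      (fun n => (hcontmul n _ hqc).aestronglyMeasurable) (integrable_greenWeight hl.upper) ?_ ?_
    · intro n
      filter_upwards [hl.upper] with u hu
      rw [norm_mul, Real.norm_of_nonneg (halfPlaneCutoff_nonneg n u),
        Real.norm_of_nonneg (greenWeight_nonneg hu)]
      exact mul_le_of_le_one_left (greenWeight_nonneg hu) (halfPlaneCutoff_le_one n u)
    · filter_upwards [hl.upper] with u hu
      rcases hu.eq_or_lt with h | h
      · simp [greenWeight_of_im_eq_zero h.symm]
      · simpa using (tendsto_halfPlaneCutoff h).mul_const (greenWeight u)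
  set ε' := ε / (8 * (C + 1)) with hε'
  have hε'0 : 0 < ε' := by positivity
  obtain ⟨n, hn⟩ := ((Metric.tendsto_atTop.1 htail) ε' hε'0)
  have hn := hn n le_rfl
  rw [Real.dist_eq] at hn
  obtain ⟨δ1, hδ1, H1⟩ := exists_energyDist_lt_of_hasCompactSupport (hcontmul n f hf) (hcs n f)
    (hsupp n f) hl (half_pos hε)
  obtain ⟨δ2, hδ2, H2⟩ := exists_energyDist_lt_of_hasCompactSupport (hcontmul n _ hqc) (hcs n _)
    (hsupp n _) hl (half_pos hε'0)
  -- The last bound makes the integrals of the weight itself `ε' / 2`-close; together with `H2` it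
  -- keeps the weighted mass of `ν` outside the cutoff small.
  refine ⟨min (min δ1 δ2) (ε' ^ 2 / 4 / (Real.log 5 + 1)), ?_, fun ν hν hd => ?_⟩
  · have : 0 < Real.log 5 + 1 := by linarith [Real.log_nonneg (by norm_num : (1 : ℝ) ≤ 5)]
    positivity
  have := hν.finite
  have h1 := H1 ν hν (hd.trans_le ((min_le_left _ _).trans (min_le_left _ _)))
  have h2 := H2 ν hν (hd.trans_le ((min_le_left _ _).trans (min_le_right _ _)))
  have h3 : |∫ u, greenWeight u ∂ν - ∫ u, greenWeight u ∂lam| ≤ ε' / 2 := by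
    have hlog : 0 ≤ Real.log 5 := Real.log_nonneg (by norm_num)
    refine abs_le_of_sq_le_sq ((sq_integral_greenWeight_sub_le hν hl).trans ?_) (by positivity)
    have h4 := hd.trans_le (min_le_right _ _)
    rw [lt_div_iff₀ (by linarith)] at h4
    nlinarith [energyDist_nonneg hν hl]
  have herr : ∀ α : Measure ℂ, HasFiniteEnergy α →
      |∫ u, f u ∂α - ∫ u, halfPlaneCutoff n u * f u ∂α| ≤
        C * (∫ u, greenWeight u ∂α - ∫ u, halfPlaneCutoff n u * greenWeight u ∂α) := by
    intro α hα
    have := hα.finite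
    have hi : ∀ g : ℂ → ℝ, ContinuousOn g {z | 0 < z.im} →
        Integrable (fun u => halfPlaneCutoff n u * g u) α := fun g hg => by
      obtain ⟨B, hB⟩ := (hcontmul n g hg).bounded_above_of_compact_support (hcs n g)
      exact Integrable.of_bound (hcontmul n g hg).aestronglyMeasurable B (ae_of_all _ hB)
    rw [← integral_sub (integrable_of_abs_le_greenWeight hf hfC hα.upper) (hi f hf),
      ← integral_sub (integrable_greenWeight hα.upper) (hi _ hqc), ← integral_const_mul]
    refine abs_integral_le_integral
      (((integrable_greenWeight hα.upper).sub (hi _ hqc)).const_mul C) ?_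
    filter_upwards [hα.upper] with u hu
    have e1 : f u - halfPlaneCutoff n u * f u = (1 - halfPlaneCutoff n u) * f u := by ring
    have e2 : 0 ≤ 1 - halfPlaneCutoff n u := by linarith [halfPlaneCutoff_le_one n u]
    rw [e1, abs_mul, abs_of_nonneg e2]
    calc (1 - halfPlaneCutoff n u) * |f u| ≤
          (1 - halfPlaneCutoff n u) * (C * greenWeight u) := by gcongr; exact hfC u hu
      _ = _ := by ring
  have h5 := abs_le.1 (herr ν hν)
  have h6 := abs_le.1 (herr lam hl)
  have h1' := abs_lt.1 h1
  have h2' := abs_lt.1 h2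
  have h3' := abs_le.1 h3
  have hn' := abs_lt.1 hn
  have h7 : C * (∫ u, greenWeight u ∂ν - ∫ u, halfPlaneCutoff n u * greenWeight u ∂ν) ≤
      C * (∫ u, greenWeight u ∂lam - ∫ u, halfPlaneCutoff n u * greenWeight u ∂lam + ε') :=
    mul_le_mul_of_nonneg_left (by linarith [h3'.2, h2'.1]) hC
  have h8 : C * (∫ u, greenWeight u ∂lam - ∫ u, halfPlaneCutoff n u * greenWeight u ∂lam) ≤
      C * ε' := mul_le_mul_of_nonneg_left (by linarith [hn'.1]) hC
  have h9 : 8 * (C * ε') + 8 * ε' = ε := by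
    rw [hε']; field_simp
  have h10 : C * (∫ u, greenWeight u ∂lam - ∫ u, halfPlaneCutoff n u * greenWeight u ∂lam + ε')
      = C * (∫ u, greenWeight u ∂lam - ∫ u, halfPlaneCutoff n u * greenWeight u ∂lam) + C * ε' := by
    ring
  rw [abs_lt]
  constructor <;> nlinarith [h5.1, h5.2, h6.1, h6.2, h1'.1, h1'.2]

/-! ### Variation of the Green function -/

/-- Minus the derivative of the Green function of the half-plane along the flow `z ↦ z + τ k(z)`
has real part of this complex kernel. -/
noncomputable def variationKernel (k : ℂ → ℂ) (u v : ℂ) : ℂ :=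
  (k u - k v) / (u - v) - (k u - starRingEnd ℂ (k v)) / (u - starRingEnd ℂ v)

/-- The Green function as a real function; on the diagonal it takes the junk value `0`. -/
noncomputable def greenReal (u v : ℂ) : ℝ := Real.log (‖u - starRingEnd ℂ v‖ / ‖u - v‖)

theorem greenFunction_eq_ofReal {u v : ℂ} (h : ¬ (u = v ∧ 0 < u.im)) :
    greenFunction u v = ENNReal.ofReal (greenReal u v) := by
  rw [greenFunction, if_neg h, greenReal]

theorem greenReal_nonneg {u v : ℂ} (hu : 0 ≤ u.im) (hv : 0 ≤ v.im) : 0 ≤ greenReal u v := by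
  unfold greenReal
  by_cases h : ‖u - v‖ = 0
  · simp [h]
  · refine Real.log_nonneg ?_
    rw [le_div_iff₀ (lt_of_le_of_ne (norm_nonneg _) (Ne.symm h)), one_mul]
    exact norm_sub_le_norm_sub_conj hu hv

theorem measurable_greenReal : Measurable fun z : ℂ × ℂ => greenReal z.1 z.2 := by
  unfold greenReal
  have := Complex.continuous_conj.measurable
  fun_prop

/-- The error of the linearisation of `log |1 + z| - log |1 + w|` is small relative to `|z - w|`, and
not only to `r`. The difference of the two slopes of the Green function vanishes at the real line,
and this form of the bound preserves that. -/
theorem abs_log_norm_one_add_sub_le {z w : ℂ} {r : ℝ} (hr : r ≤ 1 / 2) (hz : ‖z‖ ≤ r)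
    (hw : ‖w‖ ≤ r) :
    |Real.log ‖1 + z‖ - Real.log ‖1 + w‖ - (z - w).re| ≤ 2 * r * ‖z - w‖ := by
  have hre : ∀ x ∈ Metric.closedBall (0 : ℂ) r, 1 / 2 ≤ (1 + x).re := by
    intro x hx
    have h1 : ‖x‖ ≤ r := by simpa using hx
    have := (abs_le.1 ((Complex.abs_re_le_norm x).trans h1)).1
    simp
    linarith
  have hderiv : ∀ x ∈ Metric.closedBall (0 : ℂ) r, HasDerivWithinAt
      (fun x => Complex.log (1 + x) - x) (1 / (1 + x) - 1) (Metric.closedBall (0 : ℂ) r) x := by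
    intro x hx
    have hs : 1 + x ∈ Complex.slitPlane := Or.inl (by linarith [hre x hx])
    exact ((((hasDerivAt_id' x).const_add 1).clog hs).sub (hasDerivAt_id' x)).hasDerivWithinAt
  have hbound : ∀ x ∈ Metric.closedBall (0 : ℂ) r, ‖1 / (1 + x) - 1‖ ≤ 2 * r := by
    intro x hx
    have h1 : ‖x‖ ≤ r := by simpa using hx
    have h2 : 1 / 2 ≤ ‖1 + x‖ := (hre x hx).trans (Complex.re_le_norm _)
    have h3 : (1 : ℂ) + x ≠ 0 := norm_pos_iff.1 (by linarith)
    have h4 : 1 / (1 + x) - 1 = -x / (1 + x) := by field_simp; ring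
    rw [h4, norm_div, norm_neg, div_le_iff₀ (by linarith)]
    nlinarith [norm_nonneg x]
  have h := (convex_closedBall (0 : ℂ) r).norm_image_sub_le_of_norm_hasDerivWithin_le
    hderiv hbound (x := w) (y := z) (by simpa using hw) (by simpa using hz)
  refine le_trans ?_ h
  have e : Real.log ‖1 + z‖ - Real.log ‖1 + w‖ - (z - w).re =
      (Complex.log (1 + z) - z - (Complex.log (1 + w) - w)).re := by
    simp [Complex.log_re]; ring
  rw [e]
  exact Complex.abs_re_le_norm _

section Kernel

variable {k : ℂ → ℂ}

theorem eq_zero_of_im_nonpos (hS : tsupport k ⊆ {z | 0 < z.im}) {z : ℂ} (hz : z.im ≤ 0) :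
    k z = 0 :=
  image_eq_zero_of_notMem_tsupport fun h => (not_lt.2 hz) (hS h)

/-- The field vanishes in the lower half-plane, so both values are compared with zero there. -/
theorem norm_slope_conj_le {L : NNReal} (hL : LipschitzWith L k) (hS : tsupport k ⊆ {z | 0 < z.im})
    {u v : ℂ} (hu : 0 ≤ u.im) (hv : 0 ≤ v.im) :
    ‖(k u - starRingEnd ℂ (k v)) / (u - starRingEnd ℂ v)‖ ≤ 2 * L := by
  have h1 : k (starRingEnd ℂ u) = 0 := eq_zero_of_im_nonpos hS (by simpa using hu)
  have h2 : k (starRingEnd ℂ v) = 0 := eq_zero_of_im_nonpos hS (by simpa using hv)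
  have h3 := hL.norm_sub_le u (starRingEnd ℂ v)
  have h4 := hL.norm_sub_le v (starRingEnd ℂ u)
  rw [h2, sub_zero] at h3
  rw [h1, sub_zero, ← norm_sub_conj_comm] at h4
  rw [norm_div]
  refine div_le_of_le_mul₀ (norm_nonneg _) (by positivity) ?_
  refine (norm_sub_le _ _).trans ?_
  rw [Complex.norm_conj]
  linarith

theorem norm_slope_le {L : NNReal} (hL : LipschitzWith L k) (u v : ℂ) :
    ‖(k u - k v) / (u - v)‖ ≤ L := by
  rw [norm_div]
  exact div_le_of_le_mul₀ (norm_nonneg _) (by positivity) (hL.norm_sub_le u v)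

/-- The reflected slope is symmetric up to conjugation, so its real part is symmetric. -/
theorem slope_conj_comm (k : ℂ → ℂ) (u v : ℂ) :
    starRingEnd ℂ ((k u - starRingEnd ℂ (k v)) / (u - starRingEnd ℂ v)) =
      (k v - starRingEnd ℂ (k u)) / (v - starRingEnd ℂ u) := by
  rw [map_div₀, map_sub, map_sub, Complex.conj_conj, Complex.conj_conj, ← neg_div_neg_eq]
  congr 1 <;> ring

theorem slope_comm' (k : ℂ → ℂ) (u v : ℂ) : (k u - k v) / (u - v) = (k v - k u) / (v - u) := by
  rw [← neg_div_neg_eq]; congr 1 <;> ring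

theorem variationKernel_re_comm (k : ℂ → ℂ) (u v : ℂ) :
    (variationKernel k u v).re = (variationKernel k v u).re := by
  unfold variationKernel
  rw [Complex.sub_re, Complex.sub_re, slope_comm' k u v, ← slope_conj_comm k u v, Complex.conj_re]

/-- For `v` near the support of `k` both weights are bounded below and the kernel is bounded. Away
from the support the kernel is `k(u) (v - v*) / ((u - v) (u - v*))`, which vanishes at the real line
and at infinity at least as fast as the weight. -/
theorem exists_norm_variationKernel_le {L : NNReal} (hL : LipschitzWith L k)
    (hc : HasCompactSupport k) (hS : tsupport k ⊆ {z | 0 < z.im}) :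
    ∃ C > 0, ∀ u ∈ tsupport k, ∀ v : ℂ, 0 ≤ v.im →
      ‖variationKernel k u v‖ ≤ C * (greenWeight u * greenWeight v) := by
  have hSc : IsCompact (tsupport k) := hc
  obtain ⟨δ, hδ, hδS⟩ := hSc.exists_cthickening_subset_open
    (isOpen_lt continuous_const Complex.continuous_im) hS
  obtain ⟨c, hc0, hcS⟩ := exists_le_greenWeight (hSc.cthickening (r := δ)) hδS
  obtain ⟨R, hR⟩ := hSc.isBounded.exists_norm_le
  obtain ⟨M, hM⟩ := (hL.continuous).bounded_above_of_compact_support hc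
  have hM0 : 0 ≤ M := (norm_nonneg _).trans (hM 0)
  set B := (1 + |R|) / δ + 1 with hB
  have hB0 : 0 < B := by positivity
  refine ⟨3 * L / c ^ 2 + 2 * M * B ^ 2 / c + 1, by positivity, fun u hu v hv => ?_⟩
  have huc : c ≤ greenWeight u := hcS u (Metric.self_subset_cthickening _ hu)
  have hu0 : 0 < u.im := hS hu
  have hqv := greenWeight_nonneg hv
  have hqu := greenWeight_nonneg hu0.le
  -- Near the support the two slopes are estimated separately, away from it their difference.
  by_cases hvS : v ∈ Metric.cthickening δ (tsupport k)
  · have hvc := hcS v hvS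
    have h1 : ‖variationKernel k u v‖ ≤ 3 * L := by
      unfold variationKernel
      refine (norm_sub_le _ _).trans ?_
      linarith [norm_slope_le hL u v, norm_slope_conj_le hL hS hu0.le hv]
    have h2 : c ^ 2 ≤ greenWeight u * greenWeight v := by
      rw [sq]; exact mul_le_mul huc hvc hc0.le hqu
    calc ‖variationKernel k u v‖ ≤ 3 * L := h1
      _ = 3 * L / c ^ 2 * c ^ 2 := by field_simp
      _ ≤ 3 * L / c ^ 2 * (greenWeight u * greenWeight v) := by gcongr
      _ ≤ _ := by
        refine mul_le_mul_of_nonneg_right ?_ (by positivity)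
        have : 0 ≤ 2 * M * B ^ 2 / c := by positivity
        linarith
  · have hkv : k v = 0 := image_eq_zero_of_notMem_tsupport fun h =>
      hvS (Metric.self_subset_cthickening _ h)
    have hd : δ < ‖u - v‖ := by
      by_contra! h
      refine hvS (Metric.mem_cthickening_of_dist_le v u _ _ hu ?_)
      rwa [dist_comm, dist_eq_norm]
    have hd0 : 0 < ‖u - v‖ := hδ.trans hd
    have hne : u - v ≠ 0 := norm_pos_iff.1 hd0
    have hd1 : ‖u - v‖ ≤ ‖u - starRingEnd ℂ v‖ := norm_sub_le_norm_sub_conj hu0.le hv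
    have hne' : u - starRingEnd ℂ v ≠ 0 := norm_pos_iff.1 (hd0.trans_le hd1)
    have e : variationKernel k u v =
        k u * (v - starRingEnd ℂ v) / ((u - v) * (u - starRingEnd ℂ v)) := by
      rw [variationKernel, hkv, map_zero, sub_zero]
      field_simp
      ring
    have hv2 : ‖v - starRingEnd ℂ v‖ = 2 * v.im := by
      rw [Complex.sub_conj]; simp [abs_of_nonneg hv]
    have hvn : 1 + ‖v‖ ≤ B * ‖u - v‖ := by
      have h1 : ‖v‖ ≤ |R| + ‖u - v‖ := by
        calc ‖v‖ = ‖u - (u - v)‖ := by congr 1; ring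
          _ ≤ ‖u‖ + ‖u - v‖ := norm_sub_le _ _
          _ ≤ _ := by linarith [hR u hu, le_abs_self R]
      have h2 : 1 + |R| ≤ (1 + |R|) / δ * ‖u - v‖ := by
        rw [div_mul_eq_mul_div, le_div_iff₀ hδ]
        gcongr
      rw [hB]
      linarith
    have h1 : ‖variationKernel k u v‖ ≤ 2 * M * B ^ 2 * greenWeight v := by
      rw [e, norm_div, norm_mul, norm_mul, hv2]
      have hp : 0 < 1 + ‖v‖ := by positivity
      calc ‖k u‖ * (2 * v.im) / (‖u - v‖ * ‖u - starRingEnd ℂ v‖)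
          ≤ M * (2 * v.im) / (‖u - v‖ * ‖u - v‖) := by
            gcongr
            exact hM u
        _ = 2 * M * B ^ 2 * (v.im / (B * ‖u - v‖) ^ 2) := by field_simp
        _ ≤ 2 * M * B ^ 2 * (v.im / (1 + ‖v‖) ^ 2) := by gcongr
        _ ≤ _ := by gcongr; exact le_greenWeight hv
    calc ‖variationKernel k u v‖ ≤ 2 * M * B ^ 2 * greenWeight v := h1
      _ = 2 * M * B ^ 2 / c * (c * greenWeight v) := by field_simp
      _ ≤ 2 * M * B ^ 2 / c * (greenWeight u * greenWeight v) := by gcongr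
      _ ≤ _ := by
        refine mul_le_mul_of_nonneg_right ?_ (by positivity)
        have : 0 ≤ 3 * L / c ^ 2 := by positivity
        linarith

theorem variationKernel_eq_zero {u v : ℂ} (hu : u ∉ tsupport k)
    (hv : v ∉ tsupport k) : variationKernel k u v = 0 := by
  simp [variationKernel, image_eq_zero_of_notMem_tsupport hu, image_eq_zero_of_notMem_tsupport hv]

/-- First-order expansion of the Green function along the flow, uniform relative to the weights. -/
theorem exists_greenReal_variation {L : NNReal} (hL : LipschitzWith L k)
    (hc : HasCompactSupport k) (hS : tsupport k ⊆ {z | 0 < z.im}) :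
    ∃ C > 0, ∃ τ₀ > 0, (∀ u v : ℂ, 0 ≤ u.im → 0 ≤ v.im →
        |(variationKernel k u v).re| ≤ C * (greenWeight u * greenWeight v)) ∧
      ∀ τ : ℝ, |τ| ≤ τ₀ → ∀ u v : ℂ, 0 ≤ u.im → 0 ≤ v.im → ¬ (u = v ∧ 0 < u.im) →
        |greenReal (u + τ * k u) (v + τ * k v) - greenReal u v + τ * (variationKernel k u v).re| ≤
          C * τ ^ 2 * (greenWeight u * greenWeight v) := by
  obtain ⟨C, hC0, hC⟩ := exists_norm_variationKernel_le hL hc hS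
  set D := 2 * (L : ℝ) + 1 with hD
  have hD0 : 0 < D := by positivity
  have hD1 : 1 ≤ D := by simp [hD]
  have key : ∀ u v : ℂ, 0 ≤ u.im → 0 ≤ v.im →
      |(variationKernel k u v).re| ≤ C * (greenWeight u * greenWeight v) ∧
      ∀ r : ℝ, r ≤ 1 / 2 → 0 ≤ r → ∀ τ : ℝ, |τ| * D ≤ r →
        |Real.log ‖1 + τ * ((k u - starRingEnd ℂ (k v)) / (u - starRingEnd ℂ v))‖ -
          Real.log ‖1 + τ * ((k u - k v) / (u - v))‖ + τ * (variationKernel k u v).re| ≤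
          2 * r * (|τ| * (C * (greenWeight u * greenWeight v))) := by
    intro u v hu hv
    have hqu := greenWeight_nonneg hu
    have hqv := greenWeight_nonneg hv
    -- The kernel bound needs its first argument in the support of `k`; the other cases are reduced to it
    -- by symmetry, or the field vanishes at both points.
    by_cases huS : u ∈ tsupport k
    · have h1 := hC u huS v hv
      refine ⟨(Complex.abs_re_le_norm _).trans h1, fun r hr hr0 τ hτ => ?_⟩
      set a := (k u - k v) / (u - v) with ha
      set b := (k u - starRingEnd ℂ (k v)) / (u - starRingEnd ℂ v) with hb
      have hab : variationKernel k u v = a - b := rfl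
      have hsm : ∀ z : ℂ, ‖z‖ ≤ D → ‖(τ : ℂ) * z‖ ≤ r := fun z hz => by
        rw [norm_mul, Complex.norm_real, Real.norm_eq_abs]
        exact (mul_le_mul_of_nonneg_left hz (abs_nonneg _)).trans hτ
      have h2 := abs_log_norm_one_add_sub_le hr
        (hsm b ((norm_slope_conj_le hL hS hu hv).trans (by simp [hD])))
        (hsm a ((norm_slope_le hL u v).trans (by rw [hD]; linarith [L.coe_nonneg])))
      have e : ((τ : ℂ) * b - τ * a).re = -(τ * (variationKernel k u v).re) := by
        rw [hab, ← mul_sub, Complex.re_ofReal_mul, Complex.sub_re, Complex.sub_re]; ring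
      rw [e, sub_neg_eq_add, ← mul_sub, norm_mul, Complex.norm_real, Real.norm_eq_abs,
        norm_sub_rev b a, ← hab] at h2
      refine h2.trans ?_
      gcongr
    · by_cases hvS : v ∈ tsupport k
      · have h1 := hC v hvS u hu
        rw [mul_comm (greenWeight v)] at h1
        refine ⟨?_, fun r hr hr0 τ hτ => ?_⟩
        · rw [variationKernel_re_comm]
          exact (Complex.abs_re_le_norm _).trans h1
        set a := (k v - k u) / (v - u) with ha
        set b := (k v - starRingEnd ℂ (k u)) / (v - starRingEnd ℂ u) with hb
        have hab : variationKernel k v u = a - b := rfl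
        have hsm : ∀ z : ℂ, ‖z‖ ≤ D → ‖(τ : ℂ) * z‖ ≤ r := fun z hz => by
          rw [norm_mul, Complex.norm_real, Real.norm_eq_abs]
          exact (mul_le_mul_of_nonneg_left hz (abs_nonneg _)).trans hτ
        have h2 := abs_log_norm_one_add_sub_le hr
          (hsm b ((norm_slope_conj_le hL hS hv hu).trans (by simp [hD])))
          (hsm a ((norm_slope_le hL v u).trans (by rw [hD]; linarith [L.coe_nonneg])))
        have e : ((τ : ℂ) * b - τ * a).re = -(τ * (variationKernel k v u).re) := by
          rw [hab, ← mul_sub, Complex.re_ofReal_mul, Complex.sub_re, Complex.sub_re]; ring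
        have e2 : ‖1 + (τ : ℂ) * ((k u - starRingEnd ℂ (k v)) / (u - starRingEnd ℂ v))‖ =
            ‖1 + (τ : ℂ) * b‖ := by
          rw [hb, ← slope_conj_comm k u v, ← Complex.norm_conj, map_add, map_one, map_mul,
            Complex.conj_ofReal]
        rw [e, sub_neg_eq_add, ← mul_sub, norm_mul, Complex.norm_real, Real.norm_eq_abs,
          norm_sub_rev b a, ← hab] at h2
        rw [variationKernel_re_comm, slope_comm' k u v, e2]
        refine h2.trans ?_
        gcongr
      · rw [variationKernel_eq_zero huS hvS, image_eq_zero_of_notMem_tsupport huS,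
          image_eq_zero_of_notMem_tsupport hvS]
        refine ⟨by simp; positivity, fun r hr hr0 τ hτ => ?_⟩
        simp only [map_zero, zero_div, mul_zero, add_zero, norm_one, Real.log_one,
          sub_self, Complex.zero_re, abs_zero]
        positivity
  refine ⟨2 * D * C, by positivity, 1 / (2 * D), by positivity, fun u v hu hv => ?_,
    fun τ hτ u v hu hv huv => ?_⟩
  · refine (key u v hu hv).1.trans ?_
    have := mul_nonneg (greenWeight_nonneg hu) (greenWeight_nonneg hv)
    refine mul_le_mul_of_nonneg_right ?_ this
    nlinarith
  · have hqu := greenWeight_nonneg hu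
    have hqv := greenWeight_nonneg hv
    rw [le_div_iff₀ (by positivity)] at hτ
    by_cases h : u = v
    · have hu0 : u.im = 0 := le_antisymm (not_lt.1 fun h' => huv ⟨h, h'⟩) hu
      subst h
      have hk : k u = 0 := eq_zero_of_im_nonpos hS hu0.le
      simp only [variationKernel, greenReal, hk, map_zero, sub_self, div_zero, zero_div,
        mul_zero, add_zero, Complex.zero_re, abs_zero]
      positivity
    · have h1 := (key u v hu hv).2 (|τ| * D) (by linarith) (by positivity) τ le_rfl
      have hne : u - v ≠ 0 := sub_ne_zero.2 h
      have hnc : u - starRingEnd ℂ v ≠ 0 := by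
        rw [sub_ne_zero]
        intro h'
        have hi := congrArg Complex.im h'
        have hr := congrArg Complex.re h'
        simp at hi hr
        exact h (Complex.ext hr (by linarith))
      have hsm : ∀ z : ℂ, ‖z‖ ≤ D → ‖1 + (τ : ℂ) * z‖ ≠ 0 := fun z hz h0 => by
        have h2 : ‖(τ : ℂ) * z‖ ≤ 1 / 2 := by
          rw [norm_mul, Complex.norm_real, Real.norm_eq_abs]
          have := mul_le_mul_of_nonneg_left hz (abs_nonneg τ)
          linarith
        have h3 : (1 : ℂ) = -(τ * z) := by
          have := norm_eq_zero.1 h0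
          linear_combination this
        have h4 : ‖(1 : ℂ)‖ = ‖(τ : ℂ) * z‖ := by rw [← norm_neg (_ * _), ← h3]
        rw [norm_one] at h4
        linarith
      have hb := hsm _ ((norm_slope_conj_le hL hS hu hv).trans (by simp [hD] : 2 * (L : ℝ) ≤ D))
      have ha := hsm _ ((norm_slope_le hL u v).trans
        (by rw [hD]; linarith [L.coe_nonneg] : (L : ℝ) ≤ D))
      have e1 : ‖u + τ * k u - (v + τ * k v)‖ =
          ‖u - v‖ * ‖1 + τ * ((k u - k v) / (u - v))‖ := by
        rw [← norm_mul]; congr 1; field_simp; ring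
      have e2 : ‖u + τ * k u - starRingEnd ℂ (v + τ * k v)‖ = ‖u - starRingEnd ℂ v‖ *
          ‖1 + τ * ((k u - starRingEnd ℂ (k v)) / (u - starRingEnd ℂ v))‖ := by
        rw [← norm_mul, map_add, map_mul, Complex.conj_ofReal]; congr 1; field_simp; ring
      have hn1 := norm_ne_zero_iff.2 hne
      have hn2 := norm_ne_zero_iff.2 hnc
      have e3 : greenReal (u + τ * k u) (v + τ * k v) - greenReal u v =
          Real.log ‖1 + τ * ((k u - starRingEnd ℂ (k v)) / (u - starRingEnd ℂ v))‖ -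
            Real.log ‖1 + τ * ((k u - k v) / (u - v))‖ := by
        rw [greenReal, greenReal, e1, e2, Real.log_div (mul_ne_zero hn2 hb) (mul_ne_zero hn1 ha),
          Real.log_div hn2 hn1, Real.log_mul hn2 hb, Real.log_mul hn1 ha]
        ring
      rw [e3]
      refine h1.trans (le_of_eq ?_)
      rw [← sq_abs τ]
      ring

end Kernel

/-! ### The flow of a test field -/

/-- The variation `z ↦ z + τ k(z)`. -/
def flow (k : ℂ → ℂ) (τ : ℝ) (z : ℂ) : ℂ := z + τ * k z

/-- Uniform first-order expansions, relative to the weight, of the Green function and of the field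
`Re V` along the variation `z ↦ z + τ k(z)` for `|τ| ≤ τ₀`. -/
structure FlowBounds (V k : ℂ → ℂ) (C τ₀ : ℝ) : Prop where
  pos : 0 < C
  pos' : 0 < τ₀
  le_one : τ₀ ≤ 1
  continuous : Continuous k
  support : tsupport k ⊆ {z | 0 < z.im}
  injective : ∀ τ : ℝ, |τ| ≤ τ₀ → Function.Injective (flow k τ)
  im_pos : ∀ τ : ℝ, |τ| ≤ τ₀ → ∀ u : ℂ, 0 < u.im → 0 < (flow k τ u).im
  kernel : ∀ u v : ℂ, 0 ≤ u.im → 0 ≤ v.im →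
    |(variationKernel k u v).re| ≤ C * (greenWeight u * greenWeight v)
  green : ∀ τ : ℝ, |τ| ≤ τ₀ → ∀ u v : ℂ, 0 ≤ u.im → 0 ≤ v.im → ¬ (u = v ∧ 0 < u.im) →
    |greenReal (flow k τ u) (flow k τ v) - greenReal u v + τ * (variationKernel k u v).re| ≤
      C * τ ^ 2 * (greenWeight u * greenWeight v)
  slope : ∀ u : ℂ, 0 ≤ u.im → |(deriv V u * k u).re| ≤ C * greenWeight u
  slope_continuous : Continuous fun u => (deriv V u * k u).re
  field : ∀ τ : ℝ, |τ| ≤ τ₀ → ∀ u : ℂ, 0 ≤ u.im →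
    |(V (flow k τ u)).re - (V u).re - τ * (deriv V u * k u).re| ≤ C * τ ^ 2 * greenWeight u
  field_continuous : ∀ τ : ℝ, |τ| ≤ τ₀ → Continuous fun u => (V (flow k τ u)).re - (V u).re

/-- Taylor estimate of first order for a holomorphic function; the constant is not optimal. -/
theorem norm_taylor_le {V : ℂ → ℂ} {Ω : Set ℂ} (hΩ : IsOpen Ω) (hV : DifferentiableOn ℂ V Ω)
    {u η : ℂ} {δ M : ℝ} (hball : Metric.closedBall u δ ⊆ Ω) (hη : ‖η‖ ≤ δ)
    (hM : ∀ z ∈ Metric.closedBall u δ, ‖deriv (deriv V) z‖ ≤ M) :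
    ‖V (u + η) - V u - η * deriv V u‖ ≤ M * ‖η‖ ^ 2 := by
  have hV' : DifferentiableOn ℂ (deriv V) Ω := hV.deriv hΩ
  have hδ : 0 ≤ δ := (norm_nonneg _).trans hη
  have hsub : Metric.closedBall u ‖η‖ ⊆ Metric.closedBall u δ := Metric.closedBall_subset_closedBall hη
  have h1 : ∀ z ∈ Metric.closedBall u ‖η‖, ‖deriv V z - deriv V u‖ ≤ M * ‖η‖ := by
    intro z hz
    have h := (convex_closedBall u δ).norm_image_sub_le_of_norm_hasDerivWithin_le
      (f := deriv V) (f' := deriv (deriv V)) (C := M) (x := u) (y := z)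
      (fun w hw => ((hV'.differentiableAt (hΩ.mem_nhds (hball hw))).hasDerivAt).hasDerivWithinAt)
      hM (Metric.mem_closedBall_self hδ) (hsub hz)
    refine h.trans ?_
    have hM0 : 0 ≤ M := (norm_nonneg _).trans (hM u (Metric.mem_closedBall_self hδ))
    have : ‖z - u‖ ≤ ‖η‖ := by rwa [Metric.mem_closedBall, dist_eq_norm] at hz
    gcongr
  have h2 := (convex_closedBall u ‖η‖).norm_image_sub_le_of_norm_hasDerivWithin_le
      (f := fun z => V z - z * deriv V u) (f' := fun z => deriv V z - deriv V u)
      (C := M * ‖η‖) (x := u) (y := u + η)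
      (fun w hw => by
        have h3 := (hV.differentiableAt (hΩ.mem_nhds (hball (hsub hw)))).hasDerivAt
        have h4 := h3.sub ((hasDerivAt_id' w).mul_const (deriv V u))
        rw [one_mul] at h4
        exact h4.hasDerivWithinAt)
      h1 (Metric.mem_closedBall_self (norm_nonneg _)) (by simp)
  have e : V (u + η) - (u + η) * deriv V u - (V u - u * deriv V u) =
      V (u + η) - V u - η * deriv V u := by ring
  rw [e, add_sub_cancel_left] at h2
  refine h2.trans (le_of_eq ?_)
  ring

/-- A `C¹` field with compact support in a domain of the open half-plane where `V` is holomorphic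
admits uniform first-order expansions: off the support nothing moves, and on the support the weight is
bounded below. -/
theorem exists_flowBounds {V k : ℂ → ℂ} {Ω : Set ℂ} (hΩ : IsOpen Ω) (hΩH : Ω ⊆ {z | 0 < z.im})
    (hV : DifferentiableOn ℂ V Ω) (hk : ContDiff ℝ 1 k) (hc : HasCompactSupport k)
    (hS : tsupport k ⊆ Ω) : ∃ C τ₀, FlowBounds V k C τ₀ := by
  obtain ⟨L, hL⟩ := hk.lipschitzWith_of_hasCompactSupport hc one_ne_zero
  have hSH := hS.trans hΩH
  have hSc : IsCompact (tsupport k) := hc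
  obtain ⟨δ, hδ, hδS⟩ := hSc.exists_cthickening_subset_open hΩ hS
  have hSδ : IsCompact (Metric.cthickening δ (tsupport k)) := hSc.cthickening
  have hV' : DifferentiableOn ℂ (deriv V) Ω := hV.deriv hΩ
  have hV'' : DifferentiableOn ℂ (deriv (deriv V)) Ω := hV'.deriv hΩ
  obtain ⟨M2, hM2⟩ := hSδ.exists_bound_of_continuousOn (hV''.continuousOn.mono hδS)
  obtain ⟨M1, hM1⟩ := hSδ.exists_bound_of_continuousOn (hV'.continuousOn.mono hδS)
  obtain ⟨K, hK⟩ := hk.continuous.bounded_above_of_compact_support hc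
  obtain ⟨c, hc0, hcS⟩ := exists_le_greenWeight hSc hSH
  obtain ⟨C, hC, τ₁, hτ₁, hker, hgreen⟩ := exists_greenReal_variation hL hc hSH
  have hK0 : 0 ≤ K := (norm_nonneg _).trans (hK 0)
  have hflow0 : ∀ τ u, u ∉ tsupport k → flow k τ u = u := fun τ u hu => by
    simp [flow, image_eq_zero_of_notMem_tsupport hu]
  have hball : ∀ u ∈ tsupport k, Metric.closedBall u δ ⊆ Metric.cthickening δ (tsupport k) :=
    fun u hu z hz => Metric.mem_cthickening_of_dist_le z u _ _ hu hz
  set τ₀ := min (min 1 τ₁) (min (δ / (K + 1)) (1 / (2 * (L + 1)))) with hτ₀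
  have hτ₀pos : 0 < τ₀ := by positivity
  have hτK : ∀ τ : ℝ, |τ| ≤ τ₀ → ∀ u, ‖(τ : ℂ) * k u‖ ≤ δ := by
    intro τ hτ u
    rw [norm_mul, Complex.norm_real, Real.norm_eq_abs]
    have h1 : |τ| ≤ δ / (K + 1) := hτ.trans ((min_le_right _ _).trans (min_le_left _ _))
    rw [le_div_iff₀ (by positivity)] at h1
    have := mul_le_mul_of_nonneg_left (hK u) (abs_nonneg τ)
    nlinarith [abs_nonneg τ]
  have hmem : ∀ τ : ℝ, |τ| ≤ τ₀ → ∀ u ∈ tsupport k,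
      flow k τ u ∈ Metric.cthickening δ (tsupport k) := fun τ hτ u hu =>
    hball u hu (by rw [Metric.mem_closedBall, dist_eq_norm, flow, add_sub_cancel_left]
                   exact hτK τ hτ u)
  have hM10 : ∀ u ∈ tsupport k, ‖deriv V u‖ ≤ |M1| := fun u hu =>
    (hM1 u (Metric.self_subset_cthickening _ hu)).trans (le_abs_self _)
  refine ⟨C + |M1| * K / c + |M2| * K ^ 2 / c, τ₀, ?_⟩
  have hCle : C ≤ C + |M1| * K / c + |M2| * K ^ 2 / c := by
    have : 0 ≤ |M1| * K / c + |M2| * K ^ 2 / c := by positivity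
    linarith
  refine
  { pos := by positivity
    pos' := hτ₀pos
    le_one := (min_le_left _ _).trans (min_le_left _ _)
    continuous := hk.continuous
    support := hSH
    injective := ?_
    im_pos := ?_
    kernel := ?_
    green := ?_
    slope := ?_
    slope_continuous := ?_
    field := ?_
    field_continuous := ?_ }
  · intro τ hτ u v huv
    have h1 : u - v = -(τ * (k u - k v)) := by
      simp only [flow] at huv
      linear_combination huv
    have h2 : |τ| ≤ 1 / (2 * (L + 1)) := hτ.trans ((min_le_right _ _).trans (min_le_right _ _))
    rw [le_div_iff₀ (by positivity)] at h2
    have h3 : ‖u - v‖ ≤ |τ| * (L * ‖u - v‖) := by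
      conv_lhs => rw [h1, norm_neg, norm_mul, Complex.norm_real, Real.norm_eq_abs]
      gcongr
      exact hL.norm_sub_le u v
    have h4 : ‖u - v‖ ≤ 1 / 2 * ‖u - v‖ := by
      refine h3.trans ?_
      rw [← mul_assoc]
      refine mul_le_mul_of_nonneg_right ?_ (norm_nonneg _)
      nlinarith [abs_nonneg τ]
    have h5 : ‖u - v‖ = 0 := by linarith [norm_nonneg (u - v)]
    exact sub_eq_zero.1 (norm_eq_zero.1 h5)
  · intro τ hτ u hu
    by_cases h : u ∈ tsupport k
    · exact hΩH (hδS (hmem τ hτ u h))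
    · rwa [hflow0 τ u h]
  · intro u v hu hv
    refine (hker u v hu hv).trans ?_
    have := mul_nonneg (greenWeight_nonneg hu) (greenWeight_nonneg hv)
    gcongr
  · intro τ hτ u v hu hv huv
    refine (hgreen τ (hτ.trans ((min_le_left _ _).trans (min_le_right _ _))) u v hu hv huv).trans ?_
    have := mul_nonneg (greenWeight_nonneg hu) (greenWeight_nonneg hv)
    gcongr
  · intro u hu
    by_cases h : u ∈ tsupport k
    · refine (Complex.abs_re_le_norm _).trans ?_
      rw [norm_mul]
      calc ‖deriv V u‖ * ‖k u‖ ≤ |M1| * K := by gcongr; exacts [hM10 u h, hK u]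
        _ = |M1| * K / c * c := by field_simp
        _ ≤ |M1| * K / c * greenWeight u := by gcongr; exact hcS u h
        _ ≤ _ := by
          refine mul_le_mul_of_nonneg_right ?_ (greenWeight_nonneg hu)
          have : 0 ≤ |M2| * K ^ 2 / c := by positivity
          linarith
    · rw [image_eq_zero_of_notMem_tsupport h]
      simpa using mul_nonneg (by positivity) (greenWeight_nonneg hu)
  · refine Complex.continuous_re.comp (continuous_of_tsupport fun u hu => ?_)
    have hu' : u ∈ tsupport k := tsupport_mul_subset_right hu
    exact (hV'.continuousOn.continuousAt (hΩ.mem_nhds (hS hu'))).mul hk.continuous.continuousAt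
  · intro τ hτ u hu
    by_cases h : u ∈ tsupport k
    · have h1 := norm_taylor_le hΩ hV ((hball u h).trans hδS) (hτK τ hτ u)
        (fun z hz => (hM2 z (hball u h hz)).trans (le_abs_self _))
      have e : (V (flow k τ u)).re - (V u).re - τ * (deriv V u * k u).re =
          (V (u + τ * k u) - V u - τ * k u * deriv V u).re := by
        rw [Complex.sub_re, Complex.sub_re, mul_assoc, Complex.re_ofReal_mul, mul_comm (k u), flow]
      rw [e]
      refine (Complex.abs_re_le_norm _).trans (h1.trans ?_)
      rw [norm_mul, Complex.norm_real, Real.norm_eq_abs, mul_pow, sq_abs]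
      calc |M2| * (τ ^ 2 * ‖k u‖ ^ 2) ≤ |M2| * (τ ^ 2 * K ^ 2) := by gcongr; exact hK u
        _ = |M2| * K ^ 2 / c * τ ^ 2 * c := by field_simp
        _ ≤ |M2| * K ^ 2 / c * τ ^ 2 * greenWeight u := by gcongr; exact hcS u h
        _ ≤ _ := by
          have := greenWeight_nonneg hu
          have h0 : 0 ≤ |M1| * K / c := by positivity
          gcongr
          linarith
    · rw [hflow0 τ u h, image_eq_zero_of_notMem_tsupport h]
      simpa using mul_nonneg (by positivity) (greenWeight_nonneg hu)
  · intro τ hτ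
    refine continuous_of_tsupport fun u hu => ?_
    have hu' : u ∈ tsupport k := by
      by_contra h
      refine h (closure_minimal (fun w hw => ?_) (isClosed_tsupport k) hu)
      by_contra h'
      exact hw (by simp only [hflow0 τ w h', sub_self])
    have h1 : ContinuousAt V (flow k τ u) :=
      hV.continuousOn.continuousAt (hΩ.mem_nhds (hδS (hmem τ hτ u hu')))
    have h2 : ContinuousAt V u := hV.continuousOn.continuousAt (hΩ.mem_nhds (hS hu'))
    have h3 : ContinuousAt (flow k τ) u := by
      have := hk.continuous
      unfold flow
      fun_prop
    exact (Complex.continuous_re.continuousAt.comp (h1.comp h3)).sub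
      (Complex.continuous_re.continuousAt.comp h2)

/-! ### Variation of energies of measures -/

theorem ae_prod_not_diagonal {α β : Measure ℂ} [SFinite α] (hβ : HasFiniteEnergy β) :
    ∀ᵐ z : ℂ × ℂ ∂α.prod β, ¬ (z.1 = z.2 ∧ 0 < z.1.im) := by
  have := hβ.finite
  have hm : MeasurableSet {z : ℂ × ℂ | z.1 = z.2 ∧ 0 < z.1.im} :=
    (measurableSet_eq_fun measurable_fst measurable_snd).inter
      (measurableSet_lt measurable_const (Complex.measurable_im.comp measurable_fst))
  have h0 : (α.prod β) {z : ℂ × ℂ | z.1 = z.2 ∧ 0 < z.1.im} = 0 := by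
    rw [Measure.measure_prod_null hm]
    refine ae_of_all _ fun u => ?_
    have := ae_ne_of_greenEnergy hβ.energy u
    rw [ae_iff] at this
    simpa using this
  exact measure_eq_zero_iff_ae_notMem.1 h0

theorem ae_prod_upper {α β : Measure ℂ} [SFinite α] [SFinite β] (hα : ∀ᵐ z ∂α, 0 ≤ z.im)
    (hβ : ∀ᵐ z ∂β, 0 ≤ z.im) : ∀ᵐ z : ℂ × ℂ ∂α.prod β, 0 ≤ z.1.im ∧ 0 ≤ z.2.im :=
  (Measure.quasiMeasurePreserving_fst.ae hα).and (Measure.quasiMeasurePreserving_snd.ae hβ)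

theorem mutualEnergy_eq_lintegral_prod (α β : Measure ℂ) [SFinite β] :
    mutualEnergy α β = ∫⁻ z, greenFunction z.1 z.2 ∂α.prod β :=
  (lintegral_prod _ measurable_greenFunction.aemeasurable).symm

theorem HasFiniteEnergy.integrable_greenReal {α β : Measure ℂ} (hα : HasFiniteEnergy α)
    (hβ : HasFiniteEnergy β) :
    Integrable (fun z : ℂ × ℂ => greenReal z.1 z.2) (α.prod β) ∧
      (mutualEnergy α β).toReal = ∫ z, greenReal z.1 z.2 ∂α.prod β := by
  have := hα.finite
  have := hβ.finite
  have hnn : 0 ≤ᵐ[α.prod β] fun z : ℂ × ℂ => greenReal z.1 z.2 := by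
    filter_upwards [ae_prod_upper hα.upper hβ.upper] with z hz using greenReal_nonneg hz.1 hz.2
  have he : mutualEnergy α β = ∫⁻ z, ENNReal.ofReal (greenReal z.1 z.2) ∂α.prod β := by
    rw [mutualEnergy_eq_lintegral_prod]
    refine lintegral_congr_ae ?_
    filter_upwards [ae_prod_not_diagonal hβ] with z hz using greenFunction_eq_ofReal hz
  constructor
  · refine (lintegral_ofReal_ne_top_iff_integrable
      measurable_greenReal.aestronglyMeasurable hnn).1 ?_
    rw [← he]
    exact hα.mutualEnergy_ne_top hβ
  · rw [he, integral_eq_lintegral_of_nonneg_ae hnn measurable_greenReal.aestronglyMeasurable]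

section Flow

variable {V k : ℂ → ℂ} {C τ₀ τ : ℝ}

theorem FlowBounds.continuous_flow (h : FlowBounds V k C τ₀) (τ : ℝ) : Continuous (flow k τ) := by
  have := h.continuous
  unfold flow
  fun_prop

theorem FlowBounds.measurableEmbedding (h : FlowBounds V k C τ₀) (hτ : |τ| ≤ τ₀) :
    MeasurableEmbedding (flow k τ) :=
  (h.continuous_flow τ).measurableEmbedding (h.injective τ hτ)

theorem FlowBounds.flow_of_im_nonpos (h : FlowBounds V k C τ₀) (τ : ℝ) {u : ℂ} (hu : u.im ≤ 0) :
    flow k τ u = u := by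
  simp [flow, eq_zero_of_im_nonpos h.support hu]

theorem FlowBounds.im_nonneg (h : FlowBounds V k C τ₀) (hτ : |τ| ≤ τ₀) {u : ℂ} (hu : 0 ≤ u.im) :
    0 ≤ (flow k τ u).im := by
  rcases hu.eq_or_lt with h0 | h0
  · rwa [h.flow_of_im_nonpos τ h0.symm.le]
  · exact (h.im_pos τ hτ u h0).le

theorem FlowBounds.not_diagonal (h : FlowBounds V k C τ₀) (hτ : |τ| ≤ τ₀) {u v : ℂ}
    (hu : 0 ≤ u.im) (huv : ¬ (u = v ∧ 0 < u.im)) :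
    ¬ (flow k τ u = flow k τ v ∧ 0 < (flow k τ u).im) := by
  rintro ⟨h1, h2⟩
  have h3 := h.injective τ hτ h1
  have h4 : u.im = 0 := le_antisymm (not_lt.1 fun h' => huv ⟨h3, h'⟩) hu
  rw [h.flow_of_im_nonpos τ h4.le] at h2
  exact h2.ne' h4

theorem FlowBounds.abs_greenReal_sub_le (h : FlowBounds V k C τ₀) (hτ : |τ| ≤ τ₀) {u v : ℂ}
    (hu : 0 ≤ u.im) (hv : 0 ≤ v.im) (huv : ¬ (u = v ∧ 0 < u.im)) :
    |greenReal (flow k τ u) (flow k τ v) - greenReal u v| ≤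
      2 * C * |τ| * (greenWeight u * greenWeight v) := by
  have h1 := h.green τ hτ u v hu hv huv
  have h2 := h.kernel u v hu hv
  have hq := mul_nonneg (greenWeight_nonneg hu) (greenWeight_nonneg hv)
  have h3 : |τ * (variationKernel k u v).re| ≤ |τ| * (C * (greenWeight u * greenWeight v)) := by
    rw [abs_mul]; gcongr
  have h4 : C * τ ^ 2 * (greenWeight u * greenWeight v) ≤
      |τ| * (C * (greenWeight u * greenWeight v)) := by
    have : τ ^ 2 ≤ |τ| := by
      rw [← sq_abs]; nlinarith [abs_nonneg τ, hτ.trans h.le_one]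
    have h5 : 0 ≤ C * (greenWeight u * greenWeight v) := mul_nonneg h.pos.le hq
    nlinarith
  have h1' := abs_le.1 (h1.trans h4)
  have h3' := abs_le.1 h3
  rw [abs_le]
  constructor <;> nlinarith [h1'.1, h1'.2, h3'.1, h3'.2]

theorem FlowBounds.greenFunction_flow_le (h : FlowBounds V k C τ₀) (hτ : |τ| ≤ τ₀) {u v : ℂ}
    (hu : 0 ≤ u.im) (hv : 0 ≤ v.im) :
    greenFunction (flow k τ u) (flow k τ v) ≤ greenFunction u v +
        ENNReal.ofReal (2 * C * |τ| * (greenWeight u * greenWeight v)) ∧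
      greenFunction u v ≤ greenFunction (flow k τ u) (flow k τ v) +
        ENNReal.ofReal (2 * C * |τ| * (greenWeight u * greenWeight v)) := by
  by_cases huv : u = v ∧ 0 < u.im
  · obtain ⟨rfl, h0⟩ := huv
    have h1 : greenFunction u u = ⊤ := by simp [greenFunction, h0]
    have h2 : greenFunction (flow k τ u) (flow k τ u) = ⊤ := by
      simp [greenFunction, h.im_pos τ hτ u h0]
    simp [h1, h2]
  · have h1 := abs_le.1 (h.abs_greenReal_sub_le hτ hu hv huv)
    have hq := mul_nonneg (greenWeight_nonneg hu) (greenWeight_nonneg hv)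
    have hb : 0 ≤ 2 * C * |τ| * (greenWeight u * greenWeight v) := by
      have := h.pos
      positivity
    rw [greenFunction_eq_ofReal huv, greenFunction_eq_ofReal (h.not_diagonal hτ hu huv),
      ← ENNReal.ofReal_add (greenReal_nonneg hu hv) hb,
      ← ENNReal.ofReal_add (greenReal_nonneg (h.im_nonneg hτ hu) (h.im_nonneg hτ hv)) hb]
    exact ⟨ENNReal.ofReal_le_ofReal (by linarith [h1.2]),
      ENNReal.ofReal_le_ofReal (by linarith [h1.1])⟩

theorem FlowBounds.mutualEnergy_map (h : FlowBounds V k C τ₀) (τ : ℝ) (α β : Measure ℂ)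
    [SFinite α] [SFinite β] : mutualEnergy (α.map (flow k τ)) (β.map (flow k τ)) =
      ∫⁻ z, greenFunction (flow k τ z.1) (flow k τ z.2) ∂α.prod β := by
  have hm := (h.continuous_flow τ).measurable
  have hm2 : Measurable fun z : ℂ × ℂ => greenFunction (flow k τ z.1) (flow k τ z.2) :=
    measurable_greenFunction.comp ((hm.comp measurable_fst).prodMk (hm.comp measurable_snd))
  rw [lintegral_prod _ hm2.aemeasurable]
  unfold mutualEnergy
  rw [lintegral_map measurable_greenFunction.lintegral_prod_right' hm]
  refine lintegral_congr fun u => ?_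
  rw [lintegral_map (measurable_greenFunction_right _) hm]

theorem lintegral_weight_prod_ne_top {α : Measure ℂ} [IsFiniteMeasure α]
    (hα : ∀ᵐ z ∂α, 0 ≤ z.im) (c : ℝ) :
    ∫⁻ z, ENNReal.ofReal (c * (greenWeight z.1 * greenWeight z.2)) ∂α.prod α ≠ ⊤ :=
  ((integrable_greenWeight hα).mul_prod (integrable_greenWeight hα)).const_mul c |>.lintegral_lt_top.ne

/-- The Green function changes along the variation by a multiple of the product of the weights, which
is integrable for every finite measure. -/
theorem FlowBounds.hasFiniteEnergy_map_iff (h : FlowBounds V k C τ₀) (hτ : |τ| ≤ τ₀)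
    {α : Measure ℂ} [IsFiniteMeasure α] (hα : ∀ᵐ z ∂α, 0 ≤ z.im) :
    HasFiniteEnergy (α.map (flow k τ)) ↔ HasFiniteEnergy α := by
  have hm := (h.continuous_flow τ).measurable
  have hm2 : Measurable fun z : ℂ × ℂ => greenFunction (flow k τ z.1) (flow k τ z.2) :=
    measurable_greenFunction.comp ((hm.comp measurable_fst).prodMk (hm.comp measurable_snd))
  have hfin := lintegral_weight_prod_ne_top hα (2 * C * |τ|)
  constructor
  · intro H
    refine ⟨inferInstance, hα, ?_⟩
    have h1 := H.energy
    rw [← mutualEnergy_self, h.mutualEnergy_map] at h1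
    rw [← mutualEnergy_self, mutualEnergy_eq_lintegral_prod]
    have hle : ∫⁻ z, greenFunction z.1 z.2 ∂α.prod α ≤
        ∫⁻ z, (greenFunction (flow k τ z.1) (flow k τ z.2) +
          ENNReal.ofReal (2 * C * |τ| * (greenWeight z.1 * greenWeight z.2))) ∂α.prod α := by
      refine lintegral_mono_ae ?_
      filter_upwards [ae_prod_upper hα hα] with z hz
      exact (h.greenFunction_flow_le hτ hz.1 hz.2).2
    rw [lintegral_add_left hm2] at hle
    exact (hle.trans_lt (lt_top_iff_ne_top.2 (ENNReal.add_ne_top.2 ⟨h1, hfin⟩))).ne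
  · intro H
    refine ⟨inferInstance, ?_, ?_⟩
    · rw [ae_map_iff hm.aemeasurable (measurableSet_le measurable_const Complex.measurable_im)]
      filter_upwards [hα] with u hu using h.im_nonneg hτ hu
    have h1 := H.energy
    rw [← mutualEnergy_self, mutualEnergy_eq_lintegral_prod] at h1
    rw [← mutualEnergy_self, h.mutualEnergy_map]
    have hle : ∫⁻ z, greenFunction (flow k τ z.1) (flow k τ z.2) ∂α.prod α ≤
        ∫⁻ z, (greenFunction z.1 z.2 +
          ENNReal.ofReal (2 * C * |τ| * (greenWeight z.1 * greenWeight z.2))) ∂α.prod α := by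
      refine lintegral_mono_ae ?_
      filter_upwards [ae_prod_upper hα hα] with z hz
      exact (h.greenFunction_flow_le hτ hz.1 hz.2).1
    rw [lintegral_add_left measurable_greenFunction] at hle
    exact (hle.trans_lt (lt_top_iff_ne_top.2 (ENNReal.add_ne_top.2 ⟨h1, hfin⟩))).ne

theorem measurable_variationKernel_re (hk : Continuous k) :
    Measurable fun z : ℂ × ℂ => (variationKernel k z.1 z.2).re := by
  unfold variationKernel
  have := Complex.continuous_conj.measurable
  have := hk.measurable
  fun_prop

theorem FlowBounds.integrable_kernel (h : FlowBounds V k C τ₀) {α β : Measure ℂ}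
    [IsFiniteMeasure α] [IsFiniteMeasure β] (hα : ∀ᵐ z ∂α, 0 ≤ z.im) (hβ : ∀ᵐ z ∂β, 0 ≤ z.im) :
    Integrable (fun z : ℂ × ℂ => (variationKernel k z.1 z.2).re) (α.prod β) := by
  refine (((integrable_greenWeight hα).mul_prod (integrable_greenWeight hβ)).const_mul C).mono'
    (measurable_variationKernel_re h.continuous).aestronglyMeasurable ?_
  filter_upwards [ae_prod_upper hα hβ] with z hz using h.kernel z.1 z.2 hz.1 hz.2

theorem FlowBounds.abs_integral_kernel_le (h : FlowBounds V k C τ₀) {α β : Measure ℂ}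
    [IsFiniteMeasure α] [IsFiniteMeasure β] (hα : ∀ᵐ z ∂α, 0 ≤ z.im) (hβ : ∀ᵐ z ∂β, 0 ≤ z.im) :
    |∫ z, (variationKernel k z.1 z.2).re ∂α.prod β| ≤
      C * ((∫ u, greenWeight u ∂α) * ∫ u, greenWeight u ∂β) := by
  rw [← integral_prod_mul, ← integral_const_mul]
  refine abs_integral_le_integral
    (((integrable_greenWeight hα).mul_prod (integrable_greenWeight hβ)).const_mul C) ?_
  filter_upwards [ae_prod_upper hα hβ] with z hz using h.kernel z.1 z.2 hz.1 hz.2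

/-- First-order expansion of the mutual energy of two measures along the variation. -/
theorem FlowBounds.mutualEnergy_expansion (h : FlowBounds V k C τ₀) (hτ : |τ| ≤ τ₀)
    {α β : Measure ℂ} (hα : HasFiniteEnergy α) (hβ : HasFiniteEnergy β) :
    |(mutualEnergy (α.map (flow k τ)) (β.map (flow k τ))).toReal - (mutualEnergy α β).toReal +
        τ * ∫ z, (variationKernel k z.1 z.2).re ∂α.prod β| ≤
      C * τ ^ 2 * ((∫ u, greenWeight u ∂α) * ∫ u, greenWeight u ∂β) := by
  have := hα.finite
  have := hβ.finite
  have hm := (h.continuous_flow τ).measurable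
  have hmm : Measurable (Prod.map (flow k τ) (flow k τ)) := hm.prodMap hm
  have hα' := (h.hasFiniteEnergy_map_iff hτ hα.upper).2 hα
  have hβ' := (h.hasFiniteEnergy_map_iff hτ hβ.upper).2 hβ
  obtain ⟨i1, e1⟩ := hα.integrable_greenReal hβ
  obtain ⟨i2, e2⟩ := hα'.integrable_greenReal hβ'
  rw [Measure.map_prod_map α β hm hm] at i2 e2
  rw [integral_map hmm.aemeasurable measurable_greenReal.aestronglyMeasurable] at e2
  rw [integrable_map_measure measurable_greenReal.aestronglyMeasurable hmm.aemeasurable] at i2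
  simp only [Prod.map_fst, Prod.map_snd] at e2
  have i2' : Integrable (fun z : ℂ × ℂ => greenReal (flow k τ z.1) (flow k τ z.2)) (α.prod β) := i2
  have i3 := (h.integrable_kernel hα.upper hβ.upper).const_mul τ
  rw [e1, e2, ← integral_sub i2' i1, ← integral_const_mul,
    ← integral_add (f := fun z : ℂ × ℂ => greenReal (flow k τ z.1) (flow k τ z.2) -
      greenReal z.1 z.2) (i2'.sub i1) i3, ← integral_prod_mul, ← integral_const_mul]
  refine abs_integral_le_integral (((integrable_greenWeight hα.upper).mul_prod
    (integrable_greenWeight hβ.upper)).const_mul _) ?_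
  filter_upwards [ae_prod_upper hα.upper hβ.upper, ae_prod_not_diagonal (α := α) hβ] with z hz hz'
  exact h.green τ hτ z.1 z.2 hz.1 hz.2 hz'

theorem FlowBounds.abs_field_sub_le (h : FlowBounds V k C τ₀) (hτ : |τ| ≤ τ₀) {u : ℂ}
    (hu : 0 ≤ u.im) :
    |(V (flow k τ u)).re - (V u).re| ≤ 2 * C * |τ| * greenWeight u := by
  have h1 := h.field τ hτ u hu
  have h2 := h.slope u hu
  have hq := greenWeight_nonneg hu
  have h3 : |τ * (deriv V u * k u).re| ≤ |τ| * (C * greenWeight u) := by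
    rw [abs_mul]; gcongr
  have h4 : C * τ ^ 2 * greenWeight u ≤ |τ| * (C * greenWeight u) := by
    have : τ ^ 2 ≤ |τ| := by
      rw [← sq_abs]; nlinarith [abs_nonneg τ, hτ.trans h.le_one]
    have h5 : 0 ≤ C * greenWeight u := mul_nonneg h.pos.le hq
    nlinarith
  have h1' := abs_le.1 (h1.trans h4)
  have h3' := abs_le.1 h3
  rw [abs_le]
  constructor <;> nlinarith [h1'.1, h1'.2, h3'.1, h3'.2]

theorem FlowBounds.integrable_field_sub (h : FlowBounds V k C τ₀) (hτ : |τ| ≤ τ₀)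
    {α : Measure ℂ} [IsFiniteMeasure α] (hα : ∀ᵐ z ∂α, 0 ≤ z.im) :
    Integrable (fun u => (V (flow k τ u)).re - (V u).re) α := by
  refine ((integrable_greenWeight hα).const_mul (2 * C * |τ|)).mono'
    (h.field_continuous τ hτ).aestronglyMeasurable ?_
  filter_upwards [hα] with u hu using h.abs_field_sub_le hτ hu

theorem FlowBounds.integrable_slope (h : FlowBounds V k C τ₀)
    {α : Measure ℂ} [IsFiniteMeasure α] (hα : ∀ᵐ z ∂α, 0 ≤ z.im) :
    Integrable (fun u => (deriv V u * k u).re) α := by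
  refine ((integrable_greenWeight hα).const_mul C).mono'
    h.slope_continuous.aestronglyMeasurable ?_
  filter_upwards [hα] with u hu using h.slope u hu

theorem FlowBounds.abs_integral_slope_le (h : FlowBounds V k C τ₀)
    {α : Measure ℂ} [IsFiniteMeasure α] (hα : ∀ᵐ z ∂α, 0 ≤ z.im) :
    |∫ u, (deriv V u * k u).re ∂α| ≤ C * ∫ u, greenWeight u ∂α := by
  rw [← integral_const_mul]
  refine abs_integral_le_integral ((integrable_greenWeight hα).const_mul C) ?_
  filter_upwards [hα] with u hu using h.slope u hu

theorem FlowBounds.integrable_field_map_iff (h : FlowBounds V k C τ₀) (hτ : |τ| ≤ τ₀)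
    {α : Measure ℂ} [IsFiniteMeasure α] (hα : ∀ᵐ z ∂α, 0 ≤ z.im) :
    Integrable (fun z => (V z).re) (α.map (flow k τ)) ↔ Integrable (fun z => (V z).re) α := by
  rw [(h.measurableEmbedding hτ).integrable_map_iff]
  have h1 := h.integrable_field_sub hτ hα
  constructor
  · intro h2
    have := h2.sub h1
    refine this.congr (ae_of_all _ fun u => ?_)
    simp
  · intro h2
    have := h2.add h1
    refine this.congr (ae_of_all _ fun u => ?_)
    simp

/-- First-order expansion of the field energy of a measure along the variation. -/
theorem FlowBounds.field_expansion (h : FlowBounds V k C τ₀) (hτ : |τ| ≤ τ₀)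
    {α : Measure ℂ} [IsFiniteMeasure α] (hα : ∀ᵐ z ∂α, 0 ≤ z.im)
    (hi : Integrable (fun z => (V z).re) α) :
    |∫ z, (V z).re ∂α.map (flow k τ) - ∫ z, (V z).re ∂α - τ * ∫ u, (deriv V u * k u).re ∂α| ≤
      C * τ ^ 2 * ∫ u, greenWeight u ∂α := by
  have i1 : Integrable (fun u => (V (flow k τ u)).re) α := by
    have := (h.integrable_field_map_iff hτ hα).2 hi
    rwa [(h.measurableEmbedding hτ).integrable_map_iff] at this
  rw [(h.measurableEmbedding hτ).integral_map, ← integral_sub i1 hi, ← integral_const_mul,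
    ← integral_sub (f := fun u => (V (flow k τ u)).re - (V u).re) (i1.sub hi)
      ((h.integrable_slope hα).const_mul τ), ← integral_const_mul]
  refine abs_integral_le_integral ((integrable_greenWeight hα).const_mul _) ?_
  filter_upwards [hα] with u hu using h.field τ hτ u hu

end Flow

/-! ### The envelope theorem for the equilibrium energy -/

/-- A measure of finite Green energy carried by `F` for which `Re V` is integrable. -/
structure IsCarriedEnergyMeasure (V : ℂ → ℂ) (F : Set ℂ) (ν : Measure ℂ) : Prop where
  energy : HasFiniteEnergy ν
  carried : ν Fᶜ = 0
  integrable : Integrable (fun z => (V z).re) ν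

/-- The weighted energy of `ν` in the field `Re V`. -/
noncomputable def fieldEnergy (V : ℂ → ℂ) (ν : Measure ℂ) : ℝ :=
  (greenEnergy ν).toReal + 2 * ∫ z, (V z).re ∂ν

/-- The first-order condition at an end point of an interval of admissible perturbations. -/
theorem nonneg_of_forall_small {a b : ℝ} (h : ∀ s : ℝ, 0 < s → s ≤ 1 → 0 ≤ s * a + s ^ 2 * b) :
    0 ≤ a := by
  have h1 : Tendsto (fun s : ℝ => a + s * b) (𝓝[>] 0) (𝓝 (a + 0 * b)) :=
    (Continuous.tendsto (by fun_prop) 0).mono_left nhdsWithin_le_nhds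
  rw [zero_mul, add_zero] at h1
  refine ge_of_tendsto h1 ?_
  filter_upwards [Ioc_mem_nhdsGT (zero_lt_one (α := ℝ))] with s hs
  have h2 := h s hs.1 hs.2
  have h3 : 0 ≤ s * (a + s * b) := by linarith [h2]
  exact nonneg_of_mul_nonneg_right h3 hs.1

section Envelope

variable {V k : ℂ → ℂ} {F : Set ℂ} {lam ν : Measure ℂ} {C τ₀ τ : ℝ}

theorem IsCarriedEnergyMeasure.add_smul (hl : IsCarriedEnergyMeasure V F lam)
    (hν : IsCarriedEnergyMeasure V F ν) (s : ℝ) :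
    IsCarriedEnergyMeasure V F (lam + ENNReal.ofReal s • ν) where
  energy := hl.energy.add (hν.energy.smul ENNReal.ofReal_ne_top)
  carried := by simp [hl.carried, hν.carried]
  integrable := hl.integrable.add_measure (hν.integrable.smul_measure ENNReal.ofReal_ne_top)

theorem IsCarriedEnergyMeasure.smul (hl : IsCarriedEnergyMeasure V F lam) (s : ℝ) :
    IsCarriedEnergyMeasure V F (ENNReal.ofReal s • lam) where
  energy := hl.energy.smul ENNReal.ofReal_ne_top
  carried := by simp [hl.carried]
  integrable := hl.integrable.smul_measure ENNReal.ofReal_ne_top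

theorem fieldEnergy_add_smul (hl : IsCarriedEnergyMeasure V F lam)
    (hν : IsCarriedEnergyMeasure V F ν) {s : ℝ} (hs : 0 ≤ s) :
    fieldEnergy V (lam + ENNReal.ofReal s • ν) = fieldEnergy V lam +
      s * (2 * ((mutualEnergy lam ν).toReal + ∫ z, (V z).re ∂ν)) +
      s ^ 2 * (greenEnergy ν).toReal := by
  unfold fieldEnergy
  rw [toReal_greenEnergy_add_smul hl.energy hν.energy hs, integral_add_measure hl.integrable
    (hν.integrable.smul_measure ENNReal.ofReal_ne_top), integral_smul_measure,
    ENNReal.toReal_ofReal hs, smul_eq_mul]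
  ring

theorem fieldEnergy_smul (hl : IsCarriedEnergyMeasure V F lam) {s : ℝ} (hs : 0 ≤ s) :
    fieldEnergy V (ENNReal.ofReal s • lam) = s ^ 2 * (greenEnergy lam).toReal +
      s * (2 * ∫ z, (V z).re ∂lam) := by
  have := hl.energy.finite
  unfold fieldEnergy
  rw [← mutualEnergy_self, mutualEnergy_smul_left, mutualEnergy_smul_right, mutualEnergy_self,
    ENNReal.toReal_mul, ENNReal.toReal_mul, integral_smul_measure, ENNReal.toReal_ofReal hs,
    smul_eq_mul]
  ring

/-- The Euler–Lagrange inequality of a minimiser: the total potential of `lam` is nonnegative on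
every competitor, and vanishes on `lam` itself. -/
theorem mutualEnergy_add_field_nonneg (hl : IsCarriedEnergyMeasure V F lam)
    (hmin : ∀ ν, IsCarriedEnergyMeasure V F ν → fieldEnergy V lam ≤ fieldEnergy V ν)
    (hν : IsCarriedEnergyMeasure V F ν) :
    0 ≤ (mutualEnergy lam ν).toReal + ∫ z, (V z).re ∂ν ∧
      (greenEnergy lam).toReal + ∫ z, (V z).re ∂lam ≤ 0 := by
  constructor
  · have h := nonneg_of_forall_small (a := 2 * ((mutualEnergy lam ν).toReal + ∫ z, (V z).re ∂ν))
      (b := (greenEnergy ν).toReal) fun s hs _ => by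
        have h1 := hmin _ (hl.add_smul hν s)
        rw [fieldEnergy_add_smul hl hν hs.le] at h1
        linarith
    linarith
  · have h := nonneg_of_forall_small
      (a := -2 * ((greenEnergy lam).toReal + ∫ z, (V z).re ∂lam))
      (b := (greenEnergy lam).toReal) fun s hs hs1 => by
        have h1 := hmin _ (hl.smul (1 - s))
        rw [fieldEnergy_smul hl (by linarith), fieldEnergy] at h1
        linarith
    linarith

/-- The energy of a competitor exceeds the minimum by at least its squared energy distance from the
minimiser. -/
theorem energyDist_le_fieldEnergy_sub (hl : IsCarriedEnergyMeasure V F lam)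
    (hmin : ∀ ν, IsCarriedEnergyMeasure V F ν → fieldEnergy V lam ≤ fieldEnergy V ν)
    (hν : IsCarriedEnergyMeasure V F ν) :
    energyDist ν lam ≤ fieldEnergy V ν - fieldEnergy V lam := by
  have := hl.energy.finite
  have := hν.energy.finite
  obtain ⟨h1, h2⟩ := mutualEnergy_add_field_nonneg hl hmin hν
  unfold energyDist fieldEnergy
  rw [mutualEnergy_comm ν lam]
  linarith

theorem FlowBounds.isCarriedEnergyMeasure_map (h : FlowBounds V k C τ₀) (hτ : |τ| ≤ τ₀)
    (hν : IsCarriedEnergyMeasure V F ν) :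
    IsCarriedEnergyMeasure V (flow k τ '' F) (ν.map (flow k τ)) := by
  have := hν.energy.finite
  refine ⟨(h.hasFiniteEnergy_map_iff hτ hν.energy.upper).2 hν.energy, ?_,
    (h.integrable_field_map_iff hτ hν.energy.upper).2 hν.integrable⟩
  rw [(h.measurableEmbedding hτ).map_apply, preimage_compl,
    preimage_image_eq _ (h.injective τ hτ), hν.carried]

/-- Every competitor on the image of `F` is the image of a competitor on `F`. -/
theorem FlowBounds.exists_eq_map (h : FlowBounds V k C τ₀) (hτ : |τ| ≤ τ₀)
    (hF : F ⊆ {z | 0 ≤ z.im}) (hν : IsCarriedEnergyMeasure V (flow k τ '' F) ν) :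
    ∃ ν', IsCarriedEnergyMeasure V F ν' ∧ ν = ν'.map (flow k τ) := by
  have := hν.energy.finite
  have he := h.measurableEmbedding hτ
  have hmap : (ν.comap (flow k τ)).map (flow k τ) = ν := by
    rw [he.map_comap]
    refine Measure.restrict_eq_self_of_ae_mem ?_
    rw [ae_iff]
    exact measure_mono_null (compl_subset_compl.2 (image_subset_range _ _)) hν.carried
  have hfin : IsFiniteMeasure (ν.comap (flow k τ)) :=
    ⟨by rw [he.comap_apply]; exact measure_lt_top _ _⟩
  have hcar : (ν.comap (flow k τ)) Fᶜ = 0 := by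
    rw [he.comap_apply]
    exact measure_mono_null (image_compl_subset (h.injective τ hτ)) hν.carried
  have hup : ∀ᵐ z ∂ν.comap (flow k τ), 0 ≤ z.im := by
    rw [ae_iff]
    exact measure_mono_null (fun z hz hzF => hz (hF hzF)) hcar
  refine ⟨ν.comap (flow k τ), ⟨?_, hcar, ?_⟩, hmap.symm⟩
  · rw [← h.hasFiniteEnergy_map_iff hτ hup, hmap]
    exact hν.energy
  · rw [← h.integrable_field_map_iff hτ hup, hmap]
    exact hν.integrable

/-- The derivative of the potential of `lam` and of the field along the variation. -/
noncomputable def potentialVariation (V k : ℂ → ℂ) (lam : Measure ℂ) (u : ℂ) : ℝ :=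
  -∫ v, (variationKernel k u v).re ∂lam + (deriv V u * k u).re

theorem FlowBounds.abs_potentialVariation_le (h : FlowBounds V k C τ₀) [IsFiniteMeasure lam]
    (hl : ∀ᵐ z ∂lam, 0 ≤ z.im) {u : ℂ} (hu : 0 ≤ u.im) :
    |potentialVariation V k lam u| ≤ C * (1 + ∫ v, greenWeight v ∂lam) * greenWeight u := by
  have h1 : |∫ v, (variationKernel k u v).re ∂lam| ≤
      ∫ v, C * greenWeight u * greenWeight v ∂lam := by
    refine abs_integral_le_integral ((integrable_greenWeight hl).const_mul _) ?_
    filter_upwards [hl] with v hv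
    rw [mul_assoc]
    exact h.kernel u v hu hv
  rw [integral_const_mul] at h1
  have h2 := h.slope u hu
  unfold potentialVariation
  refine (abs_add_le _ _).trans ?_
  rw [abs_neg]
  linarith

theorem FlowBounds.continuousOn_potentialVariation (h : FlowBounds V k C τ₀)
    (hl : HasFiniteEnergy lam) : ContinuousOn (potentialVariation V k lam) {z | 0 < z.im} := by
  have := hl.finite
  refine ContinuousOn.add (ContinuousOn.neg fun u hu => ContinuousAt.continuousWithinAt ?_)
    h.slope_continuous.continuousOn
  have hev : ∀ᶠ u' : ℂ in 𝓝 u, 0 < u'.im :=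
    (isOpen_lt continuous_const Complex.continuous_im).mem_nhds hu
  refine continuousAt_of_dominated (bound := fun v => C * Real.log 5 * greenWeight v)
    ?_ ?_ ((integrable_greenWeight hl.upper).const_mul _) ?_
  · exact Eventually.of_forall fun u' => ((measurable_variationKernel_re h.continuous).comp
      measurable_prodMk_left).aestronglyMeasurable
  · filter_upwards [hev] with u' hu'
    filter_upwards [hl.upper] with v hv
    refine (h.kernel u' v hu'.le hv).trans ?_
    rw [mul_assoc]
    have := h.pos
    have := greenWeight_le hu'.le
    have := greenWeight_nonneg hv
    gcongr
  · filter_upwards [hl.upper, ae_ne_of_greenEnergy hl.energy u] with v hv hne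
    have hne' : u ≠ v := fun e => hne ⟨e, hu⟩
    have hne2 : u - starRingEnd ℂ v ≠ 0 := by
      intro e
      have := congrArg Complex.im e
      simp at this
      have hu' : 0 < u.im := hu
      linarith
    have hk := h.continuous
    unfold variationKernel
    refine Complex.continuous_re.continuousAt.comp ?_
    refine ContinuousAt.sub ?_ ?_
    · exact ContinuousAt.div (by fun_prop) (by fun_prop) (sub_ne_zero.2 hne')
    · exact ContinuousAt.div (by fun_prop) (by fun_prop) hne2

/-- Fubini, in the form in which the mixed terms of the energy expansion occur. -/
theorem FlowBounds.integral_potentialVariation (h : FlowBounds V k C τ₀)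
    (hl : HasFiniteEnergy lam) (hν : HasFiniteEnergy ν) :
    ∫ u, potentialVariation V k lam u ∂ν =
      -∫ z, (variationKernel k z.1 z.2).re ∂ν.prod lam + ∫ u, (deriv V u * k u).re ∂ν := by
  have := hl.finite
  have := hν.finite
  have hi := h.integrable_kernel hν.upper hl.upper
  have hi' : Integrable (fun u => -∫ v, (variationKernel k u v).re ∂lam) ν :=
    hi.integral_prod_left.neg
  unfold potentialVariation
  rw [integral_add hi' (h.integrable_slope hν.upper), integral_neg, integral_prod _ hi]

/-- The derivative at `0` of the energy of the image of `lam` along the variation. -/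
noncomputable def energyVariation (V k : ℂ → ℂ) (lam : Measure ℂ) : ℝ :=
  -∫ z, (variationKernel k z.1 z.2).re ∂lam.prod lam + 2 * ∫ u, (deriv V u * k u).re ∂lam

theorem FlowBounds.abs_fieldEnergy_map_sub_le (h : FlowBounds V k C τ₀) (hτ : |τ| ≤ τ₀)
    (hν : IsCarriedEnergyMeasure V F ν) :
    |fieldEnergy V (ν.map (flow k τ)) - fieldEnergy V ν - τ * energyVariation V k ν| ≤
      C * τ ^ 2 * ((∫ u, greenWeight u ∂ν) ^ 2 + 2 * ∫ u, greenWeight u ∂ν) := by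
  have := hν.energy.finite
  have h1 := h.mutualEnergy_expansion hτ hν.energy hν.energy
  have h2 := h.field_expansion hτ hν.energy.upper hν.integrable
  rw [mutualEnergy_self, mutualEnergy_self] at h1
  rw [abs_le] at h1 h2 ⊢
  unfold fieldEnergy energyVariation
  constructor <;> nlinarith [h1.1, h1.2, h2.1, h2.2]

theorem FlowBounds.abs_energyVariation_le (h : FlowBounds V k C τ₀)
    (hν : HasFiniteEnergy ν) : |energyVariation V k ν| ≤
      C * ((∫ u, greenWeight u ∂ν) ^ 2 + 2 * ∫ u, greenWeight u ∂ν) := by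
  have := hν.finite
  have h1 := h.abs_integral_kernel_le hν.upper hν.upper
  have h2 := h.abs_integral_slope_le hν.upper
  rw [abs_le] at h1 h2 ⊢
  unfold energyVariation
  constructor <;> nlinarith [h1.1, h1.2, h2.1, h2.2]

theorem FlowBounds.abs_fieldEnergy_map_sub_le' (h : FlowBounds V k C τ₀) (hτ : |τ| ≤ τ₀)
    (hν : IsCarriedEnergyMeasure V F ν) :
    |fieldEnergy V (ν.map (flow k τ)) - fieldEnergy V ν| ≤
      2 * C * |τ| * ((∫ u, greenWeight u ∂ν) ^ 2 + 2 * ∫ u, greenWeight u ∂ν) := by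
  have h1 := h.abs_fieldEnergy_map_sub_le hτ hν
  have h2 := h.abs_energyVariation_le hν.energy
  set P := (∫ u, greenWeight u ∂ν) ^ 2 + 2 * ∫ u, greenWeight u ∂ν with hP
  have hP0 : 0 ≤ P := by
    have := integral_greenWeight_nonneg hν.energy.upper
    positivity
  have h3 : |τ * energyVariation V k ν| ≤ |τ| * (C * P) := by
    rw [abs_mul]; gcongr
  have h4 : C * τ ^ 2 * P ≤ |τ| * (C * P) := by
    have : τ ^ 2 ≤ |τ| := by
      rw [← sq_abs]; nlinarith [abs_nonneg τ, hτ.trans h.le_one]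
    have h5 : 0 ≤ C * P := mul_nonneg h.pos.le hP0
    nlinarith
  have h1' := abs_le.1 (h1.trans h4)
  have h3' := abs_le.1 h3
  rw [abs_le]
  constructor <;> nlinarith [h1'.1, h1'.2, h3'.1, h3'.2]

/-- Competitors that do better than the image of the minimiser are close to the minimiser. -/
theorem FlowBounds.energyDist_le (h : FlowBounds V k C τ₀) (hτ : |τ| ≤ τ₀)
    (hτ' : 16 * C * Real.log 5 * |τ| ≤ 1) (hl : IsCarriedEnergyMeasure V F lam)
    (hmin : ∀ ν, IsCarriedEnergyMeasure V F ν → fieldEnergy V lam ≤ fieldEnergy V ν)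
    (hν : IsCarriedEnergyMeasure V F ν)
    (hle : fieldEnergy V (ν.map (flow k τ)) ≤ fieldEnergy V (lam.map (flow k τ))) :
    energyDist ν lam ≤ 4 * C * (5 * (∫ u, greenWeight u ∂lam) ^ 2 +
      2 * (∫ u, greenWeight u ∂lam) + 1) * |τ| := by
  have h1 := (abs_le.1 (h.abs_fieldEnergy_map_sub_le' hτ hν)).1
  have h2 := (abs_le.1 (h.abs_fieldEnergy_map_sub_le' hτ hl)).2
  have h3 := energyDist_le_fieldEnergy_sub hl hmin hν
  have h4 := sq_integral_greenWeight_sub_le hν.energy hl.energy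
  have h5 := energyDist_nonneg hν.energy hl.energy
  set p := ∫ u, greenWeight u ∂lam
  set P := ∫ u, greenWeight u ∂ν
  set N := energyDist ν lam
  have hC := h.pos
  -- The weighted mass `P` of the competitor is itself bounded by the energy distance `N`; for small `τ`
  -- the resulting term `N / 2` is absorbed on the left.
  have h6 : P ^ 2 ≤ 2 * p ^ 2 + 2 * (N * Real.log 5) := by nlinarith [sq_nonneg (P - 2 * p)]
  have h7 : P ^ 2 + 2 * P ≤ 2 * P ^ 2 + 1 := by nlinarith [sq_nonneg (P - 1)]
  have h8 : N ≤ 2 * C * |τ| * ((P ^ 2 + 2 * P) + (p ^ 2 + 2 * p)) := by linarith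
  have h9 : 2 * C * |τ| * ((P ^ 2 + 2 * P) + (p ^ 2 + 2 * p)) ≤
      2 * C * |τ| * ((4 * p ^ 2 + 4 * (N * Real.log 5) + 1) + (p ^ 2 + 2 * p)) := by
    have : 0 ≤ 2 * C * |τ| := by positivity
    exact mul_le_mul_of_nonneg_left (by linarith) this
  have h10 : 2 * C * |τ| * (4 * (N * Real.log 5)) ≤ N / 2 := by
    nlinarith [mul_le_mul_of_nonneg_right hτ' h5]
  nlinarith

/-- First-order lower bound for the energies of the images of competitors: the energy distance of
the images is nonnegative, and the remaining terms are linear in the competitor. -/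
theorem FlowBounds.le_fieldEnergy_map (h : FlowBounds V k C τ₀) (hτ : |τ| ≤ τ₀)
    (hl : IsCarriedEnergyMeasure V F lam)
    (hmin : ∀ ν, IsCarriedEnergyMeasure V F ν → fieldEnergy V lam ≤ fieldEnergy V ν)
    (hν : IsCarriedEnergyMeasure V F ν) :
    fieldEnergy V (lam.map (flow k τ)) +
      2 * τ * (∫ u, potentialVariation V k lam u ∂ν - ∫ u, potentialVariation V k lam u ∂lam) -
      2 * C * τ ^ 2 * ((∫ u, greenWeight u ∂ν) * (∫ u, greenWeight u ∂lam) +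
        (∫ u, greenWeight u ∂lam) * (∫ u, greenWeight u ∂lam) + (∫ u, greenWeight u ∂ν) +
        ∫ u, greenWeight u ∂lam) ≤ fieldEnergy V (ν.map (flow k τ)) := by
  have := hl.energy.finite
  have := hν.energy.finite
  have e1 := (abs_le.1 (h.mutualEnergy_expansion hτ hν.energy hl.energy)).1
  have e2 := (abs_le.1 (h.mutualEnergy_expansion hτ hl.energy hl.energy)).2
  have e3 := (abs_le.1 (h.field_expansion hτ hν.energy.upper hν.integrable)).1
  have e4 := (abs_le.1 (h.field_expansion hτ hl.energy.upper hl.integrable)).2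
  obtain ⟨b1, b2⟩ := mutualEnergy_add_field_nonneg hl hmin hν
  have n := energyDist_nonneg ((h.hasFiniteEnergy_map_iff hτ hν.energy.upper).2 hν.energy)
    ((h.hasFiniteEnergy_map_iff hτ hl.energy.upper).2 hl.energy)
  rw [h.integral_potentialVariation hl.energy hν.energy,
    h.integral_potentialVariation hl.energy hl.energy]
  rw [mutualEnergy_comm lam ν] at b1
  rw [mutualEnergy_self, mutualEnergy_self] at e2
  unfold energyDist at n
  unfold fieldEnergy
  nlinarith

/-- **Envelope theorem.** The infimum of the energy over the measures carried by the image of `F`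
under the variation is differentiable at `0`; its derivative is that of the energy of the image of the
minimiser. -/
theorem FlowBounds.exists_hasDerivAt (h : FlowBounds V k C τ₀) (hF : F ⊆ {z | 0 ≤ z.im})
    (hl : IsCarriedEnergyMeasure V F lam)
    (hmin : ∀ ν, IsCarriedEnergyMeasure V F ν → fieldEnergy V lam ≤ fieldEnergy V ν) :
    ∃ e : ℝ → ℝ, (∀ᶠ τ : ℝ in 𝓝 0, IsGLB {r | ∃ ν, IsCarriedEnergyMeasure V (flow k τ '' F) ν ∧
      r = fieldEnergy V ν} (e τ)) ∧ HasDerivAt e (energyVariation V k lam) 0 := by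
  have := hl.energy.finite
  have hC := h.pos
  have hτ₀ := h.pos'
  set p := ∫ u, greenWeight u ∂lam with hp
  have hp0 : 0 ≤ p := integral_greenWeight_nonneg hl.energy.upper
  set S : ℝ → Set ℝ := fun τ => {r | ∃ ν, IsCarriedEnergyMeasure V (flow k τ '' F) ν ∧
      r = fieldEnergy V ν} with hS
  -- the images of all competitors have energy at least that of the image of `lam`, up to `ε |τ|`
  have key : ∀ ε > 0, ∀ᶠ τ : ℝ in 𝓝 0, |τ| ≤ τ₀ ∧
      fieldEnergy V (lam.map (flow k τ)) - ε * |τ| ∈ lowerBounds (S τ) := by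
    intro ε hε
    obtain ⟨δ, hδ, hcl⟩ := exists_energyDist_lt (h.continuousOn_potentialVariation hl.energy)
      (fun u hu => h.abs_potentialVariation_le hl.energy.upper hu) hl.energy
      (show 0 < ε / 4 by positivity)
    have hsm : ∀ {c d : ℝ}, 0 < d → ∀ᶠ τ : ℝ in 𝓝 0, c * |τ| < d := fun {c d} hd => by
      have : Tendsto (fun τ : ℝ => c * |τ|) (𝓝 0) (𝓝 (c * |0|)) :=
        Continuous.tendsto (by fun_prop) 0
      rw [abs_zero, mul_zero] at this
      exact this.eventually_lt_const hd
    set B := 4 * C * (5 * p ^ 2 + 2 * p + 1) with hB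
    set P := p + 1 + Real.log 5 with hP
    have hlog : 0 < Real.log 5 := Real.log_pos (by norm_num)
    filter_upwards [hsm (c := 1) hτ₀, hsm (c := 16 * C * Real.log 5) one_pos, hsm (c := B) hδ,
      hsm (c := B) one_pos,
      hsm (c := 2 * C * (P * p + p * p + P + p)) (show 0 < ε / 2 by positivity)]
      with τ h1 h2 h3 h4 h5
    rw [one_mul] at h1
    refine ⟨h1.le, ?_⟩
    rintro r ⟨ν', hν', rfl⟩
    obtain ⟨ν, hν, rfl⟩ := h.exists_eq_map h1.le hF hν'
    -- Only competitors that beat the image of the minimiser matter, and these are close to the minimiser,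
    -- so that `potentialVariation` has nearly the same integral against both.
    rcases le_total (fieldEnergy V (ν.map (flow k τ))) (fieldEnergy V (lam.map (flow k τ)))
      with hle | hle
    · have d1 := h.energyDist_le h1.le h2.le hl hmin hν hle
      have d2 := hcl ν hν.energy (d1.trans_lt h3)
      have d3 := h.le_fieldEnergy_map h1.le hl hmin hν
      have d4 := sq_integral_greenWeight_sub_le hν.energy hl.energy
      have d5 : ∫ u, greenWeight u ∂ν ≤ P := by
        have : (∫ u, greenWeight u ∂ν - p) ^ 2 ≤ Real.log 5 := by
          refine d4.trans ?_
          have := d1.trans h4.le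
          nlinarith
        nlinarith [sq_nonneg (∫ u, greenWeight u ∂ν - p - 1)]
      have d6 : |τ * (∫ u, potentialVariation V k lam u ∂ν -
          ∫ u, potentialVariation V k lam u ∂lam)| ≤ |τ| * (ε / 4) := by
        rw [abs_mul]; gcongr
      have d7 := (abs_le.1 d6).1
      have d8 : (∫ u, greenWeight u ∂ν) * p + p * p + (∫ u, greenWeight u ∂ν) + p ≤
          P * p + p * p + P + p := by gcongr
      have d9 : 2 * C * τ ^ 2 * ((∫ u, greenWeight u ∂ν) * p + p * p +
          (∫ u, greenWeight u ∂ν) + p) ≤ |τ| * (ε / 2) := by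
        calc _ ≤ 2 * C * τ ^ 2 * (P * p + p * p + P + p) := by gcongr
          _ = |τ| * (2 * C * (P * p + p * p + P + p) * |τ|) := by rw [← sq_abs]; ring
          _ ≤ _ := by gcongr
      linarith
    · have := mul_nonneg hε.le (abs_nonneg τ)
      linarith
  have hmem : ∀ τ : ℝ, |τ| ≤ τ₀ → fieldEnergy V (lam.map (flow k τ)) ∈ S τ := fun τ hτ =>
    ⟨_, h.isCarriedEnergyMeasure_map hτ hl, rfl⟩
  have hglb : ∀ᶠ τ : ℝ in 𝓝 0, IsGLB (S τ) (sInf (S τ)) := by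
    filter_upwards [key 1 one_pos] with τ hτ
    exact isGLB_csInf ⟨_, hmem τ hτ.1⟩ ⟨_, hτ.2⟩
  refine ⟨fun τ => sInf (S τ), hglb, ?_⟩
  have hflow0 : flow k 0 = id := by ext z; simp [flow]
  have e0 : sInf (S 0) = fieldEnergy V lam := by
    have hk0 := (key 1 one_pos).self_of_nhds
    refine le_antisymm ?_ ?_
    · have := hglb.self_of_nhds.1 (hmem 0 (by simpa using hτ₀.le))
      rwa [hflow0, Measure.map_id] at this
    · have := hglb.self_of_nhds.2 hk0.2
      rwa [hflow0, Measure.map_id, abs_zero, mul_zero, sub_zero] at this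
  rw [hasDerivAt_iff_isLittleO, Asymptotics.isLittleO_iff]
  intro ε hε
  set M := C * (p ^ 2 + 2 * p) with hM
  have hM0 : 0 ≤ M := by positivity
  have hsm : ∀ᶠ τ : ℝ in 𝓝 0, M * |τ| < ε / 2 := by
    have : Tendsto (fun τ : ℝ => M * |τ|) (𝓝 0) (𝓝 (M * |0|)) :=
      Continuous.tendsto (by fun_prop) 0
    rw [abs_zero, mul_zero] at this
    exact this.eventually_lt_const (by positivity)
  filter_upwards [key (ε / 2) (by positivity), hglb, hsm] with τ h1 h2 h3
  have u1 := h2.1 (hmem τ h1.1)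
  have u2 := h2.2 h1.2
  have u3 := h.abs_fieldEnergy_map_sub_le h1.1 hl
  rw [← hp] at u3
  have u4 : C * τ ^ 2 * (p ^ 2 + 2 * p) ≤ ε / 2 * |τ| := by
    calc _ = M * |τ| * |τ| := by rw [← sq_abs]; ring
      _ ≤ _ := by gcongr
  have u5 := abs_le.1 (u3.trans u4)
  have hn := mul_nonneg hε.le (abs_nonneg τ)
  rw [e0, sub_zero, smul_eq_mul, Real.norm_eq_abs, Real.norm_eq_abs, abs_le]
  constructor <;> linarith [u5.1, u5.2]

end Envelope

/-! ### The external field -/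

theorem isOpen_upperHalf : IsOpen {z : ℂ | 0 < z.im} := isOpen_lt continuous_const Complex.continuous_im

theorem isClosed_closedUpperHalf : IsClosed {z : ℂ | 0 ≤ z.im} :=
  isClosed_le continuous_const Complex.continuous_im

theorem isOpen_slitHalfPlane (A : ℝ) : IsOpen (slitHalfPlane A) := by
  have h : IsClosed {z : ℂ | z.re = 0 ∧ z.im ≤ A} :=
    (isClosed_eq Complex.continuous_re continuous_const).inter
      (isClosed_le Complex.continuous_im continuous_const)
  exact isOpen_upperHalf.inter h.isOpen_compl

theorem slitHalfPlane_subset (A : ℝ) : slitHalfPlane A ⊆ {z | 0 < z.im} := fun _ h => h.1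

namespace IsSpectralDensity

variable {A : ℝ} {ρ : ℂ → ℂ}

theorem exists_bound (hρ : IsSpectralDensity A ρ) : ∃ M > 0, ∀ z : ℂ, 0 ≤ z.im → ‖ρ z‖ ≤ M := by
  obtain ⟨c, hc⟩ := hρ.continuous_infty
  have h1 : ∀ᶠ z in Bornology.cobounded ℂ ⊓ 𝓟 {z : ℂ | 0 ≤ z.im}, ‖ρ z‖ < ‖c‖ + 1 :=
    hc.norm.eventually_lt_const (lt_add_one _)
  rw [eventually_inf_principal] at h1
  obtain ⟨R, -, hR⟩ := (Metric.hasBasis_cobounded_compl_closedBall (0 : ℂ)).eventually_iff.1 h1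
  have hK : IsCompact (Metric.closedBall (0 : ℂ) R ∩ {z | 0 ≤ z.im}) :=
    (isCompact_closedBall _ _).inter_right isClosed_closedUpperHalf
  obtain ⟨B, hB⟩ := hK.exists_bound_of_continuousOn (hρ.continuousOn.mono inter_subset_right)
  refine ⟨max B (‖c‖ + 1), lt_max_of_lt_right (by positivity), fun z hz => ?_⟩
  by_cases h : z ∈ Metric.closedBall (0 : ℂ) R
  · exact (hB z ⟨h, hz⟩).trans (le_max_left _ _)
  · exact (hR h hz).le.trans (le_max_right _ _)

theorem differentiableAt (hρ : IsSpectralDensity A ρ) {z : ℂ} (hz : 0 < z.im) :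
    DifferentiableAt ℂ ρ z :=
  hρ.holomorphic.differentiableAt (isOpen_upperHalf.mem_nhds hz)

theorem norm_deriv_le (hρ : IsSpectralDensity A ρ) {M : ℝ} (hM : ∀ z : ℂ, 0 ≤ z.im → ‖ρ z‖ ≤ M)
    {z : ℂ} (hz : 0 < z.im) : ‖deriv ρ z‖ ≤ 2 * M / z.im := by
  have hsub : Metric.closedBall z (z.im / 2) ⊆ {w : ℂ | 0 < w.im} := by
    intro w hw
    have h1 : |(w - z).im| ≤ z.im / 2 := (Complex.abs_im_le_norm _).trans (by
      rwa [Metric.mem_closedBall, dist_eq_norm] at hw)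
    have h2 := (abs_le.1 h1).1
    simp only [Complex.sub_im] at h2
    show 0 < w.im
    linarith
  have h := Complex.norm_deriv_le_of_forall_mem_sphere_norm_le (f := ρ) (half_pos hz)
    ((hρ.holomorphic.mono hsub).diffContOnCl_ball subset_rfl)
    (fun w hw => hM w (hsub (Metric.sphere_subset_closedBall hw)).le)
  refine h.trans (le_of_eq ?_)
  field_simp

theorem norm_sub_le (hρ : IsSpectralDensity A ρ) {M : ℝ} (hM : ∀ z : ℂ, 0 ≤ z.im → ‖ρ z‖ ≤ M)
    {d : ℝ} (hd : 0 < d) {z w : ℂ} (hz : d ≤ z.im) (hw : d ≤ w.im) :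
    ‖ρ w - ρ z‖ ≤ 2 * M / d * ‖w - z‖ := by
  have hM0 : 0 ≤ M := (norm_nonneg _).trans (hM 0 (by simp))
  have hconv : Convex ℝ {z : ℂ | d ≤ z.im} := convex_halfSpace_im_ge d
  refine hconv.norm_image_sub_le_of_norm_deriv_le (𝕜 := ℂ)
    (fun u hu => hρ.differentiableAt (hd.trans_le hu)) (fun u hu => ?_) hz hw
  refine (hρ.norm_deriv_le hM (hd.trans_le hu)).trans ?_
  have hu' : d ≤ u.im := hu
  gcongr

theorem segment_mul_I (hρ : IsSpectralDensity A ρ) {s : ℝ} (h0 : 0 ≤ s) (h1 : s ≤ A) :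
    ρ (s * Complex.I) * Complex.I = ((-(ρ (s * Complex.I)).im : ℝ) : ℂ) := by
  have := hρ.re_segment s ⟨h0, h1⟩
  apply Complex.ext <;> simp [this]

theorem continuousOn_segment (hρ : IsSpectralDensity A ρ) :
    ContinuousOn (fun s : ℝ => ρ (s * Complex.I)) (Ici 0) :=
  hρ.continuousOn.comp (by fun_prop) fun s hs => by simpa using hs

theorem continuousOn_ray (hρ : IsSpectralDensity A ρ) {z : ℂ} (hz : 0 ≤ z.im) :
    ContinuousOn (fun s : ℝ => ρ (s * z)) (Ici 0) :=
  hρ.continuousOn.comp (by fun_prop) fun s hs => by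
    have : 0 ≤ s * z.im := mul_nonneg hs hz
    simpa using this

end IsSpectralDensity

/-! ### The integral of the density along a ray -/

/-- The integral of `ρ` along the segment from `0` to `z`. -/
noncomputable def rayIntegral (ρ : ℂ → ℂ) (z : ℂ) : ℂ := ∫ s in (0 : ℝ)..1, ρ (s * z) * z

section Ray

variable {A : ℝ} {ρ : ℂ → ℂ}

theorem reflectedDensity_of_nonneg {z : ℂ} (hz : 0 ≤ z.im) : reflectedDensity ρ z = ρ z :=
  if_pos hz

theorem tailIntegral_eq {z : ℂ} (hA : 0 ≤ A) (hz : 0 ≤ z.im) : tailIntegral A ρ z =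
    rayIntegral ρ (A * Complex.I) - rayIntegral ρ z := by
  unfold tailIntegral rayIntegral
  congr 1 <;> refine intervalIntegral.integral_congr fun s hs => ?_ <;>
    rw [uIcc_of_le zero_le_one] at hs <;> rw [reflectedDensity_of_nonneg]
  · simpa using mul_nonneg hs.1 hA
  · simpa using mul_nonneg hs.1 hz

/-- The derivative of the integrand with respect to `z` is `d/ds (s ρ(s z))`, so that it integrates to
`ρ z`; the Cauchy estimate for `ρ` dominates it. -/
theorem hasDerivAt_rayIntegral (hρ : IsSpectralDensity A ρ) {z : ℂ} (hz : 0 < z.im) :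
    HasDerivAt (rayIntegral ρ) (ρ z) z := by
  obtain ⟨M, hM0, hM⟩ := hρ.exists_bound
  set F' : ℂ → ℝ → ℂ := fun w s => (s * deriv ρ (s * w)) * w + ρ (s * w) with hF'
  have him : ∀ {s : ℝ} {w : ℂ}, 0 < s → 0 < w.im → 0 < ((s : ℂ) * w).im := fun hs hw => by
    simpa using mul_pos hs hw
  have hball : Metric.ball z (z.im / 2) ∈ 𝓝 z := Metric.ball_mem_nhds _ (half_pos hz)
  have hbim : ∀ w ∈ Metric.ball z (z.im / 2), z.im / 2 < w.im := by
    intro w hw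
    rw [Metric.mem_ball, dist_eq_norm] at hw
    have h2 := (abs_le.1 ((Complex.abs_im_le_norm (w - z)))).1
    simp only [Complex.sub_im] at h2
    linarith
  have hbn : ∀ w ∈ Metric.ball z (z.im / 2), ‖w‖ ≤ ‖z‖ + z.im / 2 := by
    intro w hw
    rw [Metric.mem_ball, dist_eq_norm] at hw
    have : ‖w‖ ≤ ‖w - z‖ + ‖z‖ := by simpa using norm_add_le (w - z) z
    linarith
  have hmeas : ∀ w : ℂ, 0 ≤ w.im → ContinuousOn (fun s : ℝ => ρ (s * w) * w) (Icc 0 1) :=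
    fun w hw => ((hρ.continuousOn_ray hw).mono Icc_subset_Ici_self).mul continuousOn_const
  obtain ⟨hint, hder⟩ := intervalIntegral.hasDerivAt_integral_of_dominated_loc_of_deriv_le
    (μ := volume) (a := 0) (b := 1) (F := fun (w : ℂ) (s : ℝ) => ρ (s * w) * w) (F' := F')
    (bound := fun _ => 2 * M / (z.im / 2) * (‖z‖ + z.im / 2) + M) hball
    (by
      filter_upwards [hball] with w hw
      rw [uIoc_of_le zero_le_one]
      exact ((hmeas w ((half_pos hz).trans (hbim w hw)).le).mono
        Ioc_subset_Icc_self).aestronglyMeasurable measurableSet_Ioc)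
    ((hmeas z hz.le).intervalIntegrable_of_Icc zero_le_one)
    (by
      rw [uIoc_of_le zero_le_one]
      refine ContinuousOn.aestronglyMeasurable ?_ measurableSet_Ioc
      have hmap : MapsTo (fun s : ℝ => (s : ℂ) * z) (Ioc 0 1) {w : ℂ | 0 < w.im} :=
        fun s hs => him hs.1 hz
      have h1 : ContinuousOn (fun s : ℝ => deriv ρ (s * z)) (Ioc 0 1) :=
        (hρ.holomorphic.deriv isOpen_upperHalf).continuousOn.comp (by fun_prop) hmap
      have h2 : ContinuousOn (fun s : ℝ => ρ (s * z)) (Ioc 0 1) :=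
        hρ.holomorphic.continuousOn.comp (by fun_prop) hmap
      exact (((Complex.continuous_ofReal.continuousOn).mul h1).mul continuousOn_const).add h2)
    (by
      refine ae_of_all _ fun s hs w hw => ?_
      rw [uIoc_of_le zero_le_one] at hs
      have hw0 := (half_pos hz).trans (hbim w hw)
      have hsw := him hs.1 hw0
      refine (norm_add_le _ _).trans (add_le_add ?_ (hM _ hsw.le))
      rw [norm_mul, norm_mul]
      have e : ‖(s : ℂ)‖ = s := by simp [abs_of_pos hs.1]
      have h1 := hρ.norm_deriv_le hM hsw
      have h2 : ‖(s : ℂ)‖ * ‖deriv ρ (s * w)‖ ≤ 2 * M / (z.im / 2) := by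
        rw [e]
        calc s * ‖deriv ρ (s * w)‖ ≤ s * (2 * M / ((s : ℂ) * w).im) := by
              have := hs.1
              gcongr
          _ = 2 * M / w.im := by
              have := hs.1.ne'
              have := hw0.ne'
              simp
              field_simp
          _ ≤ _ := by
              have := (hbim w hw).le
              gcongr
      have h3 := hbn w hw
      gcongr)
    intervalIntegrable_const
    (by
      refine ae_of_all _ fun s hs w hw => ?_
      rw [uIoc_of_le zero_le_one] at hs
      have hw0 := (half_pos hz).trans (hbim w hw)
      have h1 := (hρ.differentiableAt (him hs.1 hw0)).hasDerivAt
      have h2 : HasDerivAt (fun w : ℂ => (s : ℂ) * w) s w := by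
        simpa using (hasDerivAt_id w).const_mul (s : ℂ)
      have h3 := (h1.comp w h2).mul (hasDerivAt_id w)
      refine h3.congr_deriv ?_
      simp [hF', mul_comm])
  have hfin : ∫ s in (0 : ℝ)..1, F' z s = ρ z := by
    rw [intervalIntegral.integral_eq_sub_of_hasDerivAt_of_le
      (f := fun s : ℝ => (s : ℂ) * ρ (s * z)) zero_le_one _ _ hint]
    · simp
    · exact Complex.continuous_ofReal.continuousOn.mul
        ((hρ.continuousOn_ray hz.le).mono Icc_subset_Ici_self)
    · intro s hs
      have h1 := (hρ.differentiableAt (him hs.1 hz)).hasDerivAt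
      have h2 : HasDerivAt (fun w : ℂ => w * z) z (s : ℂ) := by
        simpa using (hasDerivAt_id (s : ℂ)).mul_const z
      have h3 := ((hasDerivAt_id (s : ℂ)).mul (h1.comp (s : ℂ) h2)).comp_ofReal
      refine h3.congr_deriv ?_
      simp [hF', mul_comm, mul_left_comm, add_comm]
  rw [hfin] at hder
  exact hder

theorem continuousOn_rayIntegral (hρ : IsSpectralDensity A ρ) :
    ContinuousOn (rayIntegral ρ) {z | 0 ≤ z.im} := by
  obtain ⟨M, hM0, hM⟩ := hρ.exists_bound
  intro z hz
  have him : ∀ {s : ℝ} {w : ℂ}, 0 < s → 0 ≤ w.im → 0 ≤ ((s : ℂ) * w).im := fun hs hw => by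
    simpa using mul_nonneg hs.le hw
  refine intervalIntegral.continuousWithinAt_of_dominated_interval
    (bound := fun _ => M * (‖z‖ + 1)) ?_ ?_ intervalIntegrable_const ?_
  · filter_upwards [self_mem_nhdsWithin] with w hw
    rw [uIoc_of_le zero_le_one]
    exact (((hρ.continuousOn_ray hw).mono (Ioc_subset_Icc_self.trans Icc_subset_Ici_self)).mul
      continuousOn_const).aestronglyMeasurable measurableSet_Ioc
  · have h1 : ∀ᶠ w in 𝓝[{z : ℂ | 0 ≤ z.im}] z, ‖w‖ < ‖z‖ + 1 :=
      (continuous_norm.continuousWithinAt.tendsto).eventually_lt_const (lt_add_one _)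
    filter_upwards [self_mem_nhdsWithin, h1] with w hw hw1
    refine ae_of_all _ fun s hs => ?_
    rw [uIoc_of_le zero_le_one] at hs
    rw [norm_mul]
    have := hM _ (him hs.1 hw)
    gcongr
  · refine ae_of_all _ fun s hs => ?_
    rw [uIoc_of_le zero_le_one] at hs
    refine ContinuousWithinAt.mul ?_ continuousWithinAt_id
    exact (hρ.continuousOn _ (him hs.1 hz)).comp
      (by fun_prop) fun w hw => him hs.1 hw

end Ray

/-! ### The logarithmic part of the field -/

/-- The integral of `log((z-η)/(z+η)) ρ(η)` over the segment `[0, iA]`. -/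
noncomputable def logIntegral (A : ℝ) (ρ : ℂ → ℂ) (z : ℂ) : ℂ :=
  ∫ s in (0 : ℝ)..A,
      Complex.log ((z - s * Complex.I) / (z + s * Complex.I)) * ρ (s * Complex.I) * Complex.I

/-- The complement of the segment `[-iA, iA]`. -/
def segmentCompl (A : ℝ) : Set ℂ := {z | ¬ (z.re = 0 ∧ |z.im| ≤ A)}

theorem isOpen_segmentCompl (A : ℝ) : IsOpen (segmentCompl A) := by
  have h : IsClosed {z : ℂ | z.re = 0 ∧ |z.im| ≤ A} :=
    (isClosed_eq Complex.continuous_re continuous_const).inter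
      (isClosed_le (continuous_abs.comp Complex.continuous_im) continuous_const)
  exact h.isOpen_compl

theorem slitHalfPlane_subset_segmentCompl (A : ℝ) : slitHalfPlane A ⊆ segmentCompl A :=
  fun _ hz h => hz.2 ⟨h.1, (le_abs_self _).trans h.2⟩

theorem intervalIntegral_conj (f : ℝ → ℂ) (a b : ℝ) :
    ∫ s in a..b, starRingEnd ℂ (f s) = starRingEnd ℂ (∫ s in a..b, f s) := by
  simp only [intervalIntegral, integral_conj, map_sub]

section Log

variable {A : ℝ} {ρ : ℂ → ℂ}

theorem segmentCompl_ne {z : ℂ} (hz : z ∈ segmentCompl A) {s : ℝ} (hs : 0 ≤ s) (hsA : s ≤ A) :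
    z - s * Complex.I ≠ 0 ∧ z + s * Complex.I ≠ 0 := by
  constructor
  · intro h
    refine hz ?_
    rw [sub_eq_zero.1 h]
    simpa [abs_of_nonneg hs] using hsA
  · intro h
    refine hz ?_
    rw [eq_neg_of_add_eq_zero_left h]
    simpa [abs_of_nonneg hs] using hsA

/-- Off the segment the quotient avoids the negative real axis, where the principal branch jumps. -/
theorem segmentCompl_quotient_mem {z : ℂ} (hz : z ∈ segmentCompl A) {s : ℝ} (hs : 0 ≤ s)
    (hsA : s ≤ A) : (z - s * Complex.I) / (z + s * Complex.I) ∈ Complex.slitPlane := by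
  obtain ⟨h1, h2⟩ := segmentCompl_ne hz hs hsA
  have hn : 0 < Complex.normSq (z + s * Complex.I) := Complex.normSq_pos.2 h2
  have hre : ((z - s * Complex.I) / (z + s * Complex.I)).re =
      (z.re ^ 2 + z.im ^ 2 - s ^ 2) / Complex.normSq (z + s * Complex.I) := by
    rw [Complex.div_re]
    simp
    ring
  have him : ((z - s * Complex.I) / (z + s * Complex.I)).im =
      (-(2 * s * z.re)) / Complex.normSq (z + s * Complex.I) := by
    rw [Complex.div_im]
    simp
    ring
  rw [Complex.mem_slitPlane_iff, hre, him]
  by_cases hr : z.re = 0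
  · left
    have : A < |z.im| := not_le.1 fun h => hz ⟨hr, h⟩
    refine div_pos ?_ hn
    rw [hr, ← sq_abs z.im]
    nlinarith [abs_nonneg z.im]
  · rcases hs.eq_or_lt with h0 | h0
    · left
      refine div_pos ?_ hn
      rw [← h0]
      have := sq_pos_of_ne_zero hr
      nlinarith [sq_nonneg z.im]
    · right
      exact div_ne_zero (neg_ne_zero.2 (mul_ne_zero (by positivity) hr)) hn.ne'

theorem hasDerivAt_logIntegral (hA : 0 < A) (hρ : IsSpectralDensity A ρ) {z : ℂ}
    (hz : z ∈ segmentCompl A) :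
    HasDerivAt (logIntegral A ρ) (∫ s in (0 : ℝ)..A,
      (1 / (z - s * Complex.I) - 1 / (z + s * Complex.I)) * ρ (s * Complex.I) * Complex.I) z := by
  obtain ⟨r, hr, hrb⟩ := Metric.isOpen_iff.1 (isOpen_segmentCompl A) z hz
  have hcb : Metric.closedBall z (r / 2) ⊆ segmentCompl A :=
    (Metric.closedBall_subset_ball (half_lt_self hr)).trans hrb
  set F' : ℂ → ℝ → ℂ := fun w s =>
    (1 / (w - s * Complex.I) - 1 / (w + s * Complex.I)) * ρ (s * Complex.I) * Complex.I with hF'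
  have hρc : ContinuousOn (fun s : ℝ => ρ (s * Complex.I)) (Icc 0 A) :=
    hρ.continuousOn_segment.mono Icc_subset_Ici_self
  have hρc2 : ContinuousOn (fun p : ℂ × ℝ => ρ (p.2 * Complex.I))
      (Metric.closedBall z (r / 2) ×ˢ Icc 0 A) :=
    hρc.comp continuousOn_snd fun p hp => hp.2
  have hcont : ContinuousOn (Function.uncurry F') (Metric.closedBall z (r / 2) ×ˢ Icc 0 A) := by
    refine ContinuousOn.mul (ContinuousOn.mul (ContinuousOn.sub ?_ ?_) hρc2) continuousOn_const
    · exact ContinuousOn.div continuousOn_const (by fun_prop)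
        fun p hp => (segmentCompl_ne (hcb hp.1) hp.2.1 hp.2.2).1
    · exact ContinuousOn.div continuousOn_const (by fun_prop)
        fun p hp => (segmentCompl_ne (hcb hp.1) hp.2.1 hp.2.2).2
  obtain ⟨B, hB⟩ := ((isCompact_closedBall z (r / 2)).prod isCompact_Icc).exists_bound_of_continuousOn
    hcont
  have hFc : ∀ w ∈ Metric.closedBall z (r / 2), ContinuousOn (fun s : ℝ =>
      Complex.log ((w - s * Complex.I) / (w + s * Complex.I)) * ρ (s * Complex.I) * Complex.I)
      (Icc 0 A) := by
    intro w hw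
    refine ContinuousOn.mul (ContinuousOn.mul ?_ hρc) continuousOn_const
    refine ContinuousOn.clog ?_ fun s hs => segmentCompl_quotient_mem (hcb hw) hs.1 hs.2
    exact ContinuousOn.div (by fun_prop) (by fun_prop)
      fun s hs => (segmentCompl_ne (hcb hw) hs.1 hs.2).2
  have hzb : z ∈ Metric.closedBall z (r / 2) := Metric.mem_closedBall_self (by positivity)
  refine (intervalIntegral.hasDerivAt_integral_of_dominated_loc_of_deriv_le
    (μ := volume) (F' := F') (bound := fun _ => B)
    (Metric.closedBall_mem_nhds z (half_pos hr)) ?_ ?_ ?_ ?_ intervalIntegrable_const ?_).2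
  · filter_upwards [Metric.closedBall_mem_nhds z (half_pos hr)] with w hw
    rw [uIoc_of_le hA.le]
    exact ((hFc w hw).mono Ioc_subset_Icc_self).aestronglyMeasurable measurableSet_Ioc
  · exact (hFc z hzb).intervalIntegrable_of_Icc hA.le
  · rw [uIoc_of_le hA.le]
    refine ContinuousOn.aestronglyMeasurable ?_ measurableSet_Ioc
    exact hcont.comp (f := fun s : ℝ => (z, s)) (by fun_prop)
      fun s hs => ⟨hzb, Ioc_subset_Icc_self hs⟩
  · refine ae_of_all _ fun s hs w hw => ?_
    rw [uIoc_of_le hA.le] at hs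
    exact hB (w, s) ⟨hw, Ioc_subset_Icc_self hs⟩
  · refine ae_of_all _ fun s hs w hw => ?_
    rw [uIoc_of_le hA.le] at hs
    obtain ⟨h1, h2⟩ := segmentCompl_ne (hcb hw) hs.1.le hs.2
    have hq := segmentCompl_quotient_mem (hcb hw) hs.1.le hs.2
    have d1 : HasDerivAt (fun w : ℂ => w - s * Complex.I) 1 w := (hasDerivAt_id w).sub_const _
    have d2 : HasDerivAt (fun w : ℂ => w + s * Complex.I) 1 w := (hasDerivAt_id w).add_const _
    have d3 := (((d1.div d2 h2).clog hq).mul_const (ρ (s * Complex.I))).mul_const Complex.I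
    refine d3.congr_deriv ?_
    simp only [hF', Pi.div_apply]
    field_simp

theorem complexField_eq (hA : 0 ≤ A) {x t : ℝ} {z : ℂ} (hz : 0 ≤ z.im) :
    complexField A ρ x t z = -logIntegral A ρ z -
      (2 * Complex.I * x * z + 2 * Complex.I * t * z ^ 2 + Complex.I * Real.pi *
        (rayIntegral ρ (A * Complex.I) - rayIntegral ρ z)) := by
  rw [complexField, tailIntegral_eq hA hz]
  rfl

theorem hasDerivAt_complexField (hA : 0 < A) (hρ : IsSpectralDensity A ρ) (x t : ℝ) {z : ℂ}
    (hz : z ∈ slitHalfPlane A) :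
    HasDerivAt (complexField A ρ x t) (-(∫ s in (0 : ℝ)..A,
      (1 / (z - s * Complex.I) - 1 / (z + s * Complex.I)) * ρ (s * Complex.I) * Complex.I) -
      (2 * Complex.I * x + 4 * Complex.I * t * z - Complex.I * Real.pi * ρ z)) z := by
  have h1 := hasDerivAt_logIntegral hA hρ (slitHalfPlane_subset_segmentCompl A hz)
  have h2 := hasDerivAt_rayIntegral hρ hz.1
  have h3 : HasDerivAt (fun z : ℂ => 2 * Complex.I * x * z) (2 * Complex.I * x) z := by
    simpa using (hasDerivAt_id z).const_mul (2 * Complex.I * x)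
  have h4 : HasDerivAt (fun z : ℂ => 2 * Complex.I * t * z ^ 2) (2 * Complex.I * t * (2 * z)) z := by
    simpa using (hasDerivAt_pow 2 z).const_mul (2 * Complex.I * t)
  have h5 := h1.neg.sub ((h3.add h4).add
    ((h2.const_sub (rayIntegral ρ (A * Complex.I))).const_mul (Complex.I * Real.pi)))
  refine (h5.congr_of_eventuallyEq ?_).congr_deriv (by ring)
  filter_upwards [isOpen_upperHalf.mem_nhds hz.1] with w hw
  rw [complexField_eq hA.le (le_of_lt hw)]
  rfl

theorem differentiableOn_complexField (hA : 0 < A) (hρ : IsSpectralDensity A ρ) (x t : ℝ) :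
    DifferentiableOn ℂ (complexField A ρ x t) (slitHalfPlane A) := fun _ hz =>
  (hasDerivAt_complexField hA hρ x t hz).differentiableAt.differentiableWithinAt

/-- Up to the boundary, away from the segment, the external field is continuous. -/
theorem continuousWithinAt_externalField (hA : 0 < A) (hρ : IsSpectralDensity A ρ) (x t : ℝ) {z : ℂ}
    (hz : 0 ≤ z.im) (hzA : z ∈ segmentCompl A) :
    ContinuousWithinAt (externalField A ρ x t) {z | 0 ≤ z.im} z := by
  have h1 : ContinuousWithinAt (logIntegral A ρ) {z | 0 ≤ z.im} z :=
    (hasDerivAt_logIntegral hA hρ hzA).continuousAt.continuousWithinAt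
  have h2 := continuousOn_rayIntegral hρ z hz
  have h3 : ContinuousWithinAt (fun z => (-logIntegral A ρ z -
      (2 * Complex.I * x * z + 2 * Complex.I * t * z ^ 2 + Complex.I * Real.pi *
        (rayIntegral ρ (A * Complex.I) - rayIntegral ρ z))).re) {z | 0 ≤ z.im} z := by
    refine Complex.continuous_re.continuousAt.comp_continuousWithinAt ?_
    refine h1.neg.sub (ContinuousWithinAt.add (by fun_prop) ?_)
    exact continuousWithinAt_const.mul (continuousWithinAt_const.sub h2)
  refine h3.congr (fun w hw => ?_) ?_
  · rw [externalField, complexField_eq hA.le hw]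
  · rw [externalField, complexField_eq hA.le hz]

/-- On the real line the external field is `-π ∫_0^ξ Im ρ`. -/
theorem externalField_ofReal (hA : 0 < A) (hρ : IsSpectralDensity A ρ) (x t ξ : ℝ) :
    externalField A ρ x t ξ = -Real.pi * (ξ * ∫ s in (0 : ℝ)..1, (ρ ((s * ξ : ℝ))).im) := by
  have hray : ∀ z : ℂ, 0 ≤ z.im → (rayIntegral ρ z).im = ∫ s in (0 : ℝ)..1, (ρ (s * z) * z).im := by
    intro z hz
    have hi : IntervalIntegrable (fun s : ℝ => ρ (s * z) * z) volume 0 1 :=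
      (((hρ.continuousOn_ray hz).mono Icc_subset_Ici_self).mul
        continuousOn_const).intervalIntegrable_of_Icc zero_le_one
    exact (Complex.imCLM.intervalIntegral_comp_comm hi).symm
  have h1 : (rayIntegral ρ (A * Complex.I)).im = 0 := by
    rw [hray _ (by simpa using hA.le)]
    refine (intervalIntegral.integral_congr fun s hs => ?_).trans intervalIntegral.integral_zero
    rw [uIcc_of_le zero_le_one] at hs
    have h2 := hρ.re_segment (s * A) ⟨mul_nonneg hs.1 hA.le, by nlinarith [hs.2]⟩
    push_cast at h2
    simp [← mul_assoc, h2]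
  have h2 : (rayIntegral ρ ξ).im = ξ * ∫ s in (0 : ℝ)..1, (ρ ((s * ξ : ℝ))).im := by
    rw [hray _ (by simp), ← intervalIntegral.integral_const_mul]
    refine intervalIntegral.integral_congr fun s _ => ?_
    simp [mul_comm]
  -- On the real line the logarithm is imaginary, and so is the density on the segment.
  have h3 : (logIntegral A ρ ξ).re = 0 := by
    have hcongr : logIntegral A ρ ξ = ((∫ s in (0 : ℝ)..A,
        (Complex.log ((ξ - s * Complex.I) / (ξ + s * Complex.I))).im *
          -(ρ (s * Complex.I)).im : ℝ) : ℂ) * Complex.I := by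
      rw [← intervalIntegral.integral_ofReal, ← intervalIntegral.integral_mul_const]
      refine intervalIntegral.integral_congr fun s hs => ?_
      rw [uIcc_of_le hA.le] at hs
      rw [mul_assoc, hρ.segment_mul_I hs.1 hs.2]
      have hn : ‖(ξ - s * Complex.I : ℂ)‖ = ‖(ξ + s * Complex.I : ℂ)‖ := by
        rw [← Complex.norm_conj]
        simp
      have hlog : (Complex.log ((ξ - s * Complex.I) / (ξ + s * Complex.I))).re = 0 := by
        rw [Complex.log_re, norm_div, hn]
        rcases eq_or_ne ‖(ξ + s * Complex.I : ℂ)‖ 0 with h | h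
        · simp [h]
        · simp [div_self h]
      apply Complex.ext <;> simp [hlog]
    rw [hcongr]
    simp
  rw [externalField, complexField_eq hA.le (by simp)]
  have e1 : (2 * Complex.I * x * ξ : ℂ).re = 0 := by simp
  have e2 : (2 * Complex.I * t * ξ ^ 2 : ℂ).re = 0 := by
    rw [← Complex.ofReal_pow]
    simp only [Complex.mul_re, Complex.mul_im, Complex.ofReal_re, Complex.ofReal_im, Complex.I_re,
      Complex.I_im, Complex.re_ofNat, Complex.im_ofNat]
    ring
  have e3 : (Complex.I * Real.pi * (rayIntegral ρ (A * Complex.I) - rayIntegral ρ ξ)).re =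
      -Real.pi * ((rayIntegral ρ (A * Complex.I)).im - (rayIntegral ρ ξ).im) := by
    simp
  rw [Complex.sub_re, Complex.neg_re, Complex.add_re, Complex.add_re, e1, e2, e3, h1, h2, h3]
  ring

theorem integral_im_pos (hρ : IsSpectralDensity A ρ) (ξ : ℝ) :
    0 < ∫ s in (0 : ℝ)..1, (ρ ((s * ξ : ℝ))).im := by
  refine intervalIntegral.intervalIntegral_pos_of_pos_on ?_ (fun s _ => hρ.im_real _) one_pos
  refine ContinuousOn.intervalIntegrable_of_Icc zero_le_one ?_
  refine Complex.continuous_im.comp_continuousOn ?_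
  exact hρ.continuousOn.comp (by fun_prop) fun s _ => by simp

theorem externalField_pos (hA : 0 < A) (hρ : IsSpectralDensity A ρ) (x t : ℝ) {ξ : ℝ} (hξ : ξ < 0) :
    0 < externalField A ρ x t ξ := by
  rw [externalField_ofReal hA hρ]
  have := mul_pos_of_neg_of_neg hξ (neg_neg_of_pos (integral_im_pos hρ ξ))
  nlinarith [Real.pi_pos]

theorem externalField_neg (hA : 0 < A) (hρ : IsSpectralDensity A ρ) (x t : ℝ) {ξ : ℝ} (hξ : 0 < ξ) :
    externalField A ρ x t ξ < 0 := by
  rw [externalField_ofReal hA hρ]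
  have := mul_pos hξ (integral_im_pos hρ ξ)
  nlinarith [Real.pi_pos]

/-! ### The reflection symmetry of the field -/

theorem logIntegral_conj (hA : 0 ≤ A) (hρ : IsSpectralDensity A ρ) {z : ℂ} (hz : z ∈ segmentCompl A) :
    logIntegral A ρ (starRingEnd ℂ z) = -starRingEnd ℂ (logIntegral A ρ z) := by
  unfold logIntegral
  rw [← intervalIntegral_conj, ← intervalIntegral.integral_neg]
  refine intervalIntegral.integral_congr fun s hs => ?_
  rw [uIcc_of_le hA] at hs
  have hq := segmentCompl_quotient_mem hz hs.1 hs.2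
  have harg := Complex.mem_slitPlane_iff_arg.1 hq
  have e : (starRingEnd ℂ z - s * Complex.I) / (starRingEnd ℂ z + s * Complex.I) =
      starRingEnd ℂ (((z - s * Complex.I) / (z + s * Complex.I))⁻¹) := by
    simp [sub_eq_add_neg]
  rw [mul_assoc, mul_assoc, hρ.segment_mul_I hs.1 hs.2, e, map_mul, Complex.conj_ofReal, map_inv₀,
    ← map_inv₀, Complex.log_conj, Complex.log_inv _ harg.1, map_neg, neg_mul]
  intro h
  rw [Complex.arg_inv, if_neg harg.1] at h
  linarith [Complex.neg_pi_lt_arg ((z - s * Complex.I) / (z + s * Complex.I))]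

theorem tailIntegral_conj (hA : 0 ≤ A) (hρ : IsSpectralDensity A ρ) {z : ℂ} (hz : 0 < z.im) :
    tailIntegral A ρ (starRingEnd ℂ z) = starRingEnd ℂ (tailIntegral A ρ z) := by
  unfold tailIntegral
  rw [map_sub, ← intervalIntegral_conj, ← intervalIntegral_conj]
  congr 1
  · refine intervalIntegral.integral_congr fun s hs => ?_
    rw [uIcc_of_le zero_le_one] at hs
    have h1 : 0 ≤ s * A := mul_nonneg hs.1 hA
    have h2 := hρ.segment_mul_I h1 (by nlinarith [hs.2])
    push_cast at h2
    rw [reflectedDensity_of_nonneg (by simpa using h1), ← mul_assoc, ← mul_assoc,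
      mul_right_comm, h2]
    simp
  · refine intervalIntegral.integral_congr_ae (ae_of_all _ fun s hs => ?_)
    rw [uIoc_of_le zero_le_one] at hs
    have h1 : 0 < s * z.im := mul_pos hs.1 hz
    have e : (s : ℂ) * starRingEnd ℂ z = starRingEnd ℂ (s * z) := by simp
    rw [e, reflectedDensity_of_nonneg (z := s * z) (by simpa using h1.le), reflectedDensity,
      if_neg (by simpa using h1), Complex.conj_conj, map_mul]

theorem complexField_conj (hA : 0 < A) (hρ : IsSpectralDensity A ρ) (x t : ℝ) {z : ℂ}
    (hz : z ∈ slitHalfPlane A) :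
    complexField A ρ x t (starRingEnd ℂ z) = -starRingEnd ℂ (complexField A ρ x t z) := by
  have h1 := logIntegral_conj hA.le hρ (slitHalfPlane_subset_segmentCompl A hz)
  have h2 := tailIntegral_conj hA.le hρ hz.1
  have key : ∀ w, complexField A ρ x t w = -logIntegral A ρ w - (2 * Complex.I * x * w +
      2 * Complex.I * t * w ^ 2 + Complex.I * Real.pi * tailIntegral A ρ w) := fun _ => rfl
  rw [key, key, h1, h2]
  simp only [map_sub, map_add, map_mul, map_neg, map_pow, map_ofNat, Complex.conj_I,
    Complex.conj_ofReal]
  ring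

theorem deriv_complexField_conj (hA : 0 < A) (hρ : IsSpectralDensity A ρ) (x t : ℝ) {z : ℂ}
    (hz : z ∈ slitHalfPlane A) :
    deriv (complexField A ρ x t) (starRingEnd ℂ z) =
      -starRingEnd ℂ (deriv (complexField A ρ x t) z) := by
  have h1 := ((hasDerivAt_complexField hA hρ x t hz).conj_conj).neg
  rw [(hasDerivAt_complexField hA hρ x t hz).deriv]
  refine (h1.congr_of_eventuallyEq ?_).deriv
  have hmem : {w : ℂ | starRingEnd ℂ w ∈ slitHalfPlane A} ∈ 𝓝 (starRingEnd ℂ z) :=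
    ((isOpen_slitHalfPlane A).preimage Complex.continuous_conj).mem_nhds (by simpa using hz)
  filter_upwards [hmem] with w hw
  have := complexField_conj hA hρ x t hw
  rw [Complex.conj_conj] at this
  rw [this]
  rfl

end Log

/-! ### The derivative of the field near the origin -/

theorem norm_log_le (w : ℂ) : ‖Complex.log w‖ ≤ |Real.log ‖w‖| + Real.pi := by
  have h := Complex.norm_le_abs_re_add_abs_im (Complex.log w)
  rw [Complex.log_re, Complex.log_im] at h
  exact h.trans (add_le_add le_rfl (Complex.abs_arg_le_pi w))

section Sector

variable {A : ℝ} {ρ : ℂ → ℂ}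

/-- The Cauchy integral of the density over the segment: near the point `i Im z` the density is
replaced by its value there, and the resulting error is controlled by the Cauchy estimate. -/
theorem norm_integral_inv_sub_le (hA : 0 < A) (hρ : IsSpectralDensity A ρ) {M : ℝ}
    (hM : ∀ z : ℂ, 0 ≤ z.im → ‖ρ z‖ ≤ M) {z : ℂ} (hz : 0 < z.im) (hre : z.re ≠ 0) :
    ‖∫ s in (0 : ℝ)..A, 1 / (z - s * Complex.I) * ρ (s * Complex.I) * Complex.I‖ ≤
      4 * M / z.im * A + M * (‖Complex.log (Complex.I * z + A)‖ + ‖Complex.log (Complex.I * z)‖) := by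
  have hM0 : 0 ≤ M := (norm_nonneg _).trans (hM 0 (by simp))
  set c := ρ (z.im * Complex.I) with hc
  have hne : ∀ s : ℝ, z - s * Complex.I ≠ 0 := fun s h => hre (by
    have := congrArg Complex.re h
    simpa using this)
  have hmem : ∀ s : ℝ, Complex.I * z + s ∈ Complex.slitPlane := fun s =>
    Complex.mem_slitPlane_iff.2 (Or.inr (by simpa using hre))
  have hinv : Continuous fun s : ℝ => 1 / (z - s * Complex.I) :=
    continuous_const.div (by fun_prop) hne
  have hlog : ∫ s in (0 : ℝ)..A, 1 / (z - s * Complex.I) * Complex.I =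
      -Complex.log (Complex.I * z + A) + Complex.log (Complex.I * z) := by
    have hint : IntervalIntegrable (fun s : ℝ => 1 / (z - s * Complex.I) * Complex.I) volume 0 A :=
      (hinv.mul continuous_const).intervalIntegrable _ _
    rw [intervalIntegral.integral_eq_sub_of_hasDerivAt
      (f := fun s : ℝ => -Complex.log (Complex.I * z + s)) (fun s _ => ?_) hint]
    · simp
    · have h1 : HasDerivAt (fun s : ℂ => Complex.I * z + s) 1 (s : ℂ) := (hasDerivAt_id _).const_add _
      refine ((h1.clog (hmem s)).neg.comp_ofReal).congr_deriv ?_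
      have e : Complex.I * z + s = Complex.I * (z - s * Complex.I) := by
        linear_combination (s : ℂ) * Complex.I_mul_I
      have := hne s
      rw [e]
      field_simp
      simp [neg_div]
  have hρc : ContinuousOn (fun s : ℝ => ρ (s * Complex.I)) (Icc 0 A) :=
    hρ.continuousOn_segment.mono Icc_subset_Ici_self
  have hsplit : ∫ s in (0 : ℝ)..A, 1 / (z - s * Complex.I) * ρ (s * Complex.I) * Complex.I =
      (∫ s in (0 : ℝ)..A, 1 / (z - s * Complex.I) * (ρ (s * Complex.I) - c) * Complex.I) +
        (-Complex.log (Complex.I * z + A) + Complex.log (Complex.I * z)) * c := by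
    rw [← hlog, ← intervalIntegral.integral_mul_const, ← intervalIntegral.integral_add]
    · refine intervalIntegral.integral_congr fun s _ => ?_
      ring
    · exact ((hinv.continuousOn.mul (hρc.sub continuousOn_const)).mul
        continuousOn_const).intervalIntegrable_of_Icc hA.le
    · exact ((hinv.mul continuous_const).mul continuous_const).intervalIntegrable _ _
  have him : ∀ s : ℝ, |s - z.im| ≤ ‖z - s * Complex.I‖ := fun s => by
    have := Complex.abs_im_le_norm (z - s * Complex.I)
    rw [abs_sub_comm]
    simpa using this
  have hmain : ∀ s : ℝ, 0 ≤ s → ‖ρ (s * Complex.I) - c‖ ≤ 4 * M / z.im * |s - z.im| := by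
    intro s hs
    rcases le_or_gt (z.im / 2) |s - z.im| with h | h
    · have h1 : ‖ρ (s * Complex.I) - c‖ ≤ M + M := (norm_sub_le _ _).trans
        (add_le_add (hM _ (by simpa using hs)) (hM _ (by simpa using hz.le)))
      have h2 : 4 * M / z.im * (z.im / 2) = M + M := by field_simp; ring
      exact h1.trans (h2.symm.le.trans (by gcongr))
    · have h3 := (abs_lt.1 h).1
      have h1 := hρ.norm_sub_le hM (half_pos hz) (z := z.im * Complex.I) (w := s * Complex.I)
        (by simp; linarith) (by simp; linarith)
      refine h1.trans (le_of_eq ?_)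
      rw [← sub_mul, norm_mul, Complex.norm_I, mul_one, ← Complex.ofReal_sub, Complex.norm_real,
        Real.norm_eq_abs]
      field_simp
      ring
  rw [hsplit]
  refine (norm_add_le _ _).trans (add_le_add ?_ ?_)
  · have := intervalIntegral.norm_integral_le_of_norm_le_const (a := 0) (b := A)
      (C := 4 * M / z.im)
      (f := fun s : ℝ => 1 / (z - s * Complex.I) * (ρ (s * Complex.I) - c) * Complex.I) ?_
    · rwa [sub_zero, abs_of_pos hA] at this
    · intro s hs
      rw [uIoc_of_le hA.le] at hs
      rw [norm_mul, norm_mul, norm_div, Complex.norm_I, norm_one, mul_one, one_div,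
        inv_mul_le_iff₀ (norm_pos_iff.2 (hne s))]
      refine (hmain s hs.1.le).trans ?_
      rw [mul_comm]
      gcongr
      exact him s
  · rw [norm_mul, mul_comm]
    have h1 : ‖c‖ ≤ M := hM _ (by simpa using hz.le)
    have h2 := norm_add_le (-Complex.log (Complex.I * z + A)) (Complex.log (Complex.I * z))
    rw [norm_neg] at h2
    gcongr

/-- In a sector at the origin, `V'` grows at most like `1 / |z|`. -/
theorem exists_norm_deriv_complexField_mul_le (hA : 0 < A) (hρ : IsSpectralDensity A ρ) (x t : ℝ)
    {c : ℝ} (hc : 0 < c) : ∃ C, ∀ z ∈ slitHalfPlane A, ‖z‖ ≤ 1 → ‖z‖ ≤ A / 2 → c * ‖z‖ ≤ z.im →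
      ‖deriv (complexField A ρ x t) z‖ * ‖z‖ ≤ C := by
  obtain ⟨M, hM0, hM⟩ := hρ.exists_bound
  set L := |Real.log (A / 2)| + |Real.log (2 * A)| with hL
  refine ⟨4 * M * A / c + M * (L + Real.pi) + M * (1 + Real.pi) + A * M / c + 2 * |x| + 4 * |t| +
    Real.pi * M, fun z hz h1 h2 h3 => ?_⟩
  have hy : 0 < z.im := hz.1
  have hz0 : 0 < ‖z‖ := norm_pos_iff.2 fun h => by simp [h] at hy
  have hyz : z.im ≤ ‖z‖ := (le_abs_self _).trans (Complex.abs_im_le_norm z)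
  have hre : z.re ≠ 0 := fun h => hz.2 ⟨h, by linarith⟩
  have hzc : ‖z‖ / z.im ≤ 1 / c := by
    rw [div_le_div_iff₀ hy hc]
    linarith
  have hρc : ContinuousOn (fun s : ℝ => ρ (s * Complex.I)) (Icc 0 A) :=
    hρ.continuousOn_segment.mono Icc_subset_Ici_self
  have hS := slitHalfPlane_subset_segmentCompl A hz
  have hsplit : ∫ s in (0 : ℝ)..A,
      (1 / (z - s * Complex.I) - 1 / (z + s * Complex.I)) * ρ (s * Complex.I) * Complex.I =
      (∫ s in (0 : ℝ)..A, 1 / (z - s * Complex.I) * ρ (s * Complex.I) * Complex.I) -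
        ∫ s in (0 : ℝ)..A, 1 / (z + s * Complex.I) * ρ (s * Complex.I) * Complex.I := by
    rw [← intervalIntegral.integral_sub]
    · refine intervalIntegral.integral_congr fun s _ => ?_
      ring
    · refine (ContinuousOn.mul (ContinuousOn.mul ?_ hρc)
        continuousOn_const).intervalIntegrable_of_Icc hA.le
      exact continuousOn_const.div (by fun_prop) fun s hs => (segmentCompl_ne hS hs.1 hs.2).1
    · refine (ContinuousOn.mul (ContinuousOn.mul ?_ hρc)
        continuousOn_const).intervalIntegrable_of_Icc hA.le
      exact continuousOn_const.div (by fun_prop) fun s hs => (segmentCompl_ne hS hs.1 hs.2).2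
  have hI2 : ‖∫ s in (0 : ℝ)..A, 1 / (z + s * Complex.I) * ρ (s * Complex.I) * Complex.I‖ ≤
      M / z.im * A := by
    have := intervalIntegral.norm_integral_le_of_norm_le_const (a := 0) (b := A) (C := M / z.im)
      (f := fun s : ℝ => 1 / (z + s * Complex.I) * ρ (s * Complex.I) * Complex.I) ?_
    · rwa [sub_zero, abs_of_pos hA] at this
    · intro s hs
      rw [uIoc_of_le hA.le] at hs
      have e1 : z.im ≤ ‖z + s * Complex.I‖ := by
        have := (le_abs_self _).trans (Complex.abs_im_le_norm (z + s * Complex.I))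
        simp at this
        linarith [hs.1]
      have e2 : ‖ρ (s * Complex.I)‖ ≤ M := hM _ (by simpa using hs.1.le)
      rw [norm_mul, norm_mul, norm_div, Complex.norm_I, norm_one, mul_one, one_div,
        inv_mul_eq_div]
      gcongr
  have hI1 := norm_integral_inv_sub_le hA hρ hM hy hre
  have hIz : ‖Complex.I * z‖ = ‖z‖ := by simp
  have hlog1 : ‖Complex.log (Complex.I * z + A)‖ ≤ L + Real.pi := by
    refine (norm_log_le _).trans (add_le_add ?_ le_rfl)
    have hA' : ‖(A : ℂ)‖ = A := by simp [abs_of_pos hA]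
    have l1 : A / 2 ≤ ‖Complex.I * z + A‖ := by
      have := norm_sub_le (Complex.I * z + A) (Complex.I * z)
      rw [add_sub_cancel_left, hA', hIz] at this
      linarith
    have l2 : ‖Complex.I * z + A‖ ≤ 2 * A := by
      have := norm_add_le (Complex.I * z) A
      rw [hA', hIz] at this
      linarith
    have m1 := Real.log_le_log (by positivity) l1
    have m2 := Real.log_le_log (by linarith) l2
    rw [abs_le]
    constructor
    · linarith [neg_abs_le (Real.log (A / 2)), abs_nonneg (Real.log (2 * A))]
    · linarith [le_abs_self (Real.log (2 * A)), abs_nonneg (Real.log (A / 2))]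
  have hlog2 : ‖Complex.log (Complex.I * z)‖ * ‖z‖ ≤ 1 + Real.pi := by
    have m1 := norm_log_le (Complex.I * z)
    rw [hIz] at m1
    have m2 := (Real.abs_log_mul_self_lt ‖z‖ hz0 h1).le
    rw [abs_mul, abs_of_pos hz0] at m2
    calc _ ≤ (|Real.log ‖z‖| + Real.pi) * ‖z‖ := by gcongr
      _ = |Real.log ‖z‖| * ‖z‖ + Real.pi * ‖z‖ := by ring
      _ ≤ 1 + Real.pi * 1 := by gcongr
      _ = _ := by ring
  rw [(hasDerivAt_complexField hA hρ x t hz).deriv, hsplit]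
  set I1 := ∫ s in (0 : ℝ)..A, 1 / (z - s * Complex.I) * ρ (s * Complex.I) * Complex.I
  set I2 := ∫ s in (0 : ℝ)..A, 1 / (z + s * Complex.I) * ρ (s * Complex.I) * Complex.I
  have hb1 : ‖I1‖ * ‖z‖ ≤ 4 * M * A / c + M * (L + Real.pi) + M * (1 + Real.pi) := by
    calc ‖I1‖ * ‖z‖ ≤ (4 * M / z.im * A + M * (‖Complex.log (Complex.I * z + A)‖ +
            ‖Complex.log (Complex.I * z)‖)) * ‖z‖ := by gcongr
      _ = 4 * M * A * (‖z‖ / z.im) + M * (‖Complex.log (Complex.I * z + A)‖ * ‖z‖) +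
            M * (‖Complex.log (Complex.I * z)‖ * ‖z‖) := by ring
      _ ≤ 4 * M * A * (1 / c) + M * ((L + Real.pi) * 1) + M * (1 + Real.pi) := by gcongr
      _ = _ := by ring
  have hb2 : ‖I2‖ * ‖z‖ ≤ A * M / c := by
    calc ‖I2‖ * ‖z‖ ≤ M / z.im * A * ‖z‖ := by gcongr
      _ = A * M * (‖z‖ / z.im) := by ring
      _ ≤ A * M * (1 / c) := by gcongr
      _ = _ := by ring
  have hb3 : ‖2 * Complex.I * x + 4 * Complex.I * t * z - Complex.I * Real.pi * ρ z‖ ≤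
      2 * |x| + 4 * |t| + Real.pi * M := by
    have n1 : ‖2 * Complex.I * x‖ = 2 * |x| := by simp
    have n2 : ‖4 * Complex.I * t * z‖ ≤ 4 * |t| * 1 := by
      have : ‖4 * Complex.I * t * z‖ = 4 * |t| * ‖z‖ := by simp
      rw [this]; gcongr
    have n3 : ‖Complex.I * Real.pi * ρ z‖ ≤ Real.pi * M := by
      have : ‖Complex.I * Real.pi * ρ z‖ = Real.pi * ‖ρ z‖ := by simp [abs_of_pos Real.pi_pos]
      rw [this]
      have := hM z hy.le
      gcongr
    refine (norm_sub_le _ _).trans (add_le_add ((norm_add_le _ _).trans ?_) n3)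
    linarith
  have hb4 : ‖2 * Complex.I * x + 4 * Complex.I * t * z - Complex.I * Real.pi * ρ z‖ * ‖z‖ ≤
      2 * |x| + 4 * |t| + Real.pi * M := by
    calc _ ≤ (2 * |x| + 4 * |t| + Real.pi * M) * 1 := by gcongr
      _ = _ := mul_one _
  have htri : ‖-(I1 - I2) - (2 * Complex.I * x + 4 * Complex.I * t * z -
      Complex.I * Real.pi * ρ z)‖ ≤ ‖I1‖ + ‖I2‖ + ‖2 * Complex.I * x + 4 * Complex.I * t * z -
      Complex.I * Real.pi * ρ z‖ := by
    refine (norm_sub_le _ _).trans (add_le_add ?_ le_rfl)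
    rw [norm_neg]
    exact norm_sub_le _ _
  have := mul_le_mul_of_nonneg_right htri hz0.le
  linarith [add_mul (‖I1‖ + ‖I2‖) ‖2 * Complex.I * x + 4 * Complex.I * t * z -
      Complex.I * Real.pi * ρ z‖ ‖z‖, add_mul ‖I1‖ ‖I2‖ ‖z‖]

end Sector

/-! ### The location of the equilibrium measure -/

section Continuum

variable {A : ℝ} {Γ : Set (SlitClosure A)}

theorem im_nonneg_of_mem_finitePart {z : ℂ} (hz : z ∈ finitePart Γ) : 0 ≤ z.im := by
  obtain ⟨p, -, hpz⟩ := hz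
  rcases p.2 with h | ⟨z', w, h, h1, -⟩
  · have : p.point = OnePoint.infty := congrArg Prod.fst h
    rw [this] at hpz
    exact absurd hpz (OnePoint.infty_ne_coe z)
  · have : p.point = (z' : OnePoint ℂ) := congrArg Prod.fst h
    rw [this, OnePoint.coe_eq_coe] at hpz
    rwa [← hpz]

theorem IsContinuum.isCompact_image_point (hΓ : IsContinuum Γ) :
    IsCompact (SlitClosure.point '' Γ) :=
  hΓ.isCompact.image (continuous_fst.comp continuous_subtype_val)

theorem finitePart_eq_preimage : finitePart Γ = (fun z : ℂ => (z : OnePoint ℂ)) ⁻¹'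
    (SlitClosure.point '' Γ) := rfl

theorem IsContinuum.isClosed_finitePart (hΓ : IsContinuum Γ) : IsClosed (finitePart Γ) := by
  rw [finitePart_eq_preimage]
  exact hΓ.isCompact_image_point.isClosed.preimage OnePoint.continuous_coe

theorem IsContinuum.isCompact_finitePart (hΓ : IsContinuum Γ) (h : ¬ ContainsInfty Γ) :
    IsCompact (finitePart Γ) := by
  have h1 : (fun z : ℂ => (z : OnePoint ℂ)) '' finitePart Γ = SlitClosure.point '' Γ := by
    rw [finitePart_eq_preimage, image_preimage_eq_iff]
    rintro _ ⟨p, hp, rfl⟩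
    have hne : p.point ≠ OnePoint.infty := fun h2 => h ⟨p, hp, h2⟩
    obtain ⟨z, hz⟩ := OnePoint.ne_infty_iff_exists.1 hne
    exact ⟨z, hz⟩
  have h2 := hΓ.isCompact_image_point.isClosed
  rw [← h1] at h2
  exact (OnePoint.isClosed_image_coe.1 h2).2

end Continuum

section Minimiser

variable {V : ℂ → ℂ} {F : Set ℂ} {lam ν : Measure ℂ}

theorem HasFiniteEnergy.restrict (hν : HasFiniteEnergy ν) (B : Set ℂ) :
    HasFiniteEnergy (ν.restrict B) := by
  have := hν.finite
  refine ⟨inferInstance, ae_restrict_of_ae hν.upper, ?_⟩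
  refine ((lintegral_mono' Measure.restrict_le_self fun u => ?_).trans_lt
    (lt_top_iff_ne_top.2 hν.energy)).ne
  exact lintegral_mono' Measure.restrict_le_self le_rfl

theorem IsCarriedEnergyMeasure.restrict (hν : IsCarriedEnergyMeasure V F ν) (B : Set ℂ) :
    IsCarriedEnergyMeasure V F (ν.restrict B) :=
  ⟨hν.energy.restrict B, Measure.absolutelyContinuous_of_le Measure.restrict_le_self hν.carried,
    hν.integrable.restrict⟩

/-- A minimiser does not charge sets on which the field is positive: removing the charge would lower
the energy. -/
theorem measure_eq_zero_of_field_pos (hl : IsCarriedEnergyMeasure V F lam)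
    (hmin : ∀ ν, IsCarriedEnergyMeasure V F ν → fieldEnergy V lam ≤ fieldEnergy V ν)
    {B : Set ℂ} (hB : MeasurableSet B) (hpos : ∀ z ∈ B, 0 ≤ z.im → 0 < (V z).re) : lam B = 0 := by
  have := hl.energy.finite
  obtain ⟨h1, -⟩ := mutualEnergy_add_field_nonneg hl hmin (hl.restrict B)
  obtain ⟨h2, h0⟩ := mutualEnergy_add_field_nonneg hl hmin (hl.restrict Bᶜ)
  have e1 : (greenEnergy lam).toReal = (mutualEnergy lam (lam.restrict B)).toReal +
      (mutualEnergy lam (lam.restrict Bᶜ)).toReal := by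
    rw [← ENNReal.toReal_add (hl.energy.mutualEnergy_ne_top (hl.energy.restrict B))
      (hl.energy.mutualEnergy_ne_top (hl.energy.restrict Bᶜ)), ← mutualEnergy_add_right,
      Measure.restrict_add_restrict_compl hB, mutualEnergy_self]
  have e2 := integral_add_compl hB hl.integrable
  have e3 : 0 ≤ (mutualEnergy lam (lam.restrict B)).toReal := ENNReal.toReal_nonneg
  have h3 : ∫ z in B, (V z).re ∂lam ≤ 0 := by linarith
  have hae : ∀ᵐ z ∂lam.restrict B, 0 < (V z).re := by
    filter_upwards [ae_restrict_mem hB, ae_restrict_of_ae hl.energy.upper] with z hz hz'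
    exact hpos z hz hz'
  have hnn : 0 ≤ᵐ[lam.restrict B] fun z => (V z).re := by
    filter_upwards [hae] with z hz using hz.le
  have h4 := (integral_eq_zero_iff_of_nonneg_ae hnn hl.integrable.restrict).1
    (le_antisymm h3 (integral_nonneg_of_ae hnn))
  have h5 : ∀ᵐ z ∂lam.restrict B, False := by
    filter_upwards [hae, h4] with z hz hz'
    exact hz.ne' hz'
  rwa [eventually_false_iff_eq_bot, ae_eq_bot, Measure.restrict_eq_zero] at h5

theorem mutualEnergy_dirac_ofReal (lam : Measure ℂ) (ξ : ℝ) :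
    mutualEnergy lam (Measure.dirac (ξ : ℂ)) = 0 := by
  have h : ∀ u : ℂ, greenFunction u ξ = 0 := fun u => by
    rw [greenFunction_comm, greenFunction_of_im_eq_zero (by simp)]
  unfold mutualEnergy
  have h2 : ∀ u : ℂ, ∫⁻ v, greenFunction u v ∂Measure.dirac (ξ : ℂ) = 0 := fun u => by
    rw [lintegral_dirac' _ (measurable_greenFunction_right u), h]
  simp [h2]

/-- If the energy has a minimiser among the measures carried by `F`, then the field is nonnegative
at the real points of `F`: a real point mass has no Green energy, so at a point of negative field its
multiples would have energies unbounded below. -/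
theorem field_ofReal_nonneg (hl : IsCarriedEnergyMeasure V F lam)
    (hmin : ∀ ν, IsCarriedEnergyMeasure V F ν → fieldEnergy V lam ≤ fieldEnergy V ν)
    (hF : MeasurableSet F) {ξ : ℝ} (hξ : (ξ : ℂ) ∈ F) : 0 ≤ (V ξ).re := by
  have hδ : IsCarriedEnergyMeasure V F (Measure.dirac (ξ : ℂ)) := by
    refine ⟨⟨inferInstance, ?_, ?_⟩, ?_, ?_⟩
    · rw [ae_dirac_eq]
      simp
    · rw [← mutualEnergy_self, mutualEnergy_dirac_ofReal]
      simp
    · rw [Measure.dirac_apply' _ hF.compl]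
      simpa using hξ
    · exact integrable_dirac (by simp)
  have h := (mutualEnergy_add_field_nonneg hl hmin hδ).1
  rwa [mutualEnergy_dirac_ofReal, ENNReal.toReal_zero, zero_add, integral_dirac] at h

end Minimiser

section Equilibrium

variable {A : ℝ} {ρ : ℂ → ℂ} {x t : ℝ} {Γ : Set (SlitClosure A)} {F : Set ℂ} {lam ν : Measure ℂ}

theorem isAdmissibleMeasure_iff (hF : F ⊆ {z | 0 ≤ z.im}) : IsAdmissibleMeasure A ρ x t F ν ↔
    IsCarriedEnergyMeasure (complexField A ρ x t) F ν :=
  ⟨fun h => ⟨⟨h.finite, by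
      rw [ae_iff]
      exact measure_mono_null (fun z hz hzF => hz (hF hzF)) h.carried, h.energy⟩,
    h.carried, h.integrable⟩,
    fun h => ⟨h.energy.finite, h.carried, h.energy.energy, h.integrable⟩⟩

/-- An equilibrium measure of a continuum is carried by a closed part of it that meets the real line
at most at `0`: near the negative half-line the field is positive, and the positive half-line, where
the field is negative, does not meet the continuum. -/
theorem exists_isClosed_carrier (hA : 0 < A) (hρ : IsSpectralDensity A ρ) (hΓ : IsContinuum Γ)
    (hslit : MeetsSlitOnlyAtZero Γ) (hl : IsCarriedEnergyMeasure (complexField A ρ x t) (finitePart Γ) lam)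
    (hmin : ∀ ν, IsCarriedEnergyMeasure (complexField A ρ x t) (finitePart Γ) ν →
      fieldEnergy (complexField A ρ x t) lam ≤ fieldEnergy (complexField A ρ x t) ν) :
    ∃ S ⊆ finitePart Γ, IsClosed S ∧ lam Sᶜ = 0 ∧ ∀ z ∈ S, z = 0 ∨ z ∈ slitHalfPlane A := by
  have hcl := hΓ.isClosed_finitePart
  set W : Set ℂ := interior {z | 0 ≤ z.im → 0 < externalField A ρ x t z} with hW
  have hWpos : ∀ z ∈ W, 0 ≤ z.im → 0 < (complexField A ρ x t z).re := fun z hz =>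
    interior_subset hz
  have hneg : ∀ ξ : ℝ, ξ < 0 → (ξ : ℂ) ∈ W := by
    intro ξ hξ
    rw [hW, mem_interior_iff_mem_nhds]
    have h1 := continuousWithinAt_externalField hA hρ x t (z := ξ) (by simp)
      fun h => hξ.ne (by simpa using h.1)
    exact eventually_nhdsWithin_iff.1
      (h1.tendsto.eventually_const_lt (externalField_pos hA hρ x t hξ))
  refine ⟨finitePart Γ \ W, sdiff_subset, hcl.sdiff isOpen_interior, ?_, ?_⟩
  · rw [sdiff_eq, compl_inter, compl_compl, measure_union_null_iff]
    exact ⟨hl.carried, measure_eq_zero_of_field_pos hl hmin isOpen_interior.measurableSet hWpos⟩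
  · rintro z ⟨hz, hzW⟩
    rcases (im_nonneg_of_mem_finitePart hz).eq_or_lt with h0 | h0
    · left
      have hzr : z = (z.re : ℂ) := Complex.ext (by simp) (by simp [← h0])
      rcases lt_trichotomy z.re 0 with h | h | h
      · exact absurd (hzr ▸ hneg _ h) hzW
      · rw [hzr, h, Complex.ofReal_zero]
      · have h1 := field_ofReal_nonneg hl hmin hcl.measurableSet (hzr ▸ hz)
        exact absurd h1 (not_le.2 (externalField_neg hA hρ x t h))
    · right
      refine ⟨h0, fun h => ?_⟩
      have hzi : z = (z.im : ℂ) * Complex.I := Complex.ext (by simp [h.1]) (by simp)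
      have := hslit z.im h0.le h.2 (hzi ▸ hz)
      exact h0.ne' this

/-- Criticality in the form of the vanishing of the first variation of the energy of the equilibrium
measure. -/
theorem IsCritical.energyVariation_eq_zero (hA : 0 < A) (hρ : IsSpectralDensity A ρ)
    (hcrit : IsCritical A ρ x t Γ)
    (hl : IsCarriedEnergyMeasure (complexField A ρ x t) (finitePart Γ) lam)
    (hmin : ∀ ν, IsCarriedEnergyMeasure (complexField A ρ x t) (finitePart Γ) ν →
      fieldEnergy (complexField A ρ x t) lam ≤ fieldEnergy (complexField A ρ x t) ν)
    {k : ℂ → ℂ} (hk : ContDiff ℝ 1 k) (hc : HasCompactSupport k)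
    (hs : tsupport k ⊆ slitHalfPlane A) : energyVariation (complexField A ρ x t) k lam = 0 := by
  obtain ⟨C, τ₀, hb⟩ := exists_flowBounds (isOpen_slitHalfPlane A) (slitHalfPlane_subset A)
    (differentiableOn_complexField hA hρ x t) hk hc hs
  have hF : finitePart Γ ⊆ {z | 0 ≤ z.im} := fun z hz => im_nonneg_of_mem_finitePart hz
  obtain ⟨e, he, hder⟩ := hb.exists_hasDerivAt hF hl hmin
  refine hcrit k hk hc hs e ?_ _ hder
  have hsmall : ∀ᶠ τ : ℝ in 𝓝 0, |τ| < τ₀ := by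
    have : Tendsto (fun τ : ℝ => |τ|) (𝓝 0) (𝓝 |0|) := continuous_abs.tendsto 0
    rw [abs_zero] at this
    exact this.eventually_lt_const hb.pos'
  filter_upwards [he, hsmall] with τ h1 h2
  have hF' : flow k τ '' finitePart Γ ⊆ {z | 0 ≤ z.im} := by
    rintro _ ⟨z, hz, rfl⟩
    exact hb.im_nonneg h2.le (hF hz)
  unfold IsEquilibriumEnergy
  convert h1 using 1
  ext r
  exact exists_congr fun ν => and_congr_left fun _ => isAdmissibleMeasure_iff hF'

end Equilibrium

/-! ### From compactly supported to Lipschitz fields -/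

theorem exists_contDiff_cutoff {s U : Set ℂ} (hs : IsClosed s) (hU : IsOpen U) (hsU : s ⊆ U) :
    ∃ χ : ℂ → ℝ, ContDiff ℝ 1 χ ∧ (∀ᶠ z in 𝓝ˢ s, χ z = 1) ∧ tsupport χ ⊆ U := by
  obtain ⟨f, h0, h1, -⟩ := exists_contMDiffMap_zero_one_nhds_of_isClosed (n := 1)
    (modelWithCornersSelf ℝ ℂ) hU.isClosed_compl hs
    (disjoint_compl_left_iff_subset.2 hsU)
  refine ⟨f, f.contMDiff.contDiff, h1, fun z hz => ?_⟩
  by_contra hzU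
  exact notMem_tsupport_iff_eventuallyEq.2 (h0.filter_mono (nhds_le_nhdsSet hzU)) hz

/-- A smooth radial function, `1` on the unit disc and `0` outside the disc of radius `2`. -/
noncomputable def radialCutoff (z : ℂ) : ℝ := Real.smoothTransition (2 - ‖z‖ ^ 2)

theorem contDiff_radialCutoff : ContDiff ℝ 1 radialCutoff :=
  Real.smoothTransition.contDiff.comp (contDiff_const.sub (contDiff_norm_sq ℝ))

theorem radialCutoff_eq_one {z : ℂ} (hz : ‖z‖ ≤ 1) : radialCutoff z = 1 :=
  Real.smoothTransition.one_of_one_le (by nlinarith [norm_nonneg z])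

theorem radialCutoff_eq_zero {z : ℂ} (hz : 2 ≤ ‖z‖) : radialCutoff z = 0 :=
  Real.smoothTransition.zero_of_nonpos (by nlinarith [norm_nonneg z])

theorem radialCutoff_nonneg (z : ℂ) : 0 ≤ radialCutoff z := Real.smoothTransition.nonneg _

theorem radialCutoff_le_one (z : ℂ) : radialCutoff z ≤ 1 := Real.smoothTransition.le_one _

theorem exists_radialCutoff_lipschitz :
    ∃ L, 0 ≤ L ∧ ∀ z w : ℂ, |radialCutoff z - radialCutoff w| ≤ L * ‖z - w‖ := by
  have hc : HasCompactSupport radialCutoff := by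
    refine HasCompactSupport.of_support_subset_isCompact (isCompact_closedBall (0 : ℂ) 2)
      fun z hz => ?_
    rw [mem_closedBall_zero_iff]
    by_contra h
    exact hz (radialCutoff_eq_zero (not_le.1 h).le)
  obtain ⟨L, hL⟩ := contDiff_radialCutoff.lipschitzWith_of_hasCompactSupport hc one_ne_zero
  exact ⟨L, L.2, fun z w => by simpa [Real.norm_eq_abs] using hL.norm_sub_le z w⟩

/-- The factor `|v|` compensates for the Lipschitz constant of the rescaled cutoff, which is of order
`r`: the cutoff varies only where `|v|` is of order `1 / r`. -/
theorem abs_radialCutoff_smul_sub_mul_le {L : ℝ} (hL0 : 0 ≤ L)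
    (hL : ∀ z w : ℂ, |radialCutoff z - radialCutoff w| ≤ L * ‖z - w‖) {r : ℝ} (hr : 0 < r) {u v : ℂ}
    (huv : ‖v‖ ≤ ‖u‖) :
    |radialCutoff (r * u) - radialCutoff (r * v)| * ‖v‖ ≤ 2 * L * ‖u - v‖ := by
  have hn : ∀ w : ℂ, ‖(r : ℂ) * w‖ = r * ‖w‖ := fun w => by simp [abs_of_pos hr]
  rcases le_or_gt 2 (r * ‖v‖) with h | h
  · rw [radialCutoff_eq_zero (z := r * v) (by rw [hn]; exact h),
      radialCutoff_eq_zero (z := r * u) (by rw [hn]; exact h.trans (by gcongr))]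
    simp only [sub_self, abs_zero, zero_mul]
    positivity
  · have h1 := hL (r * u) (r * v)
    rw [← mul_sub, hn] at h1
    calc _ ≤ L * (r * ‖u - v‖) * ‖v‖ := by gcongr
      _ = L * ‖u - v‖ * (r * ‖v‖) := by ring
      _ ≤ L * ‖u - v‖ * 2 := by gcongr
      _ = _ := by ring

/-- A smooth cutoff, `1` on the annulus `2 / r ≤ |z| ≤ r` and `0` off `1 / r ≤ |z| ≤ 2 r`. -/
noncomputable def annulusCutoff (r : ℝ) (z : ℂ) : ℝ :=
  (1 - radialCutoff (r * z)) * radialCutoff ((r⁻¹ : ℝ) * z)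

theorem contDiff_annulusCutoff (r : ℝ) : ContDiff ℝ 1 (annulusCutoff r) := by
  have h : ∀ s : ℝ, ContDiff ℝ 1 fun z : ℂ => radialCutoff (s * z) := fun s =>
    contDiff_radialCutoff.comp (contDiff_const.mul contDiff_id)
  exact (contDiff_const.sub (h r)).mul (h r⁻¹)

theorem annulusCutoff_conj (r : ℝ) (z : ℂ) :
    annulusCutoff r (starRingEnd ℂ z) = annulusCutoff r z := by
  simp [annulusCutoff, radialCutoff]

theorem abs_annulusCutoff_le_one (r : ℝ) (z : ℂ) : |annulusCutoff r z| ≤ 1 := by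
  have h1 := radialCutoff_nonneg (r * z)
  have h2 := radialCutoff_le_one (r * z)
  have h3 := radialCutoff_nonneg ((r⁻¹ : ℝ) * z)
  have h4 := radialCutoff_le_one ((r⁻¹ : ℝ) * z)
  rw [annulusCutoff, abs_of_nonneg (mul_nonneg (by linarith) h3)]
  exact mul_le_one₀ (by linarith) h3 h4

theorem norm_mem_of_annulusCutoff_ne_zero {r : ℝ} (hr : 0 < r) {z : ℂ}
    (h : annulusCutoff r z ≠ 0) : r⁻¹ ≤ ‖z‖ ∧ ‖z‖ ≤ 2 * r := by
  have hn : ∀ s : ℝ, 0 < s → ‖(s : ℂ) * z‖ = s * ‖z‖ := fun s hs => by simp [abs_of_pos hs]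
  constructor
  · by_contra h1
    refine h ?_
    rw [annulusCutoff, radialCutoff_eq_one, sub_self, zero_mul]
    rw [hn r hr]
    have := mul_lt_mul_of_pos_left (not_le.1 h1) hr
    rw [mul_inv_cancel₀ hr.ne'] at this
    exact this.le
  · by_contra h1
    refine h ?_
    rw [annulusCutoff, radialCutoff_eq_zero (z := (r⁻¹ : ℝ) * z), mul_zero]
    rw [hn r⁻¹ (by positivity), le_inv_mul_iff₀ hr]
    linarith

theorem annulusCutoff_eq_one {r : ℝ} (hr : 0 < r) {z : ℂ} (h1 : 2 ≤ r * ‖z‖) (h2 : ‖z‖ ≤ r) :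
    annulusCutoff r z = 1 := by
  have hn : ∀ s : ℝ, 0 < s → ‖(s : ℂ) * z‖ = s * ‖z‖ := fun s hs => by simp [abs_of_pos hs]
  rw [annulusCutoff, radialCutoff_eq_zero (by rw [hn r hr]; exact h1), radialCutoff_eq_one]
  · ring
  · rw [hn _ (by positivity), inv_mul_le_iff₀ hr]
    linarith

/-- Cutting a Lipschitz field that vanishes at the origin off to annuli costs only a constant factor
in the Lipschitz constant, uniformly in the annulus. -/
theorem exists_lipschitz_annulusCutoff_mul {k : ℂ → ℂ} {L : NNReal} (hk : LipschitzWith L k)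
    (h0 : k 0 = 0) : ∃ L' : NNReal, ∀ r : ℝ, 0 < r →
      LipschitzWith L' fun z => (annulusCutoff r z : ℂ) * k z := by
  obtain ⟨Λ, hΛ0, hΛ⟩ := exists_radialCutoff_lipschitz
  have hkn : ∀ z, ‖k z‖ ≤ L * ‖z‖ := fun z => by simpa [h0] using hk.norm_sub_le z 0
  have key : ∀ r : ℝ, 0 < r → ∀ u v : ℂ, ‖v‖ ≤ ‖u‖ →
      ‖(annulusCutoff r u : ℂ) * k u - annulusCutoff r v * k v‖ ≤ (L + 4 * Λ * L) * ‖u - v‖ := by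
    intro r hr u v huv
    have e : (annulusCutoff r u : ℂ) * k u - annulusCutoff r v * k v =
        annulusCutoff r u * (k u - k v) + ((annulusCutoff r u - annulusCutoff r v : ℝ) : ℂ) * k v := by
      push_cast; ring
    have h1 : |annulusCutoff r u - annulusCutoff r v| ≤
        |radialCutoff (r * u) - radialCutoff (r * v)| +
          |radialCutoff ((r⁻¹ : ℝ) * u) - radialCutoff ((r⁻¹ : ℝ) * v)| := by
      set a := radialCutoff (r * u)
      set b := radialCutoff (r * v)
      set a' := radialCutoff ((r⁻¹ : ℝ) * u)
      set b' := radialCutoff ((r⁻¹ : ℝ) * v)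
      have ha : |1 - b| ≤ 1 := by
        have := radialCutoff_nonneg (r * v)
        have := radialCutoff_le_one (r * v)
        rw [abs_le]; constructor <;> linarith
      have hb : |a'| ≤ 1 := by
        have := radialCutoff_nonneg ((r⁻¹ : ℝ) * u)
        have := radialCutoff_le_one ((r⁻¹ : ℝ) * u)
        rw [abs_le]; constructor <;> linarith
      have e2 : annulusCutoff r u - annulusCutoff r v = -(a - b) * a' + (1 - b) * (a' - b') := by
        simp only [annulusCutoff]; ring
      rw [e2]
      refine (abs_add_le _ _).trans ?_
      rw [abs_mul, abs_mul, abs_neg]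
      have := mul_le_mul_of_nonneg_left hb (abs_nonneg (a - b))
      have := mul_le_mul_of_nonneg_right ha (abs_nonneg (a' - b'))
      linarith
    have h2 := abs_radialCutoff_smul_sub_mul_le hΛ0 hΛ hr huv
    have h3 := abs_radialCutoff_smul_sub_mul_le hΛ0 hΛ (inv_pos.2 hr) huv
    have h4 : |annulusCutoff r u - annulusCutoff r v| * ‖v‖ ≤ 4 * Λ * ‖u - v‖ := by
      have := mul_le_mul_of_nonneg_right h1 (norm_nonneg v)
      linarith [add_mul |radialCutoff (r * u) - radialCutoff (r * v)|
        |radialCutoff ((r⁻¹ : ℝ) * u) - radialCutoff ((r⁻¹ : ℝ) * v)| ‖v‖]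
    rw [e]
    refine (norm_add_le _ _).trans ?_
    rw [norm_mul, norm_mul, Complex.norm_real, Complex.norm_real, Real.norm_eq_abs,
      Real.norm_eq_abs]
    have h5 : |annulusCutoff r u| * ‖k u - k v‖ ≤ 1 * (L * ‖u - v‖) := by
      have := abs_annulusCutoff_le_one r u
      have := hk.norm_sub_le u v
      gcongr
    have h6 : |annulusCutoff r u - annulusCutoff r v| * ‖k v‖ ≤ L * (4 * Λ * ‖u - v‖) := by
      calc _ ≤ |annulusCutoff r u - annulusCutoff r v| * (L * ‖v‖) := by
            gcongr; exact hkn v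
        _ = L * (|annulusCutoff r u - annulusCutoff r v| * ‖v‖) := by ring
        _ ≤ _ := by gcongr
    linarith
  refine ⟨⟨L + 4 * Λ * L, by positivity⟩, fun r hr => LipschitzWith.of_dist_le_mul fun u v => ?_⟩
  rw [dist_eq_norm, dist_eq_norm]
  rcases le_total ‖v‖ ‖u‖ with h | h
  · exact key r hr u v h
  · have := key r hr v u h
    rwa [norm_sub_rev, norm_sub_rev v u] at this

/-- For a field symmetric under reflection the reflected slope is an ordinary slope. -/
theorem norm_variationKernel_le {k : ℂ → ℂ} {L : NNReal} (hk : LipschitzWith L k)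
    (hconj : ∀ z, k (starRingEnd ℂ z) = starRingEnd ℂ (k z)) (u v : ℂ) :
    ‖variationKernel k u v‖ ≤ 2 * L := by
  have h1 := norm_slope_le hk u v
  have h2 := norm_slope_le hk u (starRingEnd ℂ v)
  rw [hconj] at h2
  exact (norm_sub_le _ _).trans (by linarith)

/-- If the first variation of the energy vanishes for all fields with compact support in `Ω`, it
vanishes for Lipschitz fields, symmetric under reflection and zero at the origin, when the measure is
carried by a closed part of `Ω ∪ {0}`. -/
theorem energyVariation_eq_zero_of_lipschitz {V : ℂ → ℂ} {Ω S : Set ℂ} {lam : Measure ℂ}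
    [IsFiniteMeasure lam] (hΩ : IsOpen Ω) (hS : IsClosed S) (hlS : lam Sᶜ = 0)
    (hSΩ : ∀ z ∈ S, z = 0 ∨ z ∈ Ω)
    (hvar : ∀ k : ℂ → ℂ, ContDiff ℝ 1 k → HasCompactSupport k → tsupport k ⊆ Ω →
      energyVariation V k lam = 0)
    {k : ℂ → ℂ} {L : NNReal} (hk : ContDiff ℝ 1 k) (hL : LipschitzWith L k) (h0 : k 0 = 0)
    (hconj : ∀ z, k (starRingEnd ℂ z) = starRingEnd ℂ (k z))
    (hint : Integrable (fun u => deriv V u * k u) lam) : energyVariation V k lam = 0 := by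
  obtain ⟨L', hL'⟩ := exists_lipschitz_annulusCutoff_mul hL h0
  set g : ℕ → ℂ → ℂ := fun n z => (annulusCutoff (n + 1) z : ℂ) * k z with hg
  have hpos : ∀ n : ℕ, (0 : ℝ) < n + 1 := fun n => by positivity
  have hae : ∀ᵐ u ∂lam, u ∈ S := by rw [ae_iff]; exact hlS
  have hae2 : ∀ᵐ z : ℂ × ℂ ∂lam.prod lam, z.1 ∈ S ∧ z.2 ∈ S :=
    (Measure.quasiMeasurePreserving_fst.ae hae).and (Measure.quasiMeasurePreserving_snd.ae hae)
  have hg0 : ∀ n, energyVariation V (g n) lam = 0 := by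
    intro n
    set r : ℝ := n + 1 with hr
    have hr0 : 0 < r := hpos n
    have hCcl : IsClosed (S ∩ {z | r⁻¹ ≤ ‖z‖}) :=
      hS.inter (isClosed_le continuous_const continuous_norm)
    have hCΩ : S ∩ {z | r⁻¹ ≤ ‖z‖} ⊆ Ω := by
      rintro z ⟨hz, hz'⟩
      refine (hSΩ z hz).resolve_left fun h => ?_
      have h2 : r⁻¹ ≤ ‖z‖ := hz'
      rw [h, norm_zero] at h2
      exact (inv_pos.2 hr0).not_ge h2
    -- A further cutoff puts the support into `Ω` and changes nothing on `S`.
    obtain ⟨ψ, hψ, hψ1, hψs⟩ := exists_contDiff_cutoff hCcl hΩ hCΩ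
    set f : ℂ → ℂ := fun z => ψ z • g n z with hf
    have hgd : ContDiff ℝ 1 (g n) :=
      (Complex.ofRealCLM.contDiff.comp (contDiff_annulusCutoff _)).mul hk
    have hfS : ∀ z ∈ S, f z = g n z := by
      intro z hz
      by_cases ha : annulusCutoff r z = 0
      · simp [hf, hg, ← hr, ha]
      · have h1 := (norm_mem_of_annulusCutoff_ne_zero hr0 ha).1
        have h2 : ψ z = 1 := hψ1.self_of_nhdsSet z ⟨hz, h1⟩
        simp [hf, h2]
    have hfc : HasCompactSupport f := by
      refine HasCompactSupport.of_support_subset_isCompact (isCompact_closedBall (0 : ℂ) (2 * r))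
        fun z hz => ?_
      rw [mem_closedBall_zero_iff]
      refine (norm_mem_of_annulusCutoff_ne_zero hr0 fun h => hz ?_).2
      simp [hf, hg, ← hr, h]
    have hfv := hvar f (hψ.smul hgd) hfc ((tsupport_smul_subset_left ψ (g n)).trans hψs)
    have e1 : ∫ z, (variationKernel (g n) z.1 z.2).re ∂lam.prod lam =
        ∫ z, (variationKernel f z.1 z.2).re ∂lam.prod lam := by
      refine integral_congr_ae ?_
      filter_upwards [hae2] with z hz
      simp only [variationKernel, hfS z.1 hz.1, hfS z.2 hz.2]
    have e2 : ∫ u, (deriv V u * g n u).re ∂lam = ∫ u, (deriv V u * f u).re ∂lam := by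
      refine integral_congr_ae ?_
      filter_upwards [hae] with z hz
      rw [hfS z hz]
    rw [← hfv, energyVariation, energyVariation, e1, e2]
  have hev : ∀ u : ℂ, ∀ᶠ n in atTop, g n u = k u := by
    intro u
    rcases eq_or_ne u 0 with rfl | hu
    · simp [hg, h0]
    · have hu' : 0 < ‖u‖ := norm_pos_iff.2 hu
      filter_upwards [eventually_ge_atTop ⌈max ‖u‖ (2 / ‖u‖)⌉₊] with n hn
      have h1 : max ‖u‖ (2 / ‖u‖) ≤ n + 1 := (Nat.le_ceil _).trans (by
        have : ((⌈max ‖u‖ (2 / ‖u‖)⌉₊ : ℕ) : ℝ) ≤ n := by exact_mod_cast hn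
        linarith)
      have h2 := (le_max_right _ _).trans h1
      rw [div_le_iff₀ hu'] at h2
      simp only [hg]
      rw [annulusCutoff_eq_one (hpos n) h2 ((le_max_left _ _).trans h1)]
      simp
  have hgc : ∀ n z, g n (starRingEnd ℂ z) = starRingEnd ℂ (g n z) := fun n z => by
    simp only [hg]
    rw [annulusCutoff_conj, hconj, map_mul, Complex.conj_ofReal]
  have hlim1 : Tendsto (fun n => ∫ z, (variationKernel (g n) z.1 z.2).re ∂lam.prod lam) atTop
      (𝓝 (∫ z, (variationKernel k z.1 z.2).re ∂lam.prod lam)) := by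
    refine tendsto_integral_of_dominated_convergence (fun _ => 2 * (L' : ℝ)) (fun n => ?_)
      (integrable_const _) (fun n => ?_) ?_
    · exact (measurable_variationKernel_re (hL' _ (hpos n)).continuous).aestronglyMeasurable
    · exact ae_of_all _ fun z => (Complex.abs_re_le_norm _).trans
        (norm_variationKernel_le (hL' _ (hpos n)) (hgc n) z.1 z.2)
    · refine ae_of_all _ fun z => tendsto_const_nhds.congr' ?_
      filter_upwards [hev z.1, hev z.2] with n h1 h2
      simp only [variationKernel, h1, h2]
  have hlim2 : Tendsto (fun n => ∫ u, (deriv V u * g n u).re ∂lam) atTop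
      (𝓝 (∫ u, (deriv V u * k u).re ∂lam)) := by
    have e : ∀ n u, deriv V u * g n u = (annulusCutoff (n + 1) u : ℂ) * (deriv V u * k u) :=
      fun n u => by simp only [hg]; ring
    refine tendsto_integral_of_dominated_convergence (fun u => ‖deriv V u * k u‖) (fun n => ?_)
      hint.norm (fun n => ?_) ?_
    · refine Complex.continuous_re.comp_aestronglyMeasurable ?_
      simp only [e]
      have hc : Continuous fun u : ℂ => (annulusCutoff (n + 1) u : ℂ) :=
        Complex.continuous_ofReal.comp (contDiff_annulusCutoff _).continuous
      exact hc.aestronglyMeasurable.mul hint.aestronglyMeasurable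
    · refine ae_of_all _ fun u => (Complex.abs_re_le_norm _).trans ?_
      rw [e, norm_mul, Complex.norm_real, Real.norm_eq_abs]
      exact mul_le_of_le_one_left (norm_nonneg _) (abs_annulusCutoff_le_one _ _)
    · refine ae_of_all _ fun u => tendsto_const_nhds.congr' ?_
      filter_upwards [hev u] with n h1
      rw [h1]
  have hlim : Tendsto (fun n => energyVariation V (g n) lam) atTop (𝓝 (energyVariation V k lam)) :=
    hlim1.neg.add (hlim2.const_mul 2)
  simp only [hg0] at hlim
  exact tendsto_nhds_unique hlim tendsto_const_nhds

/-! ### Extension of a test field to a Lipschitz field -/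

theorem exists_contDiff_eventuallyEq {h : ℂ → ℂ} {Z O : Set ℂ} (hZ : IsClosed Z) (hO : IsOpen O)
    (hZO : Z ⊆ O) (hh : ContDiffOn ℝ 1 h O) :
    ∃ H : ℂ → ℂ, ContDiff ℝ 1 H ∧ (∀ᶠ z in 𝓝ˢ Z, H z = h z) ∧ tsupport H ⊆ O := by
  obtain ⟨χ, hχ, hχ1, hχs⟩ := exists_contDiff_cutoff hZ hO hZO
  refine ⟨fun z => χ z • h z, contDiff_iff_contDiffAt.2 fun z => ?_, ?_,
    (tsupport_smul_subset_left χ h).trans hχs⟩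
  · by_cases hz : z ∈ O
    · exact hχ.contDiffAt.smul (hh.contDiffAt (hO.mem_nhds hz))
    · have h1 := notMem_tsupport_iff_eventuallyEq.1 fun h' => hz (hχs h')
      refine (contDiffAt_const (c := (0 : ℂ))).congr_of_eventuallyEq ?_
      filter_upwards [h1] with w hw
      simp [hw]
  · filter_upwards [hχ1] with z hz
    simp [hz]

/-- A field that is `C¹` near `∞` on the Riemann sphere and vanishes there is `C¹` with bounded
derivative outside a disc of the plane. -/
theorem exists_bound_fderiv_of_sphere {h : ℂ → ℂ}
    (hh : ContDiffAt ℝ 1 (fun w : ℂ => w ^ 2 * h w⁻¹) 0) :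
    ∃ R > 0, ∃ B : ℝ, ∀ z : ℂ, R < ‖z‖ → ContDiffAt ℝ 1 h z ∧ ‖fderiv ℝ h z‖ ≤ B := by
  set G : ℂ → ℂ := fun w => w ^ 2 * h w⁻¹ with hG
  have h1 : ∀ᶠ w in 𝓝 (0 : ℂ), ContDiffAt ℝ 1 G w := hh.eventually (by simp)
  have h2 : ContinuousAt (fderiv ℝ G) 0 := (hh.fderiv_right (m := 0) le_rfl).continuousAt
  have h3 : ∀ᶠ w in 𝓝 (0 : ℂ), ‖fderiv ℝ G w‖ < ‖fderiv ℝ G 0‖ + 1 :=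
    h2.norm.eventually_lt_const (lt_add_one _)
  set B := ‖fderiv ℝ G 0‖ + 1 with hB
  have hB0 : 0 ≤ B := by positivity
  obtain ⟨δ, hδ, hball⟩ := Metric.eventually_nhds_iff_ball.1 (h1.and h3)
  have hGn : ∀ w ∈ Metric.ball (0 : ℂ) δ, ‖G w‖ ≤ B * ‖w‖ := by
    intro w hw
    have := (convex_ball (0 : ℂ) δ).norm_image_sub_le_of_norm_fderiv_le (𝕜 := ℝ) (f := G) (C := B)
      (fun u hu => (hball u hu).1.differentiableAt one_ne_zero) (fun u hu => (hball u hu).2.le)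
      (Metric.mem_ball_self hδ) hw
    simpa [hG] using this
  refine ⟨δ⁻¹, inv_pos.2 hδ, 3 * B, fun z hz => ?_⟩
  have hz0 : z ≠ 0 := fun h0 => by
    rw [h0, norm_zero] at hz
    exact (inv_pos.2 hδ).not_gt hz
  have hzn : 0 < ‖z‖ := norm_pos_iff.2 hz0
  have hw : z⁻¹ ∈ Metric.ball (0 : ℂ) δ := by
    rw [mem_ball_zero_iff, norm_inv]
    exact inv_lt_of_inv_lt₀ hδ hz
  have heq : h =ᶠ[𝓝 z] fun y => y ^ 2 * G y⁻¹ := by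
    filter_upwards [isOpen_ne.mem_nhds hz0] with y hy
    have hy' : y ≠ 0 := hy
    simp only [hG, inv_inv]
    field_simp
  have hcd : ContDiffAt ℝ 1 (fun y : ℂ => y ^ 2 * G y⁻¹) z :=
    (contDiffAt_id.pow 2).mul ((hball _ hw).1.comp z (contDiffAt_inv ℝ hz0))
  refine ⟨hcd.congr_of_eventuallyEq heq, ?_⟩
  have d1 : HasFDerivAt (fun y : ℂ => y ^ 2)
      ((ContinuousLinearMap.toSpanSingleton ℂ (2 * z)).restrictScalars ℝ) z := by
    have := (hasDerivAt_pow 2 z).hasFDerivAt.restrictScalars ℝ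
    simpa using this
  have d2 : HasFDerivAt (fun y : ℂ => y⁻¹)
      ((ContinuousLinearMap.toSpanSingleton ℂ (-(z ^ 2)⁻¹)).restrictScalars ℝ) z :=
    (hasDerivAt_inv hz0).hasFDerivAt.restrictScalars ℝ
  have d3 := ((hball _ hw).1.differentiableAt one_ne_zero).hasFDerivAt
  have d4 := d1.mul (d3.comp z d2)
  rw [heq.fderiv_eq]
  have d5 : fderiv ℝ (fun y => y ^ 2 * G y⁻¹) z = _ := d4.fderiv
  rw [d5]
  refine ContinuousLinearMap.opNorm_le_bound _ (by positivity) fun y => ?_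
  have n1 : ‖fderiv ℝ G z⁻¹ (y * -(z ^ 2)⁻¹)‖ ≤ B * (‖y‖ * (‖z‖ ^ 2)⁻¹) := by
    refine ((fderiv ℝ G z⁻¹).le_opNorm _).trans ?_
    rw [norm_mul, norm_neg, norm_inv, norm_pow]
    have := (hball _ hw).2.le
    gcongr
  have n2 := hGn _ hw
  rw [norm_inv] at n2
  simp only [add_apply, smul_apply, Function.comp_apply, ContinuousLinearMap.comp_apply, ContinuousLinearMap.coe_restrictScalars',
    ContinuousLinearMap.toSpanSingleton_apply, smul_eq_mul]
  refine (norm_add_le _ _).trans ?_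
  rw [norm_mul (z ^ 2), norm_mul (G z⁻¹), norm_mul y, norm_mul 2, norm_pow, Complex.norm_ofNat]
  calc _ ≤ ‖z‖ ^ 2 * (B * (‖y‖ * (‖z‖ ^ 2)⁻¹)) + B * ‖z‖⁻¹ * (‖y‖ * (2 * ‖z‖)) := by gcongr
    _ = 3 * B * ‖y‖ := by field_simp; ring

theorem zero_mem_finitePart {A : ℝ} {Γ : Set (SlitClosure A)} (hΓ : IsContinuum Γ) :
    (0 : ℂ) ∈ finitePart Γ := ⟨_, hΓ.zeroPlus_mem, rfl⟩

/-- A test field agrees on `Γ ∪ Γ*` with a `C¹` Lipschitz field on the plane. -/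
theorem IsTestField.exists_lipschitz {A : ℝ} {Γ : Set (SlitClosure A)} (hΓ : IsContinuum Γ)
    {h : ℂ → ℂ} (hh : IsTestField Γ h) : ∃ (H : ℂ → ℂ) (L : NNReal), ContDiff ℝ 1 H ∧
      LipschitzWith L H ∧ ∀ z ∈ finitePart Γ, H z = h z ∧
        H (starRingEnd ℂ z) = h (starRingEnd ℂ z) := by
  obtain ⟨-, ⟨O, hO, hFO, hFO', hhO⟩, hinf⟩ := hh
  set Z := finitePart Γ ∪ starRingEnd ℂ ⁻¹' finitePart Γ with hZ
  have hZcl : IsClosed Z := hΓ.isClosed_finitePart.union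
    (hΓ.isClosed_finitePart.preimage Complex.continuous_conj)
  have hZO : Z ⊆ O := by
    rintro z (hz | hz)
    · exact hFO hz
    · exact hFO' ⟨_, hz, Complex.conj_conj z⟩
  have hmem : ∀ z ∈ finitePart Γ, z ∈ Z ∧ starRingEnd ℂ z ∈ Z := fun z hz =>
    ⟨Or.inl hz, Or.inr (by simpa using hz)⟩
  by_cases hc : ContainsInfty Γ
  · obtain ⟨R, hR, B, hB⟩ := exists_bound_fderiv_of_sphere (hinf hc)
    have hout : IsClosed {z : ℂ | 2 * R ≤ ‖z‖} := isClosed_le continuous_const continuous_norm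
    have hoR : IsOpen {z : ℂ | R < ‖z‖} := isOpen_lt continuous_const continuous_norm
    obtain ⟨H, hH, hHe, -⟩ := exists_contDiff_eventuallyEq (h := h) (hZcl.union hout) (hO.union hoR)
      (union_subset_union hZO fun z hz => by
        have hz' : 2 * R ≤ ‖z‖ := hz
        show R < ‖z‖
        linarith)
      (fun z hz => by
        rcases hz with hz | hz
        · exact (hhO.contDiffAt (hO.mem_nhds hz)).contDiffWithinAt
        · exact (hB z hz).1.contDiffWithinAt)
    obtain ⟨B', hB'⟩ := (isCompact_closedBall (0 : ℂ) (2 * R)).exists_bound_of_continuousOn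
      (hH.continuous_fderiv one_ne_zero).continuousOn
    have hbd : ∀ z, ‖fderiv ℝ H z‖ ≤ max B B' := by
      intro z
      rcases le_total ‖z‖ (2 * R) with h1 | h1
      · exact (hB' z (mem_closedBall_zero_iff.2 h1)).trans (le_max_right _ _)
      · have h2 : H =ᶠ[𝓝 z] h := hHe.filter_mono
          (nhds_le_nhdsSet (mem_union_right Z (show z ∈ {z : ℂ | 2 * R ≤ ‖z‖} from h1)))
        rw [h2.fderiv_eq]
        exact (hB z (by linarith)).2.trans (le_max_left _ _)
    refine ⟨H, (max B B').toNNReal, hH, lipschitzWith_of_nnnorm_fderiv_le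
      (hH.differentiable one_ne_zero) fun z => ?_, fun z hz => ?_⟩
    · rw [← NNReal.coe_le_coe, coe_nnnorm, Real.coe_toNNReal _ ((norm_nonneg _).trans (hbd z))]
      exact hbd z
    · have := hHe.self_of_nhdsSet
      exact ⟨this _ (Or.inl (hmem z hz).1), this _ (Or.inl (hmem z hz).2)⟩
  · have hFc := hΓ.isCompact_finitePart hc
    have hZc : IsCompact Z := by
      have : starRingEnd ℂ ⁻¹' finitePart Γ = starRingEnd ℂ '' finitePart Γ := by
        ext z
        exact ⟨fun hz => ⟨_, hz, Complex.conj_conj z⟩, by rintro ⟨w, hw, rfl⟩; simpa using hw⟩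
      rw [hZ, this]
      exact hFc.union (hFc.image Complex.continuous_conj)
    obtain ⟨R, hR⟩ := hZc.isBounded.subset_ball 0
    obtain ⟨H, hH, hHe, hHs⟩ := exists_contDiff_eventuallyEq (h := h) hZcl
      (hO.inter Metric.isOpen_ball) (subset_inter hZO hR) (hhO.mono inter_subset_left)
    have hHc : HasCompactSupport H := (isCompact_closedBall (0 : ℂ) R).of_isClosed_subset
      (isClosed_tsupport H) (hHs.trans (inter_subset_right.trans Metric.ball_subset_closedBall))
    obtain ⟨L, hL⟩ := hH.lipschitzWith_of_hasCompactSupport hHc one_ne_zero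
    have := hHe.self_of_nhdsSet
    exact ⟨H, L, hH, hL, fun z hz => ⟨this _ (hmem z hz).1, this _ (hmem z hz).2⟩⟩

/-! ### The antisymmetric extension -/

theorem measurableEmbedding_conj : MeasurableEmbedding (starRingEnd ℂ) :=
  Complex.continuous_conj.measurableEmbedding (starRingEnd ℂ).injective

section Antisymmetric

variable {lam : Measure ℂ} [IsFiniteMeasure lam] {S : Set ℂ}

theorem variation_antisymmetricExtension_le (lam : Measure ℂ) [IsFiniteMeasure lam] :
    (antisymmetricExtension lam).variation ≤ lam + lam.map (starRingEnd ℂ) := by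
  refine VectorMeasure.variation_sub_le.trans ?_
  rw [Measure.variation_toSignedMeasure, Measure.variation_toSignedMeasure]

theorem isFiniteMeasure_variation (lam : Measure ℂ) [IsFiniteMeasure lam] :
    IsFiniteMeasure (antisymmetricExtension lam).variation :=
  isFiniteMeasure_of_le _ (variation_antisymmetricExtension_le lam)

theorem ae_variation_of_ae {p : ℂ → Prop} (hp : MeasurableSet {z | p z}) (h1 : ∀ᵐ z ∂lam, p z)
    (h2 : ∀ᵐ z ∂lam, p (starRingEnd ℂ z)) :
    ∀ᵐ z ∂(antisymmetricExtension lam).variation, p z := by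
  refine (Measure.absolutelyContinuous_of_le
    (variation_antisymmetricExtension_le lam)).ae_le ?_
  change ∀ᵐ z ∂(lam + lam.map (starRingEnd ℂ)), p z
  rw [ae_add_measure_iff, ae_map_iff Complex.continuous_conj.measurable.aemeasurable hp]
  exact ⟨h1, h2⟩

theorem integrable_variation {f : ℂ → ℂ} (h1 : Integrable f lam)
    (h2 : Integrable (fun u => f (starRingEnd ℂ u)) lam) :
    Integrable f (antisymmetricExtension lam).variation :=
  (h1.add_measure (measurableEmbedding_conj.integrable_map_iff.2 h2)).mono_measure
    (variation_antisymmetricExtension_le lam)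

/-- In the open upper half-plane the antisymmetric extension of `lam` is `lam` itself. -/
theorem restrict_le_variation (hl : ∀ᵐ z ∂lam, 0 ≤ z.im) :
    lam.restrict {z | 0 < z.im} ≤ (antisymmetricExtension lam).variation := by
  refine Measure.le_iff.2 fun B hB => ?_
  have hP : MeasurableSet {z : ℂ | 0 < z.im} := isOpen_upperHalf.measurableSet
  have hBP := hB.inter hP
  rw [Measure.restrict_apply hB]
  refine le_trans ?_ (measure_mono (inter_subset_left (t := {z : ℂ | 0 < z.im})))
  refine le_trans (le_of_eq ?_) (VectorMeasure.enorm_measure_le_variation _ _)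
  have h0 : lam (starRingEnd ℂ ⁻¹' (B ∩ {z | 0 < z.im})) = 0 := by
    refine measure_mono_null (fun z hz => ?_) (ae_iff.1 hl)
    have h : 0 < (starRingEnd ℂ z).im := hz.2
    rw [Complex.conj_im] at h
    exact not_le.2 (by linarith : z.im < 0)
  have h1 : antisymmetricExtension lam (B ∩ {z | 0 < z.im}) = lam.real (B ∩ {z | 0 < z.im}) := by
    have e : (lam.map (starRingEnd ℂ)).real (B ∩ {z | 0 < z.im}) = 0 := by
      rw [measureReal_def, Measure.map_apply Complex.continuous_conj.measurable hBP, h0,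
        ENNReal.toReal_zero]
    unfold antisymmetricExtension
    rw [sub_apply, Measure.toSignedMeasure_apply_measurable hBP,
      Measure.toSignedMeasure_apply_measurable hBP, e, sub_zero]
  rw [h1, Real.enorm_eq_ofReal measureReal_nonneg, ofReal_measureReal]

/-- In the open lower half-plane the antisymmetric extension of `lam` is minus the reflection of
`lam`. -/
theorem restrict_map_le_variation (hl : ∀ᵐ z ∂lam, 0 ≤ z.im) :
    (lam.map (starRingEnd ℂ)).restrict {z | z.im < 0} ≤ (antisymmetricExtension lam).variation := by
  refine Measure.le_iff.2 fun B hB => ?_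
  have hP : MeasurableSet {z : ℂ | z.im < 0} :=
    measurableSet_lt Complex.measurable_im measurable_const
  have hBP := hB.inter hP
  rw [Measure.restrict_apply hB]
  refine le_trans ?_ (measure_mono (inter_subset_left (t := {z : ℂ | z.im < 0})))
  refine le_trans (le_of_eq ?_) (VectorMeasure.enorm_measure_le_variation _ _)
  have h0 : lam (B ∩ {z | z.im < 0}) = 0 :=
    measure_mono_null (fun z hz => not_le.2 hz.2) (ae_iff.1 hl)
  have h1 : antisymmetricExtension lam (B ∩ {z | z.im < 0}) =
      -(lam.map (starRingEnd ℂ)).real (B ∩ {z | z.im < 0}) := by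
    have e : lam.real (B ∩ {z | z.im < 0}) = 0 := by
      rw [measureReal_def, h0, ENNReal.toReal_zero]
    unfold antisymmetricExtension
    rw [sub_apply, Measure.toSignedMeasure_apply_measurable hBP,
      Measure.toSignedMeasure_apply_measurable hBP, e, zero_sub]
  rw [h1, enorm_neg, Real.enorm_eq_ofReal measureReal_nonneg, ofReal_measureReal]

/-- A function that vanishes at the only real point which the measure may charge, and is integrable
for the total variation of the antisymmetric extension, is integrable for the measure and for its
reflection: these do not cancel off the real line. -/
theorem integrable_of_integrable_variation (hS : ∀ᵐ z ∂lam, z = 0 ∨ 0 < z.im) {f : ℂ → ℂ}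
    (hf : Integrable f (antisymmetricExtension lam).variation) (hf0 : f 0 = 0) :
    Integrable f lam ∧ Integrable (fun u => f (starRingEnd ℂ u)) lam := by
  have hl : ∀ᵐ z ∂lam, 0 ≤ z.im := by
    filter_upwards [hS] with z hz
    rcases hz with rfl | hz
    · simp
    · exact hz.le
  have hP : MeasurableSet {z : ℂ | 0 < z.im} := isOpen_upperHalf.measurableSet
  have hN : MeasurableSet {z : ℂ | z.im < 0} :=
    measurableSet_lt Complex.measurable_im measurable_const
  constructor
  · have h1 : IntegrableOn f {z | 0 < z.im} lam := hf.mono_measure (restrict_le_variation hl)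
    refine (h1.integrable_indicator hP).congr ?_
    filter_upwards [hS] with z hz
    rcases hz with rfl | hz
    · simp [hf0]
    · exact indicator_of_mem (s := {z : ℂ | 0 < z.im}) hz f
  · have h1 : IntegrableOn f {z | z.im < 0} (lam.map (starRingEnd ℂ)) :=
      hf.mono_measure (restrict_map_le_variation hl)
    have h2 := measurableEmbedding_conj.integrable_map_iff.1 (h1.integrable_indicator hN)
    refine h2.congr ?_
    filter_upwards [hS] with z hz
    rcases hz with rfl | hz
    · simp [hf0]
    · have : (starRingEnd ℂ z).im < 0 := by simpa using hz
      exact indicator_of_mem (s := {z : ℂ | z.im < 0}) this f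

theorem integral_antisymmetricExtension {f : ℂ → ℂ} (h1 : Integrable f lam)
    (h2 : Integrable (fun u => f (starRingEnd ℂ u)) lam) :
    ∫ᵛ u, f u ∂<•(antisymmetricExtension lam) = ∫ u, (f u - f (starRingEnd ℂ u)) ∂lam := by
  have h3 : Integrable f (lam.map (starRingEnd ℂ)) := measurableEmbedding_conj.integrable_map_iff.2 h2
  unfold antisymmetricExtension
  rw [VectorMeasure.integral_sub_vectorMeasure, VectorMeasure.integral_toSignedMeasure,
    VectorMeasure.integral_toSignedMeasure, measurableEmbedding_conj.integral_map,
    integral_sub h1 h2]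
  · rw [VectorMeasure.Integrable, Measure.variation_toSignedMeasure]
    exact h1
  · rw [VectorMeasure.Integrable, Measure.variation_toSignedMeasure]
    exact h3

end Antisymmetric

/-! ### The identity for Lipschitz fields -/

/-- The field `H + H*`, symmetric under reflection. -/
noncomputable def symmetrisation (H : ℂ → ℂ) (z : ℂ) : ℂ :=
  H z + starRingEnd ℂ (H (starRingEnd ℂ z))

theorem symmetrisation_conj (H : ℂ → ℂ) (z : ℂ) :
    symmetrisation H (starRingEnd ℂ z) = starRingEnd ℂ (symmetrisation H z) := by
  simp [symmetrisation, add_comm]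

theorem contDiff_symmetrisation {H : ℂ → ℂ} (hH : ContDiff ℝ 1 H) :
    ContDiff ℝ 1 (symmetrisation H) :=
  hH.add (Complex.conjCLE.contDiff.comp (hH.comp Complex.conjCLE.contDiff))

theorem lipschitzWith_symmetrisation {H : ℂ → ℂ} {L : NNReal} (hH : LipschitzWith L H) :
    LipschitzWith (L + L) (symmetrisation H) := by
  refine hH.add (LipschitzWith.of_dist_le_mul fun u v => ?_)
  rw [Complex.dist_conj_conj]
  exact (hH.dist_le_mul _ _).trans (by rw [Complex.dist_conj_conj])

/-- The divided difference `(H(u) - H(v)) / (u - v)`. -/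
noncomputable def dividedDifference (H : ℂ → ℂ) (u v : ℂ) : ℂ := (H u - H v) / (u - v)

theorem measurable_dividedDifference {H : ℂ → ℂ} (hH : Continuous H) :
    Measurable fun p : ℂ × ℂ => dividedDifference H p.1 p.2 := by
  have := hH.measurable
  unfold dividedDifference
  fun_prop

/-- The four terms are those of the double integral of the divided difference against the
antisymmetric extension; two of them are conjugates of slopes of the symmetrised field. -/
theorem variationKernel_symmetrisation_re (H : ℂ → ℂ) (u v : ℂ) :
    (variationKernel (symmetrisation H) u v).re =
      (dividedDifference H u v - dividedDifference H u (starRingEnd ℂ v) -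
        (dividedDifference H (starRingEnd ℂ u) v -
          dividedDifference H (starRingEnd ℂ u) (starRingEnd ℂ v))).re := by
  have e1 : (symmetrisation H u - symmetrisation H v) / (u - v) = dividedDifference H u v +
      starRingEnd ℂ (dividedDifference H (starRingEnd ℂ u) (starRingEnd ℂ v)) := by
    simp only [symmetrisation, dividedDifference, map_div₀, map_sub, Complex.conj_conj, ← add_div]
    ring
  have e2 : (symmetrisation H u - starRingEnd ℂ (symmetrisation H v)) / (u - starRingEnd ℂ v) =
      dividedDifference H u (starRingEnd ℂ v) +
        starRingEnd ℂ (dividedDifference H (starRingEnd ℂ u) v) := by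
    simp only [symmetrisation, dividedDifference, map_div₀, map_sub, map_add, Complex.conj_conj,
      ← add_div]
    ring
  rw [variationKernel, e1, e2]
  simp only [Complex.sub_re, Complex.add_re, Complex.conj_re]
  ring

section Lipschitz

variable {lam : Measure ℂ} [IsFiniteMeasure lam] {S : Set ℂ} {h H : ℂ → ℂ} {L : NNReal}

/-- The divided difference of a Lipschitz function is bounded, and on the carrier of the measure the
test field agrees with a Lipschitz one. -/
theorem integrable_dividedDifference_variation (hS : MeasurableSet S) (hlS : ∀ᵐ z ∂lam, z ∈ S)
    (hL : LipschitzWith L H)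
    (hHh : ∀ z ∈ S, H z = h z ∧ H (starRingEnd ℂ z) = h (starRingEnd ℂ z)) :
    Integrable (fun p : ℂ × ℂ => (h p.1 - h p.2) / (p.1 - p.2))
      ((antisymmetricExtension lam).variation.prod (antisymmetricExtension lam).variation) := by
  have := isFiniteMeasure_variation lam
  have hZ : ∀ᵐ z ∂(antisymmetricExtension lam).variation, z ∈ S ∪ starRingEnd ℂ ⁻¹' S := by
    refine ae_variation_of_ae (hS.union (Complex.continuous_conj.measurable hS)) ?_ ?_
    · filter_upwards [hlS] with z hz using Or.inl hz
    · filter_upwards [hlS] with z hz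
      right
      simpa using hz
  have hZe : ∀ z ∈ S ∪ starRingEnd ℂ ⁻¹' S, H z = h z := by
    rintro z (hz | hz)
    · exact (hHh z hz).1
    · simpa using (hHh _ hz).2
  have hi : Integrable (fun p : ℂ × ℂ => dividedDifference H p.1 p.2)
      ((antisymmetricExtension lam).variation.prod (antisymmetricExtension lam).variation) :=
    (integrable_const (L : ℝ)).mono' (measurable_dividedDifference hL.continuous).aestronglyMeasurable
      (ae_of_all _ fun p => norm_slope_le hL p.1 p.2)
  refine hi.congr ?_
  filter_upwards [Measure.quasiMeasurePreserving_fst.ae hZ,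
    Measure.quasiMeasurePreserving_snd.ae hZ] with p h1 h2
  rw [dividedDifference, hZe _ h1, hZe _ h2]

/-- The double integral against the antisymmetric extension is the integral of the variation kernel
of the symmetrised field. -/
theorem re_integral_dividedDifference (hlS : ∀ᵐ z ∂lam, z ∈ S) (hL : LipschitzWith L H)
    (hHh : ∀ z ∈ S, H z = h z ∧ H (starRingEnd ℂ z) = h (starRingEnd ℂ z)) :
    (∫ᵛ u, (∫ᵛ v, (h u - h v) / (u - v) ∂<•(antisymmetricExtension lam))
      ∂<•(antisymmetricExtension lam)).re =
      ∫ z, (variationKernel (symmetrisation H) z.1 z.2).re ∂lam.prod lam := by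
  have hc := Complex.continuous_conj.measurable
  have hm := measurable_dividedDifference hL.continuous
  have hq : ∀ (f : ℂ → ℂ) (u : ℂ), Measurable f →
      Integrable (fun v => dividedDifference H u (f v)) lam := fun f u hf =>
    (integrable_const (L : ℝ)).mono' (hm.comp (measurable_const.prodMk hf)).aestronglyMeasurable
      (ae_of_all _ fun v => norm_slope_le hL u (f v))
  set J : ℂ → ℂ := fun u =>
    ∫ v, (dividedDifference H u v - dividedDifference H u (starRingEnd ℂ v)) ∂lam with hJ
  have hJm : StronglyMeasurable J := by
    refine StronglyMeasurable.integral_prod_right' (f := fun p : ℂ × ℂ =>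
      dividedDifference H p.1 p.2 - dividedDifference H p.1 (starRingEnd ℂ p.2)) ?_
    exact (hm.sub (hm.comp (measurable_fst.prodMk (hc.comp measurable_snd)))).stronglyMeasurable
  have hJb : ∀ u, ‖J u‖ ≤ (L + L) * lam.real univ := fun u =>
    norm_integral_le_of_norm_le_const (ae_of_all _ fun v => (norm_sub_le _ _).trans
      (add_le_add (norm_slope_le hL _ _) (norm_slope_le hL _ _)))
  have hJi : ∀ f : ℂ → ℂ, Measurable f → Integrable (fun u => J (f u)) lam := fun f hf =>
    (integrable_const ((L + L) * lam.real univ)).mono'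
      (hJm.comp_measurable hf).aestronglyMeasurable (ae_of_all _ fun u => hJb (f u))
  have hinner : ∀ u : ℂ, H u = h u →
      ∫ᵛ v, (h u - h v) / (u - v) ∂<•(antisymmetricExtension lam) = J u := by
    intro u hu
    have e1 : (fun v => dividedDifference H u v) =ᵐ[lam] fun v => (h u - h v) / (u - v) := by
      filter_upwards [hlS] with v hv
      rw [dividedDifference, hu, (hHh v hv).1]
    have e2 : (fun v => dividedDifference H u (starRingEnd ℂ v)) =ᵐ[lam]
        fun v => (h u - h (starRingEnd ℂ v)) / (u - starRingEnd ℂ v) := by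
      filter_upwards [hlS] with v hv
      rw [dividedDifference, hu, (hHh v hv).2]
    rw [integral_antisymmetricExtension ((hq _ u measurable_id).congr e1) ((hq _ u hc).congr e2)]
    exact integral_congr_ae (e1.symm.sub e2.symm)
  have o1 : J =ᵐ[lam] fun u => ∫ᵛ v, (h u - h v) / (u - v) ∂<•(antisymmetricExtension lam) := by
    filter_upwards [hlS] with u hu
    rw [hinner u (hHh u hu).1]
  have o2 : (fun u => J (starRingEnd ℂ u)) =ᵐ[lam] fun u =>
      ∫ᵛ v, (h (starRingEnd ℂ u) - h v) / (starRingEnd ℂ u - v) ∂<•(antisymmetricExtension lam) := by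
    filter_upwards [hlS] with u hu
    rw [hinner _ (hHh u hu).2]
  have i1 := hJi _ measurable_id
  have i2 := hJi _ hc
  have hKi : Integrable (fun z : ℂ × ℂ => (variationKernel (symmetrisation H) z.1 z.2).re)
      (lam.prod lam) := by
    have hLs := lipschitzWith_symmetrisation hL
    refine (integrable_const (2 * ((L + L : NNReal) : ℝ))).mono'
      (measurable_variationKernel_re hLs.continuous).aestronglyMeasurable (ae_of_all _ fun z => ?_)
    exact (Complex.abs_re_le_norm _).trans
      (norm_variationKernel_le hLs (symmetrisation_conj H) z.1 z.2)
  have hdiff : ∫ᵛ u, (∫ᵛ v, (h u - h v) / (u - v) ∂<•(antisymmetricExtension lam))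
      ∂<•(antisymmetricExtension lam) = ∫ u, (J u - J (starRingEnd ℂ u)) ∂lam := by
    rw [integral_antisymmetricExtension (i1.congr o1) (i2.congr o2)]
    exact integral_congr_ae (o1.symm.sub o2.symm)
  rw [hdiff, integral_prod _ hKi]
  have e3 := Complex.reCLM.integral_comp_comm (i1.sub i2)
  rw [Complex.reCLM_apply] at e3
  refine Eq.trans e3.symm (integral_congr_ae (ae_of_all _ fun u => ?_))
  have j1 := (hq _ u measurable_id).sub (hq _ u hc)
  have j2 := (hq _ (starRingEnd ℂ u) measurable_id).sub (hq _ (starRingEnd ℂ u) hc)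
  have e4 : J u - J (starRingEnd ℂ u) = ∫ v, (dividedDifference H u v -
      dividedDifference H u (starRingEnd ℂ v) - (dividedDifference H (starRingEnd ℂ u) v -
        dividedDifference H (starRingEnd ℂ u) (starRingEnd ℂ v))) ∂lam :=
    (integral_sub j1 j2).symm
  have e5 := Complex.reCLM.integral_comp_comm (j1.sub j2)
  simp only [Complex.reCLM_apply] at e5
  show (J u - J (starRingEnd ℂ u)).re = _
  rw [e4]
  refine Eq.trans e5.symm (integral_congr_ae (ae_of_all _ fun v => ?_))
  exact (variationKernel_symmetrisation_re H u v).symm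

/-- The field term, for a function `W` with `W(z*) = -W(z)*`: the two sign changes, of `W` and of the
measure, cancel, and the reflected part contributes `H*`. -/
theorem re_integral_field {W : ℂ → ℂ} (hlS : ∀ᵐ z ∂lam, z ∈ S)
    (hHh : ∀ z ∈ S, H z = h z ∧ H (starRingEnd ℂ z) = h (starRingEnd ℂ z)) (hH0 : H 0 = 0)
    (hW : ∀ z ∈ S, z = 0 ∨ W (starRingEnd ℂ z) = -starRingEnd ℂ (W z))
    (h1 : Integrable (fun u => W u * h u) lam)
    (h2 : Integrable (fun u => W (starRingEnd ℂ u) * h (starRingEnd ℂ u)) lam) :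
    Integrable (fun u => W u * symmetrisation H u) lam ∧
      (∫ᵛ u, W u * h u ∂<•(antisymmetricExtension lam)).re =
        ∫ u, (W u * symmetrisation H u).re ∂lam := by
  have key : ∀ u ∈ S, W u * symmetrisation H u = W u * h u -
      starRingEnd ℂ (W (starRingEnd ℂ u) * h (starRingEnd ℂ u)) := by
    intro u hu
    obtain ⟨e1, e2⟩ := hHh u hu
    rcases hW u hu with rfl | h3
    · rw [← e1, ← e2]
      simp [symmetrisation, hH0]
    · rw [h3, symmetrisation, e1, e2]
      simp
      ring
  have h2' : Integrable (fun u => starRingEnd ℂ (W (starRingEnd ℂ u) * h (starRingEnd ℂ u))) lam :=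
    Complex.conjCLE.toContinuousLinearMap.integrable_comp h2
  constructor
  · refine (h1.sub h2').congr ?_
    filter_upwards [hlS] with u hu
    exact (key u hu).symm
  · rw [integral_antisymmetricExtension h1 h2]
    have e := Complex.reCLM.integral_comp_comm (h1.sub h2)
    rw [Complex.reCLM_apply] at e
    refine Eq.trans e.symm (integral_congr_ae ?_)
    filter_upwards [hlS] with u hu
    rw [key u hu]
    simp

end Lipschitz

/-! ### Integrability of the field term -/

/-- Near the origin this is the bound in a sector, elsewhere continuity on a compact set. -/
theorem exists_norm_deriv_mul_le_of_isCompact {A : ℝ} {ρ : ℂ → ℂ} (hA : 0 < A)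
    (hρ : IsSpectralDensity A ρ) (x t : ℝ) {S : Set ℂ} (hS : IsCompact S)
    (hSΩ : ∀ z ∈ S, z = 0 ∨ z ∈ slitHalfPlane A) {c δ : ℝ} (hc : 0 < c) (hδ : 0 < δ)
    (hsec : ∀ z ∈ S, ‖z‖ < δ → c * ‖z‖ ≤ z.im) :
    ∃ C, ∀ z ∈ S, ‖deriv (complexField A ρ x t) z‖ * ‖z‖ ≤ C := by
  obtain ⟨C₁, hC₁⟩ := exists_norm_deriv_complexField_mul_le hA hρ x t hc
  set r := min δ (min 1 (A / 2)) with hr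
  have hr0 : 0 < r := lt_min hδ (lt_min one_pos (half_pos hA))
  have hK : IsCompact (S ∩ {z | r ≤ ‖z‖}) :=
    hS.inter_right (isClosed_le continuous_const continuous_norm)
  have hcont : ContinuousOn (fun z => ‖deriv (complexField A ρ x t) z‖ * ‖z‖)
      (S ∩ {z | r ≤ ‖z‖}) := by
    refine ContinuousOn.mul (ContinuousOn.norm ?_) continuous_norm.continuousOn
    refine ((differentiableOn_complexField hA hρ x t).deriv
      (isOpen_slitHalfPlane A)).continuousOn.mono ?_
    rintro z ⟨hz, hz'⟩
    refine (hSΩ z hz).resolve_left fun h0 => ?_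
    have h2 : r ≤ ‖z‖ := hz'
    rw [h0, norm_zero] at h2
    exact hr0.not_ge h2
  obtain ⟨C₂, hC₂⟩ := hK.exists_bound_of_continuousOn hcont
  refine ⟨max 0 (max C₁ C₂), fun z hz => ?_⟩
  rcases hSΩ z hz with rfl | hzΩ
  · simp
  rcases le_or_gt r ‖z‖ with h | h
  · exact (le_abs_self _).trans ((hC₂ z ⟨hz, h⟩).trans
      ((le_max_right _ _).trans (le_max_right _ _)))
  · have hz1 := h.trans_le ((min_le_right _ _).trans (min_le_left _ _))
    have hz2 := h.trans_le ((min_le_right _ _).trans (min_le_right _ _))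
    exact (hC₁ z hzΩ hz1.le hz2.le (hsec z hz (h.trans_le (min_le_left _ _)))).trans
      ((le_max_left _ _).trans (le_max_right _ _))

/-! ### The variational identity -/

theorem theorem6 (A : ℝ) (hA : 0 < A) (ρ : ℂ → ℂ) (hρ : IsSpectralDensity A ρ)
    (x t : ℝ) (hx : 0 ≤ x) (ht : 0 ≤ t)
    (Γ : Set (SlitClosure A)) (hΓ : IsContinuum Γ)
    (htan : NotTangentToReal Γ) (hslit : MeetsSlitOnlyAtZero Γ)
    (hcrit : IsCritical A ρ x t Γ)
    (lam : Measure ℂ) [IsFiniteMeasure lam]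
    (hlam : IsEquilibriumMeasure A ρ x t (finitePart Γ) lam)
    (μ : SignedMeasure ℂ) (hμ : μ = antisymmetricExtension lam)
    (h : ℂ → ℂ) (hh : IsTestField Γ h)
    (hinf : ContainsInfty Γ → μ.Integrable (fun u => deriv (complexField A ρ x t) u * h u)) :
    Integrable (fun p : ℂ × ℂ => (h p.1 - h p.2) / (p.1 - p.2))
        (μ.variation.prod μ.variation) ∧
      μ.Integrable (fun u => deriv (complexField A ρ x t) u * h u) ∧
      (∫ᵛ u, (∫ᵛ v, (h u - h v) / (u - v) ∂<•μ) ∂<•μ).re =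
        2 * (∫ᵛ u, deriv (complexField A ρ x t) u * h u ∂<•μ).re := by
  subst hμ
  have hF : finitePart Γ ⊆ {z | 0 ≤ z.im} := fun z hz => im_nonneg_of_mem_finitePart hz
  have hl := (isAdmissibleMeasure_iff hF).1 hlam.1
  have hmin : ∀ ν, IsCarriedEnergyMeasure (complexField A ρ x t) (finitePart Γ) ν →
      fieldEnergy (complexField A ρ x t) lam ≤ fieldEnergy (complexField A ρ x t) ν :=
    fun ν hν => hlam.2 ν ((isAdmissibleMeasure_iff hF).2 hν)
  obtain ⟨S, hSF, hScl, hS0, hSΩ⟩ := exists_isClosed_carrier hA hρ hΓ hslit hl hmin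
  obtain ⟨H, L, hH, hL, hHh⟩ := hh.exists_lipschitz hΓ
  have hHS : ∀ z ∈ S, H z = h z ∧ H (starRingEnd ℂ z) = h (starRingEnd ℂ z) :=
    fun z hz => hHh z (hSF hz)
  have hH0 : H 0 = 0 := ((hHh 0 (zero_mem_finitePart hΓ)).1).trans hh.1
  have hlS : ∀ᵐ z ∂lam, z ∈ S := by rw [ae_iff]; exact hS0
  set W := deriv (complexField A ρ x t) with hW
  -- At `0` the derivative of the field may be a junk value; the test field vanishes there.
  have hWconj : ∀ z ∈ S, z = 0 ∨ W (starRingEnd ℂ z) = -starRingEnd ℂ (W z) := fun z hz =>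
    (hSΩ z hz).imp_right fun h => deriv_complexField_conj hA hρ x t h
  have hW2 : Integrable (fun u => W u * h u) lam ∧
      Integrable (fun u => W (starRingEnd ℂ u) * h (starRingEnd ℂ u)) lam := by
    -- When the continuum is unbounded integrability is assumed, for the total variation; otherwise it
    -- follows from the sector condition, since `|V' h|` is at most a multiple of `|V'| |z|`.
    by_cases hc : ContainsInfty Γ
    · refine integrable_of_integrable_variation ?_ (hinf hc) (by simp [hh.1])
      filter_upwards [hlS] with z hz
      exact (hSΩ z hz).imp_right fun h => h.1
    · obtain ⟨c, hc0, δ, hδ, hsec⟩ := htan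
      obtain ⟨C, hC⟩ := exists_norm_deriv_mul_le_of_isCompact hA hρ x t
        ((hΓ.isCompact_finitePart hc).of_isClosed_subset hScl hSF) hSΩ hc0 hδ
        fun z hz => hsec z (hSF hz)
      have hHn : ∀ z, ‖H z‖ ≤ L * ‖z‖ := fun z => by simpa [hH0] using hL.norm_sub_le z 0
      have hWm : Measurable W := measurable_deriv _
      have hHm := hL.continuous.measurable
      have hcm := Complex.continuous_conj.measurable
      constructor
      · refine (integrable_const (L * C)).mono' ?_ ?_
        · refine (hWm.mul hHm).aestronglyMeasurable.congr ?_
          filter_upwards [hlS] with z hz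
          simp only [Pi.mul_apply, (hHS z hz).1]
        · filter_upwards [hlS] with z hz
          rw [← (hHS z hz).1, norm_mul]
          calc ‖W z‖ * ‖H z‖ ≤ ‖W z‖ * (L * ‖z‖) := by gcongr; exact hHn z
            _ = L * (‖W z‖ * ‖z‖) := by ring
            _ ≤ L * C := by gcongr; exact hC z hz
      · refine (integrable_const (L * C)).mono' ?_ ?_
        · refine ((hWm.comp hcm).mul (hHm.comp hcm)).aestronglyMeasurable.congr ?_
          filter_upwards [hlS] with z hz
          simp only [Pi.mul_apply, Function.comp_apply, (hHS z hz).2]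
        · filter_upwards [hlS] with z hz
          have hC' := hC z hz
          rcases hWconj z hz with rfl | hWz
          · rw [← (hHS 0 hz).2]
            simp only [map_zero, hH0, mul_zero, norm_zero] at hC' ⊢
            positivity
          · rw [← (hHS z hz).2, norm_mul, hWz, norm_neg, Complex.norm_conj]
            have := hHn (starRingEnd ℂ z)
            rw [Complex.norm_conj] at this
            calc ‖W z‖ * ‖H (starRingEnd ℂ z)‖ ≤ ‖W z‖ * (L * ‖z‖) := by gcongr
              _ = L * (‖W z‖ * ‖z‖) := by ring
              _ ≤ L * C := by gcongr
  obtain ⟨hk, hfield⟩ := re_integral_field hlS hHS hH0 hWconj hW2.1 hW2.2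
  refine ⟨integrable_dividedDifference_variation hScl.measurableSet hlS hL hHS,
    integrable_variation hW2.1 hW2.2, ?_⟩
  rw [re_integral_dividedDifference hlS hL hHS, hfield]
  -- The two sides are the two parts of the energy variation along the symmetrised field.
  have hvar := energyVariation_eq_zero_of_lipschitz (V := complexField A ρ x t)
    (isOpen_slitHalfPlane A) hScl hS0 hSΩ
    (fun k hk hc hs => hcrit.energyVariation_eq_zero hA hρ hl hmin hk hc hs)
    (contDiff_symmetrisation hH) (lipschitzWith_symmetrisation hL)
    (by simp [symmetrisation, hH0]) (symmetrisation_conj H) hk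
  unfold energyVariation at hvar
  linarith
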